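/- Let $N\ge 3$ be an integer and $\alpha\in(0,2)$. Let $g:\mathbb R^N\to\mathbb R$ satisfy condition (G): $g\in L^1_{\rm loc}(\mathbb R^N)$, the positive part $g^+=\max(g,0)$ is not almost everywhere zero, and $g^+=g_1+g_2$ almost everywhere for some $g_1,g_2:\mathbb R^N\to\mathbb R$ with $g_1\in L^{N/(2-\alpha)}(\mathbb R^N)$, $\lim_{x\to y}|x-y|^{2-\alpha}g_2(x)=0$ for every $y\in\mathbb R^N$, and $\lim_{|x|\to\infty}|x|^{2-\alpha}g_2(x)=0$. Let $W^{1,2}_\alpha(\mathbb R^N)$ be the completion of $C_0^\infty(\mathbb R^N)$ with respect to the norm $\|u\|_\alpha=\left(\int_{\mathbb R^N}|x|^\alpha|\nabla u|^2\,dx\right)^{1/2}$, realized as a space of functions on $\mathbb R^N$ modulo null sets: a function $u$ with gradient $\nabla u$ belongs to it if and only if there are $\varphi_n\in C_0^\infty(\mathbb R^N)$ with $\varphi_n\to u$ almost everywhere and $\int_{\mathbb R^N}|x|^\alpha|\nabla\varphi_n-\nabla u|^2\,dx\to0$. A number $\lambda>0$ is called an eigenvalue of the problem $$-\operatorname{div}(|x|^\alpha\nabla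 u)=\lambda\, g\,u\quad\text{on }\mathbb R^N$$ if there is $u\in W^{1,2}_\alpha(\mathbb R^N)\setminus\{0\}$ such that, for every $v\in W^{1,2}_\alpha(\mathbb R^N)$, the function $g\,u\,v$ is integrable and $$\int_{\mathbb R^N}|x|^\alpha\,\nabla u\cdot\nabla v\,dx=\lambda\int_{\mathbb R^N}g\,u\,v\,dx.$$ Then this problem has an unbounded increasing sequence of positive eigenvalues: there are eigenvalues $0<\lambda_1<\lambda_2<\cdots$ with $\lambda_n\to\infty$. -/

import Mathlib

open MeasureTheory Filter Topology
open scoped ContDiff ENNReal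

namespace WeightedEigen

/-- The Euclidean space `ℝ^N`. -/
abbrev Space (N : ℕ) : Type := EuclideanSpace ℝ (Fin N)

/-- The measure `|x|^α dx` on `ℝ^N`. -/
noncomputable def weightMeasure (N : ℕ) (α : ℝ) : Measure (Space N) :=
  (volume : Measure (Space N)).withDensity (fun x => ENNReal.ofReal (‖x‖ ^ α))

/-- `φ ∈ C₀^∞(ℝ^N)`. -/
def IsTestFunction {N : ℕ} (φ : Space N → ℝ) : Prop :=
  ContDiff ℝ ∞ φ ∧ HasCompactSupport φ

/-- `MemW α u G`: the function `u` belongs to `W^{1,2}_α(ℝ^N)`, the completion of `C₀^∞(ℝ^N)`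
for the norm `‖φ‖_α² = ∫ |x|^α |∇φ|² dx`, and `G` is its gradient: there are test functions `φ n`
with `φ n → u` almost everywhere and `∫ |x|^α |∇(φ n) - G|² dx → 0`.

By the Sobolev type inequality `(∫ |φ|^q)^{2/q} ≤ C ∫ |x|^α |∇φ|²`, `q = 2N/(N-2+α)`, every
Cauchy sequence of test functions has a subsequence with these properties, and `u` and `G`
determine each other up to null sets, so such `u` (modulo null sets) are precisely the elements of
the completion, with squared norm `∫ |x|^α |G|² dx`. -/
def MemW {N : ℕ} (α : ℝ) (u : Space N → ℝ) (G : Space N → Space N) : Prop :=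
  MemLp G 2 (weightMeasure N α) ∧
    ∃ φ : ℕ → Space N → ℝ,
      (∀ n, IsTestFunction (φ n)) ∧
      (∀ᵐ x ∂(volume : Measure (Space N)), Tendsto (fun n => φ n x) atTop (𝓝 (u x))) ∧
      Tendsto (fun n => eLpNorm (fun x => gradient (φ n) x - G x) 2 (weightMeasure N α))
        atTop (𝓝 0)

/-- Condition (G) on the weight function `g`; here `max (g x) 0` is the positive part of `g`. -/
structure ConditionG {N : ℕ} (α : ℝ) (g : Space N → ℝ) : Prop where
  locallyIntegrable : LocallyIntegrable g volume
  posPart_ne_zero : ¬ (fun x => max (g x) 0) =ᵐ[volume] (fun _ => (0 : ℝ))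
  decomposition : ∃ g₁ g₂ : Space N → ℝ,
    (∀ᵐ x ∂(volume : Measure (Space N)), max (g x) 0 = g₁ x + g₂ x) ∧
    MemLp g₁ (ENNReal.ofReal ((N : ℝ) / (2 - α))) volume ∧
    (∀ y : Space N, Tendsto (fun x => ‖x - y‖ ^ (2 - α) * g₂ x) (𝓝[≠] y) (𝓝 0)) ∧
    Tendsto (fun x => ‖x‖ ^ (2 - α) * g₂ x) (cocompact (Space N)) (𝓝 0)

/-- `lam > 0` is an eigenvalue of `-div(|x|^α ∇u) = lam g u` on `ℝ^N`: for some nonzero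
`u ∈ W^{1,2}_α(ℝ^N)` the weak equation holds against every `v ∈ W^{1,2}_α(ℝ^N)`, the integral on its
right-hand side being absolutely convergent (the one on the left always is, by Cauchy-Schwarz). -/
def IsEigenvalue {N : ℕ} (α : ℝ) (g : Space N → ℝ) (lam : ℝ) : Prop :=
  0 < lam ∧
    ∃ (u : Space N → ℝ) (G : Space N → Space N),
      MemW α u G ∧ ¬ u =ᵐ[volume] (fun _ => (0 : ℝ)) ∧
      ∀ (v : Space N → ℝ) (H : Space N → Space N), MemW α v H →
        Integrable (fun x => g x * u x * v x) volume ∧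
        ∫ x, ‖x‖ ^ α * inner ℝ (G x) (H x) = lam * ∫ x, g x * u x * v x

end WeightedEigen

/-! Write `g = g⁺ - g⁻`. A test function `φ` is identified with the triple `(∇φ, φ, φ)` in the
product of `L²(|x|^α dx)`, `L²(g⁻ dx)` and `L²(g⁺ dx)`, and `X` is the closure of these triples. On
`X` the equation reads `⟪x₁, z₁⟫ = λ (⟪x₃, z₃⟫ - ⟪x₂, z₂⟫)`, so eigenvectors are critical points of
`‖x₃‖² - ‖x₂‖²` on the sphere `‖x₁‖ = 1`. Since `g⁻` is only locally integrable, its form need not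
be bounded by the energy; carrying it as a separate component avoids any such bound, and it enters
with the favourable sign.

If `x₃` depends compactly on `x₁`, the supremum of the form is attained. Maximizing again on
orthogonal complements yields orthogonal eigenvectors as long as the form takes positive values
there, which bump functions at Lebesgue points of `{g > 0}` guarantee. If the eigenvalues were
bounded, the form would stay above a positive constant along this orthogonal sequence, against
compactness. This is `exists_large_eigenvalue`.

Compactness of the form of `g⁺` (`ConditionG.compactForm`) rests on two devices. Multiplication by
`|x|^(α/2)` sends functions of finite weighted energy to functions of finite unweighted energy, by
Hardy's inequality. Interpolation with the Hardy potential `|x|^(α-2)` then turns an unweighted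
bound for `U^(2/(2-α))` into a weighted bound for `U`. Hardy's inequality at an arbitrary centre
thus controls `|x - y|^(α-2)`, and Sobolev's inequality controls `L^(N/(2-α))`. Both summands of
`g⁺` are, up to form-small remainders, dominated by multiples of indicators of balls, and for those
Rellich's theorem applies.

It remains to test against every `v` in `W`, although `v` need not be square integrable for `g⁻ dx`.
Kato's inequality closes this gap: testing the equation with `sign(u) |v|` and dropping the
nonnegative term containing `|∇u|²` bounds `∫ g⁻ |u| |v|` by the energy norm of `v`
(`WeakEquation.exists_bound`). Both sides of the equation are then continuous in `v`, and density of
the test functions finishes the proof (`isEigenvalue_of_mem_formDomain`). -/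

namespace WeightedEigen

/-! ### Large eigenvalues of a pencil of quadratic forms on Hilbert spaces -/

section Abstract

variable {H₁ H₂ H₃ : Type*}
  [NormedAddCommGroup H₁] [InnerProductSpace ℝ H₁]
  [NormedAddCommGroup H₂] [InnerProductSpace ℝ H₂]
  [NormedAddCommGroup H₃] [InnerProductSpace ℝ H₃]

/-- The form `μ ⟪x₁, y₁⟫ + ⟪x₂, y₂⟫ - ⟪x₃, y₃⟫` on a product of three Hilbert spaces. -/
noncomputable def pencil (μ : ℝ) (x y : H₁ × H₂ × H₃) : ℝ :=
  μ * inner ℝ x.1 y.1 + inner ℝ x.2.1 y.2.1 - inner ℝ x.2.2 y.2.2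

lemma pencil_add_smul (μ t : ℝ) (x y : H₁ × H₂ × H₃) :
    pencil μ (x + t • y) (x + t • y) =
      pencil μ x x + 2 * t * pencil μ x y + t ^ 2 * pencil μ y y := by
  simp only [pencil, Prod.fst_add, Prod.snd_add, Prod.smul_fst, Prod.smul_snd, inner_add_left,
    inner_add_right, real_inner_smul_left, real_inner_smul_right]
  rw [real_inner_comm x.1 y.1, real_inner_comm x.2.1 y.2.1, real_inner_comm x.2.2 y.2.2]
  ring

lemma pencil_self (μ : ℝ) (x : H₁ × H₂ × H₃) :
    pencil μ x x = μ * ‖x.1‖ ^ 2 + ‖x.2.1‖ ^ 2 - ‖x.2.2‖ ^ 2 := by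
  simp [pencil]

/-- Null vectors of a positive semidefinite form lie in its kernel. -/
lemma pencil_eq_zero {Y : Submodule ℝ (H₁ × H₂ × H₃)} {μ : ℝ}
    (hpos : ∀ y ∈ Y, 0 ≤ pencil μ y y) {x : H₁ × H₂ × H₃} (hx : x ∈ Y) (h0 : pencil μ x x = 0)
    {y : H₁ × H₂ × H₃} (hy : y ∈ Y) : pencil μ x y = 0 := by
  have key : ∀ t : ℝ, 0 ≤ 2 * t * pencil μ x y + t ^ 2 * pencil μ y y := fun t => by
    have := hpos _ (Y.add_mem hx (Y.smul_mem t hy))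
    rwa [pencil_add_smul, h0, zero_add] at this
  have hyy := hpos y hy
  by_contra hne
  -- This is nearly the minimizer in `t`; the `+ 1` keeps the denominator positive when `pencil μ y
  -- y = 0`.
  have h1 := key (-(pencil μ x y) / (pencil μ y y + 1))
  have h2 : 2 * (-(pencil μ x y) / (pencil μ y y + 1)) * pencil μ x y
      + (-(pencil μ x y) / (pencil μ y y + 1)) ^ 2 * pencil μ y y
      = - (pencil μ x y) ^ 2 * (pencil μ y y + 2) / (pencil μ y y + 1) ^ 2 := by
    field_simp
    ring
  rw [h2] at h1
  have h3 : 0 < (pencil μ x y) ^ 2 * (pencil μ y y + 2) / (pencil μ y y + 1) ^ 2 := by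
    have : 0 < (pencil μ x y) ^ 2 := by positivity
    positivity
  have h4 : - (pencil μ x y) ^ 2 * (pencil μ y y + 2) / (pencil μ y y + 1) ^ 2
    = -((pencil μ x y) ^ 2 * (pencil μ y y + 2) / (pencil μ y y + 1) ^ 2) := by ring
  rw [h4] at h1
  linarith

/-- A quadratic form `‖x₃‖² - ‖x₂‖²`, with `x₃` depending compactly on `x₁`, attains its
supremum over the unit sphere `‖x₁‖ = 1`. -/
lemma exists_maximizer [CompleteSpace H₁] [CompleteSpace H₂] [CompleteSpace H₃]
    (Y : Submodule ℝ (H₁ × H₂ × H₃)) (hY : IsClosed (Y : Set (H₁ × H₂ × H₃)))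
    {C : ℝ} (hC : ∀ x ∈ Y, ‖x.2.2‖ ≤ C * ‖x.1‖)
    (htb : TotallyBounded ((fun x : H₁ × H₂ × H₃ => x.2.2) '' {x | x ∈ Y ∧ ‖x.1‖ ≤ 1}))
    (hpos : ∃ x ∈ Y, ‖x.2.1‖ < ‖x.2.2‖) :
    ∃ x ∈ Y, ‖x.1‖ = 1 ∧ ∃ μ : ℝ, 0 < μ ∧ ∀ z ∈ Y, pencil μ x z = 0 := by
  set q : H₁ × H₂ × H₃ → ℝ := fun x => ‖x.2.2‖ ^ 2 - ‖x.2.1‖ ^ 2 with hq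
  set S : Set ℝ := q '' {x | x ∈ Y ∧ ‖x.1‖ = 1} with hS
  have hscale : ∀ x ∈ Y, x.1 ≠ 0 → q x / ‖x.1‖ ^ 2 ∈ S := by
    intro x hx hx1
    have hn : ‖x.1‖ ≠ 0 := norm_ne_zero_iff.2 hx1
    refine ⟨(‖x.1‖⁻¹) • x, ⟨Y.smul_mem _ hx, ?_⟩, ?_⟩
    · simp [norm_smul, hn]
    · simp only [hq, Prod.smul_snd, Prod.smul_fst, norm_smul, norm_inv, norm_norm]
      field_simp
  have hbdd : BddAbove S := by
    refine ⟨C ^ 2, ?_⟩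
    rintro _ ⟨x, ⟨hx, hx1⟩, rfl⟩
    have h1 := hC x hx
    rw [hx1, mul_one] at h1
    have := pow_le_pow_left₀ (norm_nonneg _) h1 2
    simp only [hq]
    nlinarith [sq_nonneg ‖x.2.1‖]
  obtain ⟨x₀, hx₀, hx₀q⟩ := hpos
  have hzero : ∀ x ∈ Y, x.1 = 0 → x.2.2 = 0 := by
    intro x hx h
    have := hC x hx
    rw [h, norm_zero, mul_zero] at this
    exact norm_le_zero_iff.1 this
  have hx₀1 : x₀.1 ≠ 0 := by
    intro h
    have := hzero x₀ hx₀ h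
    rw [this, norm_zero] at hx₀q
    exact absurd hx₀q (not_lt.2 (norm_nonneg _))
  have hx₀S := hscale x₀ hx₀ hx₀1
  have hq0 : 0 < q x₀ / ‖x₀.1‖ ^ 2 := by
    have : 0 < ‖x₀.1‖ := norm_pos_iff.2 hx₀1
    have h2 : 0 < q x₀ := by
      have := pow_lt_pow_left₀ hx₀q (norm_nonneg _) two_ne_zero
      simp only [hq]; linarith
    positivity
  set μ := sSup S with hμ
  have hμ0 : 0 < μ := lt_of_lt_of_le hq0 (le_csSup hbdd hx₀S)
  -- By homogeneity, `μ` being an upper bound on the sphere means that the pencil is positive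
  -- semidefinite on `Y`. A maximizer is then a null vector of it, hence in its kernel.
  have hpsd : ∀ x ∈ Y, 0 ≤ pencil μ x x := by
    intro x hx
    rw [pencil_self]
    by_cases h : x.1 = 0
    · rw [hzero x hx h, h]
      simp
    · have h1 := le_csSup hbdd (hscale x hx h)
      have h2 : 0 < ‖x.1‖ ^ 2 := by have := norm_pos_iff.2 h; positivity
      rw [div_le_iff₀ h2] at h1
      simp only [hq] at h1
      linarith
  obtain ⟨s, -, hs_lim, hs_mem⟩ := exists_seq_tendsto_sSup (S := S) ⟨_, hx₀S⟩ hbdd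
  choose x hxY hxs using hs_mem
  have hcpt : IsCompact (closure ((fun x : H₁ × H₂ × H₃ => x.2.2) '' {x | x ∈ Y ∧ ‖x.1‖ ≤ 1})) :=
    htb.closure.isCompact_of_isClosed isClosed_closure
  obtain ⟨z, -, φ, hφ, hz⟩ := hcpt.tendsto_subseq (x := fun n => (x n).2.2)
    (fun n => subset_closure ⟨x n, ⟨(hxY n).1, (hxY n).2.le⟩, rfl⟩)
  set y : ℕ → H₁ × H₂ × H₃ := fun n => x (φ n) with hy
  have hyY : ∀ n, y n ∈ Y := fun n => (hxY _).1
  have hy1 : ∀ n, ‖(y n).1‖ = 1 := fun n => (hxY _).2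
  have hp : Tendsto (fun n => pencil μ (y n) (y n)) atTop (𝓝 0) := by
    have : Tendsto (fun n => μ - s (φ n)) atTop (𝓝 (μ - μ)) :=
      tendsto_const_nhds.sub (hs_lim.comp hφ.tendsto_atTop)
    rw [sub_self] at this
    refine this.congr fun n => ?_
    rw [pencil_self, hy1, ← hxs (φ n)]
    simp only [hq, hy]
    ring
  have hz3 : CauchySeq (fun n => (y n).2.2) := hz.cauchySeq
  have hpar : ∀ m n, pencil μ (y m - y n) (y m - y n)
      ≤ 2 * pencil μ (y m) (y m) + 2 * pencil μ (y n) (y n) := by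
    intro m n
    -- Parallelogram law, in which the value at `y m + y n` is nonnegative and is discarded.
    have h1 := hpsd _ (Y.add_mem (hyY m) (Y.smul_mem 1 (hyY n)))
    have h2 := pencil_add_smul μ (-1) (y m) (y n)
    rw [pencil_add_smul] at h1
    rw [neg_one_smul, ← sub_eq_add_neg] at h2
    linarith
  have hcauchy : CauchySeq y := by
    rw [Metric.cauchySeq_iff]
    intro ε hε
    -- For large indices `hpar` contributes less than `4 * δ` and the convergent third components
    -- less than `δ`, so that `μ ‖·‖² + ‖·‖² < 5 * δ` for the first two components of the
    -- difference. As `8 * δ = min 1 μ * ε ^ 2`, every component is smaller than `ε`. The form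
    -- subtracted in the maximization therefore converges without any compactness of its own.
    set δ := min 1 μ * ε ^ 2 / 8 with hδ
    have hm : 0 < min 1 μ := lt_min one_pos hμ0
    have hδ0 : 0 < δ := by positivity
    obtain ⟨N₁, hN₁⟩ := (Metric.tendsto_atTop.1 hp) δ hδ0
    obtain ⟨N₂, hN₂⟩ := (Metric.cauchySeq_iff.1 hz3) (Real.sqrt δ) (Real.sqrt_pos.2 hδ0)
    refine ⟨max N₁ N₂, fun m hm' n hn' => ?_⟩
    have a1 := hN₁ m (le_trans (le_max_left _ _) hm')
    have a2 := hN₁ n (le_trans (le_max_left _ _) hn')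
    have a3 := hN₂ m (le_trans (le_max_right _ _) hm') n (le_trans (le_max_right _ _) hn')
    rw [Real.dist_eq, sub_zero] at a1 a2
    have b1 := (le_abs_self _).trans_lt a1
    have b2 := (le_abs_self _).trans_lt a2
    have b3 : ‖(y m - y n).2.2‖ ^ 2 < δ := by
      rw [dist_eq_norm] at a3
      have := pow_lt_pow_left₀ a3 (norm_nonneg _) two_ne_zero
      rwa [Real.sq_sqrt hδ0.le] at this
    have h := hpar m n
    rw [pencil_self] at h
    have h5 : μ * ‖(y m - y n).1‖ ^ 2 + ‖(y m - y n).2.1‖ ^ 2 < 5 * δ := by linarith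
    have l1 : min 1 μ * ‖(y m - y n).1‖ ^ 2 ≤ μ * ‖(y m - y n).1‖ ^ 2 := by
      gcongr; exact min_le_right _ _
    have l2 : min 1 μ * ‖(y m - y n).2.1‖ ^ 2 ≤ ‖(y m - y n).2.1‖ ^ 2 := by
      have := mul_le_mul_of_nonneg_right (min_le_left 1 μ) (sq_nonneg ‖(y m - y n).2.1‖)
      linarith
    have l3 : min 1 μ * ‖(y m - y n).2.2‖ ^ 2 ≤ ‖(y m - y n).2.2‖ ^ 2 := by
      have := mul_le_mul_of_nonneg_right (min_le_left 1 μ) (sq_nonneg ‖(y m - y n).2.2‖)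
      linarith
    have h8 : 5 * δ < min 1 μ * ε ^ 2 := by
      have : 8 * δ = min 1 μ * ε ^ 2 := by rw [hδ]; ring
      linarith
    have fin : ∀ t : ℝ, 0 ≤ t → min 1 μ * t ^ 2 < min 1 μ * ε ^ 2 → t < ε := fun t ht h =>
      lt_of_pow_lt_pow_left₀ 2 hε.le (lt_of_mul_lt_mul_left h hm.le)
    rw [dist_eq_norm, Prod.norm_def, Prod.norm_def]
    refine max_lt (fin _ (norm_nonneg _) ?_) (max_lt (fin _ (norm_nonneg _) ?_)
      (fin _ (norm_nonneg _) ?_))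
    · nlinarith [sq_nonneg ‖(y m - y n).2.1‖]
    · nlinarith [sq_nonneg ‖(y m - y n).1‖, mul_nonneg hμ0.le (sq_nonneg ‖(y m - y n).1‖)]
    · linarith
  obtain ⟨w, hw⟩ := cauchySeq_tendsto_of_complete hcauchy
  have hwY : w ∈ Y := hY.mem_of_tendsto hw (Eventually.of_forall hyY)
  have hw1 : ‖w.1‖ = 1 := by
    have : Tendsto (fun n => ‖(y n).1‖) atTop (𝓝 ‖w.1‖) :=
      ((continuous_fst.norm).tendsto w).comp hw
    simp only [hy1] at this
    exact (tendsto_nhds_unique this tendsto_const_nhds)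
  have hw0 : pencil μ w w = 0 := by
    have hc : Continuous (fun x : H₁ × H₂ × H₃ => pencil μ x x) := by
      simp only [pencil]; fun_prop
    exact tendsto_nhds_unique ((hc.tendsto w).comp hw) hp
  exact ⟨w, hwY, hw1, μ, hμ0, fun z hz => pencil_eq_zero hpsd hwY hw0 hz⟩

/-- Existence of arbitrarily large generalized eigenvalues `λ` of
`⟪x₁, y₁⟫ = λ (⟪x₃, y₃⟫ - ⟪x₂, y₂⟫)` on a closed subspace of a product of Hilbert spaces. -/
theorem exists_large_eigenvalue [CompleteSpace H₁] [CompleteSpace H₂] [CompleteSpace H₃]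
    (X : Submodule ℝ (H₁ × H₂ × H₃))
    (hX : IsClosed (X : Set (H₁ × H₂ × H₃)))
    {C : ℝ} (hC : ∀ x ∈ X, ‖x.2.2‖ ≤ C * ‖x.1‖)
    (htb : TotallyBounded ((fun x : H₁ × H₂ × H₃ => x.2.2) '' {x | x ∈ X ∧ ‖x.1‖ ≤ 1}))
    (hpos : ∀ F : Finset H₁, ∃ x ∈ X, (∀ f ∈ F, inner ℝ f x.1 = 0) ∧ ‖x.2.1‖ < ‖x.2.2‖)
    (R : ℝ) :
    ∃ lam : ℝ, R < lam ∧ 0 < lam ∧ ∃ x ∈ X, x.1 ≠ 0 ∧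
      ∀ z ∈ X, inner ℝ x.1 z.1 = lam * (inner ℝ x.2.2 z.2.2 - inner ℝ x.2.1 z.2.1) := by
  classical
  by_contra hcon
  push Not at hcon
  set P : H₁ × H₂ × H₃ → Prop := fun x => x ∈ X ∧ ‖x.1‖ = 1 ∧ ∃ μ : ℝ, 0 < μ ∧
    ∀ z ∈ X, pencil μ x z = 0 with hP
  have hstep : ∀ s : Finset (H₁ × H₂ × H₃), (∀ x ∈ s, P x) →
      ∃ y, P y ∧ ∀ x ∈ s, inner ℝ x.1 y.1 = 0 := by
    intro s hs
    set L : Submodule ℝ (H₁ × H₂ × H₃) := Submodule.span ℝ (s : Set (H₁ × H₂ × H₃)) with hL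
    set K : Submodule ℝ H₁ := L.map (LinearMap.fst ℝ H₁ (H₂ × H₃)) with hK
    set Y : Submodule ℝ (H₁ × H₂ × H₃) := X ⊓ (Kᗮ).comap (LinearMap.fst ℝ H₁ (H₂ × H₃)) with hYd
    have hLX : L ≤ X := Submodule.span_le.2 fun x hx => (hs x hx).1
    have hYX : ∀ x ∈ Y, x ∈ X := fun x hx => hx.1
    have hYc : IsClosed (Y : Set (H₁ × H₂ × H₃)) := by
      rw [hYd, Submodule.coe_inf]
      exact hX.inter (K.isClosed_orthogonal.preimage continuous_fst)
    obtain ⟨w, hwY, hw1, μ, hμ, hw⟩ := exists_maximizer Y hYc (fun x hx => hC x (hYX x hx))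
      (htb.subset (by
        rintro _ ⟨x, ⟨hx, hx1⟩, rfl⟩
        exact ⟨x, ⟨hYX x hx, hx1⟩, rfl⟩))
      (by
        obtain ⟨x, hx, hxs, hlt⟩ := hpos (s.image Prod.fst)
        refine ⟨x, ⟨hx, ?_⟩, hlt⟩
        simp only [Submodule.mem_comap, LinearMap.fst_apply, SetLike.mem_coe, hK, hL]
        rw [Submodule.map_span]
        refine (Submodule.mem_orthogonal _ _).2 fun u hu => ?_
        induction hu using Submodule.span_induction with
        | mem u hu =>
          obtain ⟨f, hf, rfl⟩ := hu
          exact hxs _ (Finset.mem_image_of_mem _ hf)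
        | zero => simp
        | add a b _ _ ha hb => rw [inner_add_left, ha, hb, add_zero]
        | smul c a _ ha => rw [real_inner_smul_left, ha, mul_zero])
    have horth : ∀ u ∈ L, inner ℝ u.1 w.1 = 0 := fun u hu =>
      (Submodule.mem_orthogonal _ _).1 hwY.2 _ ⟨u, hu, rfl⟩
    -- An earlier critical vector `u` has its own parameter `ν`. Orthogonality of the first
    -- components removes the term containing `ν`, so the remaining two inner products cancel and
    -- the pencil vanishes for the new `μ` as well.
    have hker : ∀ u ∈ L, pencil μ w u = 0 := by
      intro u hu
      induction hu using Submodule.span_induction with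
      | mem u hu =>
        obtain ⟨huX, -, ν, hν, h⟩ := hs u hu
        have h1 := h w (hYX w hwY)
        have h2 := horth u (Submodule.subset_span hu)
        simp only [pencil, h2, real_inner_comm] at h1 ⊢
        rw [real_inner_comm u.1 w.1, h2]
        linarith
      | zero => simp [pencil]
      | add a b _ _ ha hb =>
        simp only [pencil, Prod.fst_add, Prod.snd_add, inner_add_right] at *
        linarith
      | smul c a _ ha =>
        simp only [pencil, Prod.smul_fst, Prod.smul_snd, real_inner_smul_right] at *
        linear_combination c * ha
    refine ⟨w, ⟨hYX w hwY, hw1, μ, hμ, fun z hz => ?_⟩,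
      fun x hx => horth x (Submodule.subset_span hx)⟩
    -- Finite dimension provides the orthogonal projection onto `K`. Subtracting from `z` an element
    -- of `L` with the projected first component leaves a vector of `Y`, so criticality on `Y`
    -- together with `hker` gives criticality on `X`.
    have hfin : FiniteDimensional ℝ L := FiniteDimensional.span_finset ℝ s
    obtain ⟨k, hk, r, hr, hkr⟩ := K.exists_add_mem_mem_orthogonal z.1
    obtain ⟨u, hu, rfl⟩ := hk
    have hzu : z - u ∈ Y := by
      refine ⟨X.sub_mem hz (hLX hu), ?_⟩
      simp only [Submodule.mem_comap, LinearMap.fst_apply, SetLike.mem_coe, Prod.fst_sub] at hkr ⊢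
      rw [hkr]
      simpa using hr
    have h1 := hw _ hzu
    have h2 := hker u hu
    simp only [pencil, Prod.fst_sub, Prod.snd_sub, inner_sub_right] at *
    linarith
  obtain ⟨f, hfP, hfr⟩ := exists_seq_of_forall_finset_exists P
    (fun x y => inner ℝ x.1 y.1 = 0) hstep
  set c : ℝ := 1 / (|R| + 1) with hc
  have hc0 : 0 < c := by positivity
  -- The value of the form at `f n` is its parameter `μ`. If it were below `c`, then `μ⁻¹ > |R| + 1`
  -- would be an eigenvalue exceeding `R`.
  have hq : ∀ n, c ≤ ‖(f n).2.2‖ ^ 2 - ‖(f n).2.1‖ ^ 2 := by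
    intro n
    obtain ⟨hX', h1, μ, hμ, h⟩ := hfP n
    have h2 := h _ hX'
    rw [pencil_self, h1] at h2
    by_contra hlt
    push Not at hlt
    have hμc : μ < c := by linarith
    have hRμ : R < μ⁻¹ := by
      have : c⁻¹ < μ⁻¹ := (inv_lt_inv₀ hc0 hμ).2 hμc
      rw [hc, one_div, inv_inv] at this
      have := le_abs_self R
      linarith
    obtain ⟨z, hz, hne⟩ := hcon μ⁻¹ hRμ (inv_pos.2 hμ) (f n) hX'
      (by rw [← norm_ne_zero_iff, h1]; exact one_ne_zero)
    apply hne
    have h3 := h z hz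
    simp only [pencil] at h3
    field_simp
    linarith
  have hcpt : IsCompact (closure ((fun x : H₁ × H₂ × H₃ => x.2.2) '' {x | x ∈ X ∧ ‖x.1‖ ≤ 1})) :=
    htb.closure.isCompact_of_isClosed isClosed_closure
  obtain ⟨z, -, φ, hφ, hz⟩ := hcpt.tendsto_subseq (x := fun n => (f n).2.2)
    (fun n => subset_closure ⟨f n, ⟨(hfP n).1, (hfP n).2.1.le⟩, rfl⟩)
  obtain ⟨M, hM⟩ := (Metric.cauchySeq_iff.1 hz.cauchySeq) (Real.sqrt c) (Real.sqrt_pos.2 hc0)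
  have hd := hM (M + 1) (Nat.le_succ M) M le_rfl
  set a := f (φ (M + 1)) with ha
  set b := f (φ M) with hb
  have hba : inner ℝ b.1 a.1 = 0 := hfr _ _ (hφ (Nat.lt_succ_self M))
  obtain ⟨hbX, -, μ, hμ, hbe⟩ := hfP (φ M)
  have hbe' := hbe a (hfP _).1
  simp only [pencil, ← hb, hba] at hbe'
  have hd' : ‖a.2.2 - b.2.2‖ ^ 2 < c := by
    simp only [Function.comp, dist_eq_norm] at hd
    have := pow_lt_pow_left₀ hd (norm_nonneg _) two_ne_zero
    rwa [Real.sq_sqrt hc0.le] at this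
  have hqa := hq (φ (M + 1))
  have hqb := hq (φ M)
  rw [← ha] at hqa
  rw [← hb] at hqb
  -- Orthogonality of the first components and the equation for `b` make the mixed inner products
  -- equal, so the form at `a - b` is the sum of its values at `a` and `b`, at least `2 * c`. This
  -- contradicts `‖a.2.2 - b.2.2‖ ^ 2 < c`.
  have e3 := norm_sub_sq_real a.2.2 b.2.2
  have e2 := norm_sub_sq_real a.2.1 b.2.1
  rw [real_inner_comm] at e2 e3
  nlinarith [sq_nonneg ‖a.2.1 - b.2.1‖]

end Abstract

variable {N : ℕ}

/-! ### Hardy's inequality with power weights -/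

lemma IsTestFunction.differentiable {φ : Space N → ℝ} (h : IsTestFunction φ) :
    Differentiable ℝ φ := h.1.differentiable (by simp)

lemma IsTestFunction.contDiff_one {φ : Space N → ℝ} (h : IsTestFunction φ) :
    ContDiff ℝ 1 φ := h.1.of_le (by exact_mod_cast le_top)

lemma IsTestFunction.continuous {φ : Space N → ℝ} (h : IsTestFunction φ) : Continuous φ :=
  h.1.continuous

lemma IsTestFunction.continuous_fderiv {φ : Space N → ℝ} (h : IsTestFunction φ) :
    Continuous (fderiv ℝ φ) := h.1.continuous_fderiv (by simp)

/-- The divergence theorem for the radial field `f(x) x`. -/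
lemma integral_dilation {f : Space N → ℝ} (hf : ContDiff ℝ 1 f) (hc : HasCompactSupport f) :
    ∫ x, ((N : ℝ) * f x + fderiv ℝ f x x) = 0 := by
  have hfd : Continuous (fderiv ℝ f) := hf.continuous_fderiv one_ne_zero
  have hfdi : ∀ i : Fin N, Continuous fun x : Space N =>
      x i * fderiv ℝ f x (EuclideanSpace.single i 1) := fun i => by fun_prop
  have hfdc : ∀ i : Fin N, HasCompactSupport fun x : Space N =>
      x i * fderiv ℝ f x (EuclideanSpace.single i 1) := fun i =>
    HasCompactSupport.mul_left (HasCompactSupport.comp_left (hc.fderiv ℝ)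
      (g := fun L : Space N →L[ℝ] ℝ => L (EuclideanSpace.single i 1)) (by simp))
  have hpart : ∀ i : Fin N, ∫ x : Space N, x i * fderiv ℝ f x (EuclideanSpace.single i 1)
      = - ∫ x, f x := by
    intro i
    have hd : ∀ x : Space N, fderiv ℝ (fun x : Space N => x i) x (EuclideanSpace.single i 1) = 1 := by
      intro x
      have : HasFDerivAt (fun x : Space N => x i) (EuclideanSpace.proj i : Space N →L[ℝ] ℝ) x :=
        (EuclideanSpace.proj i : Space N →L[ℝ] ℝ).hasFDerivAt
      rw [this.fderiv]
      simp
    have := integral_mul_fderiv_eq_neg_fderiv_mul_of_integrable (μ := (volume : Measure (Space N)))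
      (f := fun x : Space N => x i) (g := f) (v := EuclideanSpace.single i 1)
      (by simp only [hd, one_mul]; exact hf.continuous.integrable_of_hasCompactSupport hc)
      ((hfdi i).integrable_of_hasCompactSupport (hfdc i))
      ((Continuous.mul (by fun_prop) hf.continuous).integrable_of_hasCompactSupport hc.mul_left)
      (fun x _ => by fun_prop) (fun x _ => (hf.differentiable one_ne_zero) x)
    rw [this]
    simp only [hd, one_mul]
  have hsum : ∀ x : Space N, fderiv ℝ f x x =
      ∑ i, x i * fderiv ℝ f x (EuclideanSpace.single i 1) := by
    intro x
    conv_lhs => rw [show x = ∑ i, x i • (EuclideanSpace.single i (1 : ℝ) : Space N) from by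
      ext j; simp [Finset.sum_apply, Pi.single_apply]]
    rw [map_sum]
    refine Finset.sum_congr rfl fun i _ => ?_
    rw [map_smul, smul_eq_mul]
    congr 3
    ext j; simp [Finset.sum_apply, Pi.single_apply]
  simp only [hsum]
  rw [integral_add ((hf.continuous.integrable_of_hasCompactSupport hc).const_mul _)
    (integrable_finsetSum _ fun i _ => (hfdi i).integrable_of_hasCompactSupport (hfdc i)),
    integral_finsetSum _ fun i _ => (hfdi i).integrable_of_hasCompactSupport (hfdc i)]
  simp only [hpart, integral_const_mul]
  simp

/-- The regularized Hardy inequality. -/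
lemma hardy_regularized {β : ℝ} (hβ : β < 2) (hN : 0 < (N : ℝ) + β - 2)
    {φ : Space N → ℝ} (hφ : IsTestFunction φ) {ε : ℝ} (hε : 0 < ε) :
    ∫ x, (‖x‖ ^ 2 + ε) ^ ((β - 2) / 2) * φ x ^ 2 ≤
      (2 / ((N : ℝ) + β - 2)) ^ 2 *
        ∫ x, (‖x‖ ^ 2 + ε) ^ ((β - 2) / 2) * ‖x‖ ^ 2 * ‖fderiv ℝ φ x‖ ^ 2 := by
  set c := (N : ℝ) + β - 2 with hc
  have hpos : ∀ x : Space N, 0 < ‖x‖ ^ 2 + ε := fun x => by positivity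
  set w : Space N → ℝ := fun x => (‖x‖ ^ 2 + ε) ^ ((β - 2) / 2) with hw
  have hwpos : ∀ x, 0 < w x := fun x => Real.rpow_pos_of_pos (hpos x) _
  have hwd : ContDiff ℝ ∞ w :=
    ((contDiff_norm_sq ℝ).add contDiff_const).rpow_const_of_ne fun x => (hpos x).ne'
  have hwx : ∀ x, fderiv ℝ w x x =
      (β - 2) * (‖x‖ ^ 2 + ε) ^ ((β - 2) / 2 - 1) * ‖x‖ ^ 2 := by
    intro x
    have h1 : HasFDerivAt (fun y : Space N => ‖y‖ ^ 2 + ε) (2 • (innerSL ℝ x)) x :=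
      (hasStrictFDerivAt_norm_sq x).hasFDerivAt.add_const ε
    have h2 := h1.rpow_const (p := (β - 2) / 2) (Or.inl (hpos x).ne')
    rw [h2.fderiv]
    simp
    ring
  -- Here `‖x‖² / (‖x‖² + ε) ≤ 1`, and the factor `β - 2` is negative.
  have hwx' : ∀ x, (β - 2) * w x ≤ fderiv ℝ w x x := by
    intro x
    rw [hwx, Real.rpow_sub_one (hpos x).ne', mul_assoc]
    refine mul_le_mul_of_nonpos_left ?_ (by linarith)
    rw [div_mul_eq_mul_div, div_le_iff₀ (hpos x)]
    have := hwpos x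
    simp only [hw] at *
    nlinarith
  have hwc : Continuous w := hwd.continuous
  have hφc := hφ.continuous
  have hφd := hφ.continuous_fderiv
  have hφ2 : HasCompactSupport fun x => φ x ^ 2 :=
    hφ.2.comp_left (g := fun t : ℝ => t ^ 2) (by simp)
  have hdil := integral_dilation (f := fun x => w x * φ x ^ 2)
    ((hwd.of_le (by exact_mod_cast le_top)).mul (hφ.contDiff_one.pow 2)) hφ2.mul_left
  have hder : ∀ x, fderiv ℝ (fun x => w x * φ x ^ 2) x x =
      fderiv ℝ w x x * φ x ^ 2 + 2 * w x * φ x * fderiv ℝ φ x x := by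
    intro x
    have h1 := (hwd.differentiable (by simp) x).hasFDerivAt
    have h2 := (hφ.differentiable x).hasFDerivAt
    have h3 : HasFDerivAt (fun x => w x * φ x ^ 2) _ x := h1.mul (h2.pow 2)
    rw [h3.fderiv]
    simp
    ring
  simp only [hder] at hdil
  -- The right-hand side is the divergence of `w φ² x`, whose integral is zero. It is at least `c w
  -- φ² + 2 w φ (x · ∇φ)`, and completing the square in the mixed term costs half of the first one.
  have hpt : ∀ x, (c / 2) * (w x * φ x ^ 2) - (2 / c) * (w x * ‖x‖ ^ 2 * ‖fderiv ℝ φ x‖ ^ 2) ≤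
      (N : ℝ) * (w x * φ x ^ 2) + (fderiv ℝ w x x * φ x ^ 2 + 2 * w x * φ x * fderiv ℝ φ x x) := by
    intro x
    have h1 := mul_le_mul_of_nonneg_right (hwx' x) (sq_nonneg (φ x))
    have h2 : |fderiv ℝ φ x x| ≤ ‖fderiv ℝ φ x‖ * ‖x‖ := (fderiv ℝ φ x).le_opNorm x
    have h3 : (fderiv ℝ φ x x) ^ 2 ≤ ‖x‖ ^ 2 * ‖fderiv ℝ φ x‖ ^ 2 := by
      rw [← sq_abs, ← mul_pow, mul_comm ‖x‖]
      exact pow_le_pow_left₀ (abs_nonneg _) h2 2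
    have h4 : 0 ≤ w x * ((c / 2) * φ x ^ 2 + 2 * φ x * fderiv ℝ φ x x
        + (2 / c) * (‖x‖ ^ 2 * ‖fderiv ℝ φ x‖ ^ 2)) := by
      refine mul_nonneg (hwpos x).le ?_
      have h5 : (2 / c) * (fderiv ℝ φ x x) ^ 2 ≤ (2 / c) * (‖x‖ ^ 2 * ‖fderiv ℝ φ x‖ ^ 2) := by
        gcongr
      have h6 : (c / 2) * φ x ^ 2 + 2 * φ x * fderiv ℝ φ x x + (2 / c) * (fderiv ℝ φ x x) ^ 2
        = (c / 2) * (φ x + (2 / c) * fderiv ℝ φ x x) ^ 2 := by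
        field_simp
        ring
      have : 0 ≤ (c / 2) * (φ x + (2 / c) * fderiv ℝ φ x x) ^ 2 := by positivity
      linarith
    have : (N : ℝ) = c + 2 - β := by rw [hc]; ring
    rw [this]
    nlinarith
  have hA : Integrable fun x => w x * φ x ^ 2 :=
    (hwc.mul (hφc.pow 2)).integrable_of_hasCompactSupport hφ2.mul_left
  have hdc : HasCompactSupport fun x => ‖fderiv ℝ φ x‖ ^ 2 :=
    (hφ.2.fderiv ℝ).comp_left (g := fun L => ‖L‖ ^ 2) (by simp)
  have hB : Integrable fun x => w x * ‖x‖ ^ 2 * ‖fderiv ℝ φ x‖ ^ 2 :=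
    ((hwc.mul (continuous_norm.pow 2)).mul (hφd.norm.pow 2)).integrable_of_hasCompactSupport
      hdc.mul_left
  have hI : Integrable fun x => (N : ℝ) * (w x * φ x ^ 2) +
      (fderiv ℝ w x x * φ x ^ 2 + 2 * w x * φ x * fderiv ℝ φ x x) := by
    have hwd' : Continuous (fderiv ℝ w) := hwd.continuous_fderiv (by simp)
    refine (hA.const_mul _).add (Integrable.add ?_ ?_)
    · exact Continuous.integrable_of_hasCompactSupport (by fun_prop) hφ2.mul_left
    · refine Continuous.integrable_of_hasCompactSupport (by fun_prop) ?_
      exact HasCompactSupport.mul_right (hφ.2.mul_left)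
  have hint := integral_mono ((hA.const_mul (c / 2)).sub (hB.const_mul (2 / c))) hI hpt
  simp only [Pi.sub_apply] at hint
  rw [hdil, integral_sub (hA.const_mul (c / 2)) (hB.const_mul (2 / c)), integral_const_mul,
    integral_const_mul] at hint
  have hfin : (c / 2) * ∫ x, w x * φ x ^ 2 ≤ (2 / c) * ∫ x, w x * ‖x‖ ^ 2 * ‖fderiv ℝ φ x‖ ^ 2 := by
    linarith
  calc ∫ x, w x * φ x ^ 2 = (2 / c) * ((c / 2) * ∫ x, w x * φ x ^ 2) := by field_simp
    _ ≤ (2 / c) * ((2 / c) * ∫ x, w x * ‖x‖ ^ 2 * ‖fderiv ℝ φ x‖ ^ 2) := by gcongr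
    _ = _ := by ring

/-- The energy `∫ |x|^β |∇φ|²`. -/
noncomputable def energy (β : ℝ) (φ : Space N → ℝ) : ℝ≥0∞ :=
  ∫⁻ x, ‖x‖ₑ ^ β * ‖fderiv ℝ φ x‖ₑ ^ 2

/-- The potential `V` is form bounded with respect to the energy: `∫ V φ² ≤ C ∫ |x|^β |∇φ|²`. -/
def FormBound (β : ℝ) (V : Space N → ℝ≥0∞) (C : ℝ≥0∞) : Prop :=
  ∀ φ : Space N → ℝ, IsTestFunction φ → ∫⁻ x, V x * ‖φ x‖ₑ ^ 2 ≤ C * energy β φ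

lemma ae_ne_point (hN : 0 < N) (y : Space N) : ∀ᵐ x : Space N, x ≠ y := by
  have : NeZero N := ⟨hN.ne'⟩
  exact compl_mem_ae_iff.2 (measure_singleton y)

lemma enorm_rpow_eq {E : Type*} [NormedAddCommGroup E] {x : E} (hx : x ≠ 0) (s : ℝ) :
    ‖x‖ₑ ^ s = ENNReal.ofReal (‖x‖ ^ s) := by
  rw [← ofReal_norm, ENNReal.ofReal_rpow_of_pos (norm_pos_iff.2 hx)]

lemma enorm_sq_eq {E : Type*} [SeminormedAddCommGroup E] (x : E) :
    ‖x‖ₑ ^ 2 = ENNReal.ofReal (‖x‖ ^ 2) := by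
  rw [← ofReal_norm, ENNReal.ofReal_pow (norm_nonneg _)]

/-- Fatou's lemma for an almost everywhere convergent sequence. -/
lemma lintegral_le_of_tendsto_of_le {X : Type*} [MeasurableSpace X] {μ : Measure X}
    {f : ℕ → X → ℝ≥0∞} {F : X → ℝ≥0∞} {b : ℕ → ℝ≥0∞} {B : ℝ≥0∞} (hf : ∀ n, AEMeasurable (f n) μ)
    (hlim : ∀ᵐ x ∂μ, Tendsto (fun n => f n x) atTop (𝓝 (F x)))
    (hb : ∀ n, ∫⁻ x, f n x ∂μ ≤ b n) (hB : Tendsto b atTop (𝓝 B)) : ∫⁻ x, F x ∂μ ≤ B := by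
  calc ∫⁻ x, F x ∂μ = ∫⁻ x, liminf (fun n => f n x) atTop ∂μ :=
        lintegral_congr_ae (hlim.mono fun x hx => hx.liminf_eq.symm)
    _ ≤ liminf (fun n => ∫⁻ x, f n x ∂μ) atTop := lintegral_liminf_le' hf
    _ ≤ liminf b atTop := liminf_le_liminf (Eventually.of_forall hb)
    _ = B := hB.liminf_eq

lemma lintegral_le_of_tendsto {X : Type*} [MeasurableSpace X] {μ : Measure X} {f : ℕ → X → ℝ≥0∞}
    {F : X → ℝ≥0∞} {B : ℝ≥0∞} (hf : ∀ n, AEMeasurable (f n) μ)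
    (hlim : ∀ᵐ x ∂μ, Tendsto (fun n => f n x) atTop (𝓝 (F x)))
    (hB : ∀ n, ∫⁻ x, f n x ∂μ ≤ B) : ∫⁻ x, F x ∂μ ≤ B :=
  lintegral_le_of_tendsto_of_le hf hlim hB tendsto_const_nhds

lemma tendsto_inv_succ : Tendsto (fun n : ℕ => 1 / ((n : ℝ) + 1)) atTop (𝓝 0) :=
  tendsto_one_div_add_atTop_nhds_zero_nat

/-- Hardy's inequality. -/
lemma hardy {β : ℝ} (hβ : β < 2) (hN0 : 0 < N) (hN : 0 < (N : ℝ) + β - 2) :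
    FormBound (N := N) β (fun x => ‖x‖ₑ ^ (β - 2))
      (ENNReal.ofReal ((2 / ((N : ℝ) + β - 2)) ^ 2)) := by
  intro φ hφ
  set K := (2 / ((N : ℝ) + β - 2)) ^ 2 with hK
  have hφc := hφ.continuous
  have hφd := hφ.continuous_fderiv
  set ε : ℕ → ℝ := fun n => 1 / ((n : ℝ) + 1) with hε
  have hεpos : ∀ n, 0 < ε n := fun n => by simp only [hε]; positivity
  have hwc : ∀ n, Continuous fun x : Space N => (‖x‖ ^ 2 + ε n) ^ ((β - 2) / 2) := fun n =>
    Continuous.rpow_const (by fun_prop) fun x => Or.inl (by have := hεpos n; positivity)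
  have hmono : ∀ n (x : Space N), x ≠ 0 →
      (‖x‖ ^ 2 + ε n) ^ ((β - 2) / 2) * ‖x‖ ^ 2 ≤ ‖x‖ ^ β := by
    intro n x hx
    have hx0 : 0 < ‖x‖ := norm_pos_iff.2 hx
    have h1 : (‖x‖ ^ 2 + ε n) ^ ((β - 2) / 2) ≤ (‖x‖ ^ 2) ^ ((β - 2) / 2) :=
      Real.rpow_le_rpow_of_nonpos (by positivity) (by linarith [hεpos n]) (by linarith)
    calc _ ≤ (‖x‖ ^ 2) ^ ((β - 2) / 2) * ‖x‖ ^ 2 := by gcongr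
      _ = ‖x‖ ^ β := by
        rw [← Real.rpow_natCast, ← Real.rpow_mul hx0.le, ← Real.rpow_add hx0]
        congr 1; push_cast; ring
  -- Fatou's lemma as `ε` tends to `0`. The regularized weights increase to the singular ones
  -- because `β < 2`, so the gradient side is bounded uniformly.
  refine lintegral_le_of_tendsto
    (f := fun n x => ENNReal.ofReal ((‖x‖ ^ 2 + ε n) ^ ((β - 2) / 2) * φ x ^ 2)) (fun n => ?_) ?_ ?_
  · exact (ENNReal.continuous_ofReal.comp ((hwc n).mul (hφc.pow 2))).aemeasurable
  · filter_upwards [ae_ne_point hN0 0] with x hx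
    have hx0 : 0 < ‖x‖ := norm_pos_iff.2 hx
    rw [enorm_rpow_eq hx, enorm_sq_eq, ← ENNReal.ofReal_mul (by positivity), Real.norm_eq_abs,
      sq_abs]
    refine ENNReal.tendsto_ofReal (Tendsto.mul_const _ ?_)
    have h1 : Tendsto (fun n => ‖x‖ ^ 2 + ε n) atTop (𝓝 (‖x‖ ^ 2 + 0)) :=
      tendsto_const_nhds.add tendsto_inv_succ
    rw [add_zero] at h1
    have h2 := h1.rpow_const (p := (β - 2) / 2) (Or.inl (by positivity))
    have h3 : (‖x‖ ^ 2) ^ ((β - 2) / 2) = ‖x‖ ^ (β - 2) := by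
      rw [← Real.rpow_natCast, ← Real.rpow_mul hx0.le]
      congr 1; push_cast; ring
    rwa [h3] at h2
  · intro n
    have hφ2 : HasCompactSupport fun x => φ x ^ 2 :=
      hφ.2.comp_left (g := fun t : ℝ => t ^ 2) (by simp)
    have hdc : HasCompactSupport fun x => ‖fderiv ℝ φ x‖ ^ 2 :=
      (hφ.2.fderiv ℝ).comp_left (g := fun L => ‖L‖ ^ 2) (by simp)
    have hA : Integrable fun x => (‖x‖ ^ 2 + ε n) ^ ((β - 2) / 2) * φ x ^ 2 :=
      ((hwc n).mul (hφc.pow 2)).integrable_of_hasCompactSupport hφ2.mul_left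
    have hB : Integrable fun x => (‖x‖ ^ 2 + ε n) ^ ((β - 2) / 2) * ‖x‖ ^ 2
        * ‖fderiv ℝ φ x‖ ^ 2 :=
      (((hwc n).mul (continuous_norm.pow 2)).mul (hφd.norm.pow 2)).integrable_of_hasCompactSupport
        hdc.mul_left
    have hw0 : ∀ x : Space N, 0 ≤ (‖x‖ ^ 2 + ε n) ^ ((β - 2) / 2) := fun x =>
      Real.rpow_nonneg (by have := hεpos n; positivity) _
    rw [← ofReal_integral_eq_lintegral_ofReal hA
      (Eventually.of_forall fun x => mul_nonneg (hw0 x) (sq_nonneg _))]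
    refine (ENNReal.ofReal_le_ofReal (hardy_regularized hβ hN hφ (hεpos n))).trans ?_
    rw [ENNReal.ofReal_mul (by positivity), ofReal_integral_eq_lintegral_ofReal hB
      (Eventually.of_forall fun x => mul_nonneg (mul_nonneg (hw0 x) (sq_nonneg _)) (sq_nonneg _))]
    gcongr
    refine lintegral_mono_ae ?_
    filter_upwards [ae_ne_point hN0 0] with x hx
    rw [enorm_rpow_eq hx, enorm_sq_eq, ← ENNReal.ofReal_mul (by positivity)]
    exact ENNReal.ofReal_le_ofReal (by gcongr; exact hmono n x hx)

/-! ### From unweighted to weighted energy -/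

/-- The smooth weight `|x|² (|x|² + ε)^(α/4 - 1)`, an approximation from below of `|x|^(α/2)`. -/
noncomputable def smoothWeight (α ε : ℝ) (x : Space N) : ℝ :=
  ‖x‖ ^ 2 * (‖x‖ ^ 2 + ε) ^ (α / 4 - 1)

lemma smoothWeight_nonneg {α ε : ℝ} (hε : 0 < ε) (x : Space N) : 0 ≤ smoothWeight α ε x :=
  mul_nonneg (sq_nonneg _) (Real.rpow_nonneg (by positivity) _)

lemma contDiff_smoothWeight {α ε : ℝ} (hε : 0 < ε) :
    ContDiff ℝ ∞ (smoothWeight α ε : Space N → ℝ) :=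
  (contDiff_norm_sq ℝ).mul (((contDiff_norm_sq ℝ).add contDiff_const).rpow_const_of_ne fun x => by
    positivity)

lemma smoothWeight_le {α ε : ℝ} (hα : α < 4) (hε : 0 < ε) {x : Space N} (hx : x ≠ 0) :
    smoothWeight α ε x ≤ ‖x‖ ^ (α / 2) := by
  have hx0 : 0 < ‖x‖ := norm_pos_iff.2 hx
  have h1 : (‖x‖ ^ 2 + ε) ^ (α / 4 - 1) ≤ (‖x‖ ^ 2) ^ (α / 4 - 1) :=
    Real.rpow_le_rpow_of_nonpos (by positivity) (by linarith) (by linarith)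
  calc _ ≤ ‖x‖ ^ 2 * (‖x‖ ^ 2) ^ (α / 4 - 1) := by unfold smoothWeight; gcongr
    _ = ‖x‖ ^ (α / 2) := by
      rw [← Real.rpow_natCast, ← Real.rpow_mul hx0.le, ← Real.rpow_add hx0]
      congr 1; push_cast; ring

/-- Each of the two terms of the product rule is at most `2 ‖x‖ (‖x‖² + ε)^(α/4 - 1)`. The bound
does not involve `ε`, which is what the limit in the smoothing parameter requires. -/
lemma norm_fderiv_smoothWeight_le {α ε : ℝ} (hα0 : 0 < α) (hα : α < 4) (hε : 0 < ε)
    {x : Space N} (hx : x ≠ 0) :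
    ‖fderiv ℝ (smoothWeight α ε) x‖ ≤ 4 * ‖x‖ ^ (α / 2 - 1) := by
  have hx0 : 0 < ‖x‖ := norm_pos_iff.2 hx
  have hp : 0 < ‖x‖ ^ 2 + ε := by positivity
  obtain ⟨T, hT⟩ : ∃ T : Space N →L[ℝ] ℝ, T = 2 • (innerSL ℝ x) := ⟨_, rfl⟩
  have h0 : HasFDerivAt (fun y : Space N => ‖y‖ ^ 2) T x :=
    hT ▸ (hasStrictFDerivAt_norm_sq x).hasFDerivAt
  have h2 := (h0.add_const ε).rpow_const (p := α / 4 - 1) (Or.inl hp.ne')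
  have h3 : HasFDerivAt (smoothWeight α ε) _ x := h0.mul h2
  rw [h3.fderiv]
  have hle : (‖x‖ ^ 2 + ε) ^ (α / 4 - 1) ≤ (‖x‖ ^ 2) ^ (α / 4 - 1) :=
    Real.rpow_le_rpow_of_nonpos (by positivity) (by linarith) (by linarith)
  have hrp : 0 < (‖x‖ ^ 2 + ε) ^ (α / 4 - 1) := Real.rpow_pos_of_pos hp _
  have hsub : (‖x‖ ^ 2 + ε) ^ (α / 4 - 1 - 1) * ‖x‖ ^ 2 ≤ (‖x‖ ^ 2 + ε) ^ (α / 4 - 1) := by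
    rw [Real.rpow_sub_one hp.ne', div_mul_eq_mul_div, div_le_iff₀ hp]
    nlinarith
  have hnn : ‖T‖ = 2 * ‖x‖ := by
    rw [hT, ← Nat.cast_smul_eq_nsmul ℝ, norm_smul, innerSL_apply_norm]
    simp
  have hE : ‖x‖ * (‖x‖ ^ 2) ^ (α / 4 - 1) = ‖x‖ ^ (α / 2 - 1) := by
    rw [← Real.rpow_natCast, ← Real.rpow_mul hx0.le]
    nth_rewrite 1 [← Real.rpow_one ‖x‖]
    rw [← Real.rpow_add hx0]
    congr 1; push_cast; ring
  refine (norm_add_le _ _).trans ?_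
  rw [norm_smul, norm_smul, norm_smul, hnn, Real.norm_eq_abs, Real.norm_eq_abs, Real.norm_eq_abs,
    abs_mul, abs_of_nonneg (sq_nonneg ‖x‖), abs_of_pos hrp,
    abs_of_pos (Real.rpow_pos_of_pos hp _), abs_of_neg (by linarith : α / 4 - 1 < 0), ← hE]
  set A := (‖x‖ ^ 2 + ε) ^ (α / 4 - 1)
  set B := (‖x‖ ^ 2 + ε) ^ (α / 4 - 1 - 1)
  have hB0 : 0 < B := Real.rpow_pos_of_pos hp _
  have h5 : ‖x‖ ^ 2 * (-(α / 4 - 1) * B * (2 * ‖x‖)) ≤ 2 * ‖x‖ * A := by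
    have : -(α / 4 - 1) * (B * ‖x‖ ^ 2) ≤ 1 * A :=
      mul_le_mul (by linarith) hsub (by positivity) zero_le_one
    nlinarith
  have h6 : ‖x‖ * A ≤ ‖x‖ * (‖x‖ ^ 2) ^ (α / 4 - 1) := by gcongr
  nlinarith

lemma isTestFunction_smoothWeight_mul {α ε : ℝ} (hε : 0 < ε) {φ : Space N → ℝ}
    (hφ : IsTestFunction φ) : IsTestFunction fun x => smoothWeight α ε x * φ x :=
  ⟨(contDiff_smoothWeight hε).mul hφ.1, hφ.2.mul_left⟩

/-- The constant relating the energy of `|x|^(α/2) φ` to the weighted energy of `φ`. -/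
noncomputable def transferConst (N : ℕ) (α : ℝ) : ℝ≥0∞ :=
  2 + 32 * ENNReal.ofReal ((2 / ((N : ℝ) + α - 2)) ^ 2)

lemma transferConst_ne_top : transferConst N α ≠ ⊤ := by
  unfold transferConst
  finiteness

/-- By the product rule and `(a + b)² ≤ 2a² + 2b²`, the gradient of the weight contributes `2 · 4² =
32` times the Hardy potential, which Hardy's inequality absorbs into the weighted energy. -/
lemma energy_smoothWeight_mul_le {α ε : ℝ} (hα0 : 0 < α) (hα : α < 2) (hN : 2 ≤ N) (hε : 0 < ε)
    {φ : Space N → ℝ} (hφ : IsTestFunction φ) :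
    energy 0 (fun x => smoothWeight α ε x * φ x) ≤ transferConst N α * energy α φ := by
  have hN2 : (2 : ℝ) ≤ N := by exact_mod_cast hN
  have hH := hardy (N := N) hα (by omega) (by linarith) φ hφ
  have hof : ∀ (n : ℕ) [n.AtLeastTwo] (r : ℝ), (OfNat.ofNat n : ℝ≥0∞) * ENNReal.ofReal r =
      ENNReal.ofReal (OfNat.ofNat n * r) := fun n _ r => by
    rw [ENNReal.ofReal_mul (Nat.ofNat_nonneg n), ENNReal.ofReal_ofNat]
  have hpt : ∀ᵐ x : Space N, ‖x‖ₑ ^ (0 : ℝ) *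
      ‖fderiv ℝ (fun x => smoothWeight α ε x * φ x) x‖ₑ ^ 2 ≤
      2 * (‖x‖ₑ ^ α * ‖fderiv ℝ φ x‖ₑ ^ 2) + 32 * (‖x‖ₑ ^ (α - 2) * ‖φ x‖ₑ ^ 2) := by
    filter_upwards [ae_ne_point (by omega) 0] with x hx
    have hx0 : 0 < ‖x‖ := norm_pos_iff.2 hx
    have h1 := ((contDiff_smoothWeight (N := N) (α := α) hε).differentiable
      (by simp) x).hasFDerivAt
    have h3 : HasFDerivAt (fun x => smoothWeight α ε x * φ x) _ x :=
      h1.mul (hφ.differentiable x).hasFDerivAt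
    rw [ENNReal.rpow_zero, one_mul, h3.fderiv, enorm_rpow_eq hx, enorm_rpow_eq hx,
      enorm_sq_eq, enorm_sq_eq, enorm_sq_eq, ← ENNReal.ofReal_mul (by positivity),
      ← ENNReal.ofReal_mul (by positivity),
      hof 2, hof 32,
      ← ENNReal.ofReal_add (by positivity) (by positivity)]
    refine ENNReal.ofReal_le_ofReal ?_
    have h4 := smoothWeight_le (by linarith) hε hx (α := α)
    have h5 := norm_fderiv_smoothWeight_le hα0 (by linarith) hε hx
    have h6 := smoothWeight_nonneg (α := α) hε x
    have e1 : ‖x‖ ^ α = (‖x‖ ^ (α / 2)) ^ 2 := by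
      rw [← Real.rpow_natCast, ← Real.rpow_mul hx0.le]; congr 1; push_cast; ring
    have e2 : ‖x‖ ^ (α - 2) = (‖x‖ ^ (α / 2 - 1)) ^ 2 := by
      rw [← Real.rpow_natCast, ← Real.rpow_mul hx0.le]; congr 1; push_cast; ring
    rw [e1, e2]
    have h7 : ‖smoothWeight α ε x • fderiv ℝ φ x + φ x • fderiv ℝ (smoothWeight α ε) x‖ ≤
        ‖x‖ ^ (α / 2) * ‖fderiv ℝ φ x‖ + ‖φ x‖ * (4 * ‖x‖ ^ (α / 2 - 1)) := by
      refine (norm_add_le _ _).trans ?_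
      rw [norm_smul, norm_smul, Real.norm_of_nonneg h6]
      gcongr
    have h8 := pow_le_pow_left₀ (norm_nonneg _) h7 2
    refine h8.trans ?_
    nlinarith [sq_nonneg (‖x‖ ^ (α / 2) * ‖fderiv ℝ φ x‖ - ‖φ x‖ * (4 * ‖x‖ ^ (α / 2 - 1)))]
  have hm1 : Measurable fun x : Space N => ‖x‖ₑ ^ α * ‖fderiv ℝ φ x‖ₑ ^ 2 :=
    (measurable_enorm.pow_const _).mul (hφ.continuous_fderiv.measurable.enorm.pow_const 2)
  calc energy 0 (fun x => smoothWeight α ε x * φ x)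
      ≤ ∫⁻ x, (2 * (‖x‖ₑ ^ α * ‖fderiv ℝ φ x‖ₑ ^ 2) + 32 * (‖x‖ₑ ^ (α - 2) * ‖φ x‖ₑ ^ 2)) :=
        lintegral_mono_ae hpt
    _ = 2 * energy α φ + 32 * ∫⁻ x, ‖x‖ₑ ^ (α - 2) * ‖φ x‖ₑ ^ 2 := by
        rw [lintegral_add_left (hm1.const_mul _), lintegral_const_mul' _ _ (by simp),
          lintegral_const_mul' _ _ (by simp), energy]
    _ ≤ 2 * energy α φ + 32 * (ENNReal.ofReal ((2 / ((N : ℝ) + α - 2)) ^ 2) * energy α φ) := by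
        gcongr
    _ = _ := by rw [transferConst]; ring

/-- Form bounds for the unweighted energy give form bounds for the weighted one. -/
lemma FormBound.weight {α : ℝ} (hα0 : 0 < α) (hα : α < 2) (hN : 2 ≤ N) {V : Space N → ℝ≥0∞}
    (hV : AEMeasurable V) (hVfin : ∀ᵐ x, V x ≠ ⊤) {C : ℝ≥0∞} (h : FormBound 0 V C) :
    FormBound α (fun x => V x * ‖x‖ₑ ^ α) (C * transferConst N α) := by
  intro φ hφ
  set ε : ℕ → ℝ := fun n => 1 / ((n : ℝ) + 1) with hε
  have hεpos : ∀ n, 0 < ε n := fun n => by simp only [hε]; positivity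
  refine lintegral_le_of_tendsto
    (f := fun n x => V x * ‖smoothWeight α (ε n) x * φ x‖ₑ ^ 2) (fun n => ?_) ?_ ?_
  · exact hV.mul ((isTestFunction_smoothWeight_mul (hεpos n) hφ).continuous.measurable.enorm.pow_const
      2).aemeasurable
  · filter_upwards [hVfin, ae_ne_point (by omega) 0] with x hx hx0
    rw [mul_assoc]
    -- Multiplication by `V x` is continuous at every limit value, including zero, because `V x` is
    -- finite.
    refine ENNReal.Tendsto.const_mul ?_ (Or.inr hx)
    have hx0' : 0 < ‖x‖ := norm_pos_iff.2 hx0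
    have e1 : ‖x‖ ^ α = (‖x‖ ^ (α / 2)) ^ 2 := by
      rw [← Real.rpow_natCast, ← Real.rpow_mul hx0'.le]; congr 1; push_cast; ring
    simp only [enorm_sq_eq]
    rw [enorm_rpow_eq hx0, ← ENNReal.ofReal_mul (by positivity), e1, ← mul_pow]
    refine ENNReal.tendsto_ofReal ?_
    have h1 : Tendsto (fun n => ‖x‖ ^ 2 + ε n) atTop (𝓝 (‖x‖ ^ 2 + 0)) :=
      tendsto_const_nhds.add tendsto_inv_succ
    rw [add_zero] at h1
    have h2 := (h1.rpow_const (p := α / 4 - 1) (Or.inl (by positivity))).const_mul (‖x‖ ^ 2)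
    have h3 : ‖x‖ ^ 2 * (‖x‖ ^ 2) ^ (α / 4 - 1) = ‖x‖ ^ (α / 2) := by
      rw [← Real.rpow_natCast, ← Real.rpow_mul hx0'.le, ← Real.rpow_add hx0']
      congr 1; push_cast; ring
    rw [h3] at h2
    have h4 := ((h2.mul_const (φ x)).norm).pow 2
    rw [norm_mul, Real.norm_of_nonneg (by positivity : 0 ≤ ‖x‖ ^ (α / 2))] at h4
    exact h4
  · intro n
    refine (h _ (isTestFunction_smoothWeight_mul (hεpos n) hφ)).trans ?_
    rw [mul_assoc]
    gcongr
    exact energy_smoothWeight_mul_le hα0 hα hN (hεpos n) hφ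

/-! ### Calculus of form bounds; Hardy and Sobolev potentials -/

lemma FormBound.mono {β : ℝ} {V W : Space N → ℝ≥0∞} {C D : ℝ≥0∞} (h : FormBound β V C)
    (hVW : ∀ᵐ x, W x ≤ V x) (hCD : C ≤ D) : FormBound β W D := fun φ hφ =>
  (lintegral_mono_ae (hVW.mono fun x hx => by gcongr)).trans ((h φ hφ).trans (by gcongr))

lemma FormBound.add {β : ℝ} {V W : Space N → ℝ≥0∞} (hV : AEMeasurable V) {C D : ℝ≥0∞}
    (h : FormBound β V C) (h' : FormBound β W D) :
    FormBound β (fun x => V x + W x) (C + D) := by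
  intro φ hφ
  simp only [add_mul]
  have hm : AEMeasurable (fun x => V x * ‖φ x‖ₑ ^ 2) :=
    hV.mul (hφ.continuous.measurable.enorm.pow_const 2).aemeasurable
  rw [lintegral_add_left' hm]
  exact add_le_add (h φ hφ) (h' φ hφ)

lemma FormBound.const_mul {β : ℝ} {V : Space N → ℝ≥0∞} {C : ℝ≥0∞} (h : FormBound β V C)
    {c : ℝ≥0∞} (hc : c ≠ ⊤) : FormBound β (fun x => c * V x) (c * C) := by
  intro φ hφ
  simp only [mul_assoc]
  rw [lintegral_const_mul' _ _ hc]
  gcongr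
  exact h φ hφ

/-- Hölder's inequality with exponents `1/s` and `1/t`, after distributing `φ²` over the two
factors; this uses `s + t = 1`. -/
lemma FormBound.interpolate {β : ℝ} {V W : Space N → ℝ≥0∞} (hV : AEMeasurable V)
    (hW : AEMeasurable W) {C D : ℝ≥0∞} (h : FormBound β V C) (h' : FormBound β W D)
    {s t : ℝ} (hs : 0 < s) (ht : 0 < t) (hst : s + t = 1) :
    FormBound β (fun x => V x ^ s * W x ^ t) (C ^ s * D ^ t) := by
  intro φ hφ
  have hm := (hφ.continuous.measurable.enorm.pow_const 2).aemeasurable (μ := volume)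
  have hsplit : ∀ e a b : ℝ≥0∞, e ≠ ⊤ → a ^ s * b ^ t * e = (a * e) ^ s * (b * e) ^ t := by
    intro e a b he
    rw [ENNReal.mul_rpow_of_nonneg _ _ hs.le, ENNReal.mul_rpow_of_nonneg _ _ ht.le,
      mul_mul_mul_comm, ← ENNReal.rpow_add_of_nonneg _ _ hs.le ht.le, hst, ENNReal.rpow_one]
  calc ∫⁻ x, V x ^ s * W x ^ t * ‖φ x‖ₑ ^ 2
      = ∫⁻ x, (V x * ‖φ x‖ₑ ^ 2) ^ s * (W x * ‖φ x‖ₑ ^ 2) ^ t :=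
        lintegral_congr fun x => hsplit _ _ _ (by finiteness)
    _ ≤ (∫⁻ x, V x * ‖φ x‖ₑ ^ 2) ^ s * (∫⁻ x, W x * ‖φ x‖ₑ ^ 2) ^ t :=
        ENNReal.lintegral_mul_norm_pow_le (hV.mul hm) (hW.mul hm) hs.le ht.le hst
    _ ≤ (C * energy β φ) ^ s * (D * energy β φ) ^ t := by
        gcongr
        · exact h φ hφ
        · exact h' φ hφ
    _ = _ := by
        rw [ENNReal.mul_rpow_of_nonneg _ _ hs.le, ENNReal.mul_rpow_of_nonneg _ _ ht.le,
          mul_mul_mul_comm, ← ENNReal.rpow_add_of_nonneg _ _ hs.le ht.le, hst, ENNReal.rpow_one]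

lemma IsTestFunction.comp_add_right {φ : Space N → ℝ} (hφ : IsTestFunction φ) (y : Space N) :
    IsTestFunction fun x => φ (x + y) :=
  ⟨hφ.1.comp (contDiff_id.add contDiff_const), hφ.2.comp_homeomorph (Homeomorph.addRight y)⟩

/-- Hardy's inequality centred at an arbitrary point. -/
lemma hardy_translate (hN : 3 ≤ N) (y : Space N) :
    FormBound (N := N) 0 (fun x => ‖x - y‖ₑ ^ (-2 : ℝ))
      (ENNReal.ofReal ((2 / ((N : ℝ) - 2)) ^ 2)) := by
  intro φ hφ
  have hN3 : (3 : ℝ) ≤ N := by exact_mod_cast hN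
  have h := hardy (N := N) (β := 0) (by norm_num) (by omega) (by linarith) _
    (hφ.comp_add_right y)
  have e1 : energy 0 (fun x => φ (x + y)) = energy 0 φ := by
    simp only [energy, ENNReal.rpow_zero, one_mul, fderiv_comp_add_right]
    exact lintegral_add_right_eq_self (fun x => ‖fderiv ℝ φ x‖ₑ ^ 2) y
  have e2 : ∫⁻ x : Space N, ‖x‖ₑ ^ ((0 : ℝ) - 2) * ‖φ (x + y)‖ₑ ^ 2 =
      ∫⁻ x, ‖x - y‖ₑ ^ (-2 : ℝ) * ‖φ x‖ₑ ^ 2 := by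
    rw [← lintegral_add_right_eq_self (fun x => ‖x - y‖ₑ ^ (-2 : ℝ) * ‖φ x‖ₑ ^ 2) y]
    simp
  rw [e1, e2] at h
  simpa using h

/-- With the interpolation parameters `1 - α/2` and `α/2` the powers of `‖x‖` cancel exactly. This
dictates the power `2 / (2 - α)` in `FormBound.of_rpow`. -/
lemma interpolate_eq {α : ℝ} (hα : α < 2) {x : Space N} (hx : x ≠ 0) (v : ℝ≥0∞) :
    (v ^ (2 / (2 - α)) * ‖x‖ₑ ^ α) ^ (1 - α / 2) * (‖x‖ₑ ^ (α - 2)) ^ (α / 2) = v := by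
  have h2 : (2 : ℝ) - α ≠ 0 := by linarith
  rw [ENNReal.mul_rpow_of_nonneg _ _ (by linarith), ← ENNReal.rpow_mul, ← ENNReal.rpow_mul,
    ← ENNReal.rpow_mul, mul_assoc,
    ← ENNReal.rpow_add _ _ (by simpa using hx) (by simp),
    show α * (1 - α / 2) + (α - 2) * (α / 2) = 0 by ring, ENNReal.rpow_zero, mul_one,
    show 2 / (2 - α) * (1 - α / 2) = 1 by field_simp, ENNReal.rpow_one]

/-- The passage from unweighted form bounds for `U ^ (2 / (2 - α))` to weighted ones for `U`. -/
lemma FormBound.of_rpow {α : ℝ} (hα0 : 0 < α) (hα : α < 2) (hN : 2 ≤ N) {U : Space N → ℝ≥0∞}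
    (hU : AEMeasurable U) (hUfin : ∀ᵐ x, U x ≠ ⊤) {C : ℝ≥0∞}
    (h : FormBound 0 (fun x => U x ^ (2 / (2 - α))) C) :
    FormBound α U ((C * transferConst N α) ^ (1 - α / 2) *
      ENNReal.ofReal ((2 / ((N : ℝ) + α - 2)) ^ 2) ^ (α / 2)) := by
  have hN2 : (2 : ℝ) ≤ N := by exact_mod_cast hN
  have h1 := h.weight hα0 hα hN (hU.pow_const _) (hUfin.mono fun x hx =>
    ENNReal.rpow_ne_top_of_nonneg (div_nonneg zero_le_two (by linarith)) hx)
  have h2 := h1.interpolate ((hU.pow_const _).mul (measurable_enorm.pow_const _).aemeasurable)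
    (measurable_enorm.pow_const _).aemeasurable
    (hardy (N := N) hα (by omega) (by linarith)) (s := 1 - α / 2) (t := α / 2)
    (by linarith) (by linarith) (by ring)
  refine h2.mono ?_ le_rfl
  filter_upwards [ae_ne_point (by omega) 0] with x hx
  exact (interpolate_eq hα hx (U x)).ge

/-- The potentials `|x - y|^(α - 2)` are form bounded, uniformly in `y`. -/
lemma exists_formBound_translate {α : ℝ} (hα0 : 0 < α) (hα : α < 2) (hN : 3 ≤ N) :
    ∃ K : ℝ≥0∞, K ≠ ⊤ ∧ ∀ y : Space N, FormBound α (fun x => ‖x - y‖ₑ ^ (α - 2)) K := by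
  refine ⟨_, ?_, fun y => FormBound.of_rpow hα0 hα (by omega) (by fun_prop)
    ?_ ((hardy_translate hN y).mono ?_ le_rfl)⟩
  · have := transferConst_ne_top (N := N) (α := α)
    exact ENNReal.mul_ne_top (ENNReal.rpow_ne_top_of_nonneg (by linarith) (by finiteness))
      (ENNReal.rpow_ne_top_of_nonneg (by linarith) (by finiteness))
  · filter_upwards [ae_ne_point (by omega) y] with x hx
    exact ENNReal.rpow_ne_top_of_ne_zero (by simpa [sub_eq_zero] using hx) (by simp)
  · refine Eventually.of_forall fun x => ?_
    -- Raised to the power `2 / (2 - α)`, the potential becomes the classical inverse square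
    -- potential centred at `y`.
    rw [← ENNReal.rpow_mul, show (α - 2) * (2 / (2 - α)) = -2 by
      have : (2 : ℝ) - α ≠ 0 := by linarith
      field_simp
      ring]

/-- Form bounds from Sobolev's inequality. -/
lemma exists_formBound_sobolev (hN : 3 ≤ N) :
    ∃ K : ℝ≥0∞, K ≠ ⊤ ∧ ∀ V : Space N → ℝ≥0∞, AEMeasurable V →
      FormBound 0 V (K * (∫⁻ x, V x ^ ((N : ℝ) / 2)) ^ (2 / (N : ℝ))) := by
  have hN3 : (3 : ℝ) ≤ N := by exact_mod_cast hN
  -- The critical Sobolev exponent; Hölder's inequality with weights `2/N` and `(N-2)/N` then leaves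
  -- the potential in `L^(N/2)`.
  set p' : NNReal := 2 * N / (N - 2 : ℝ).toNNReal with hp'
  have hp'r : (p' : ℝ) = 2 * N / (N - 2) := by
    rw [hp']
    push_cast
    rw [Real.coe_toNNReal _ (by linarith)]
  have hp'pos : 0 < (p' : ℝ) := by rw [hp'r]; apply div_pos <;> linarith
  have hp'0 : (p' : ℝ≥0∞) ≠ 0 := by
    rw [ENNReal.coe_ne_zero]
    exact fun h => hp'pos.ne' (by rw [h]; rfl)
  refine ⟨(eLpNormLESNormFDerivOfEqInnerConst (volume : Measure (Space N)) (2 : NNReal) : ℝ≥0∞) ^ 2,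
    by finiteness, fun V hV ψ hψ => ?_⟩
  have hs := eLpNorm_le_eLpNorm_fderiv_of_eq_inner (volume : Measure (Space N)) hψ.contDiff_one
    hψ.2 (p := 2) (p' := p') (by norm_num) (by simp; omega) (by
      rw [hp'r]
      simp only [finrank_euclideanSpace, Fintype.card_fin]
      push_cast
      have : (N : ℝ) - 2 ≠ 0 := by linarith
      have : (N : ℝ) ≠ 0 := by linarith
      field_simp)
  have he : eLpNorm (fderiv ℝ ψ) 2 volume ^ 2 = energy 0 ψ := by
    rw [eLpNorm_eq_lintegral_rpow_enorm_toReal (by simp) (by simp), energy, ← ENNReal.rpow_natCast,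
      ← ENNReal.rpow_mul]
    simp
  have hmain : ∫⁻ x, V x * ‖ψ x‖ₑ ^ 2 ≤
      (∫⁻ x, V x ^ ((N : ℝ) / 2)) ^ (2 / (N : ℝ)) * eLpNorm ψ p' volume ^ 2 := by
    have hq : eLpNorm ψ p' volume ^ 2 = (∫⁻ x, ‖ψ x‖ₑ ^ (p' : ℝ)) ^ (((N : ℝ) - 2) / N) := by
      rw [eLpNorm_eq_lintegral_rpow_enorm_toReal hp'0 (by simp), ← ENNReal.rpow_natCast,
        ← ENNReal.rpow_mul]
      congr 1
      simp only [ENNReal.coe_toReal]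
      rw [hp'r]
      have : (N : ℝ) - 2 ≠ 0 := by linarith
      have : (N : ℝ) ≠ 0 := by linarith
      field_simp
      norm_num
    rw [hq]
    have hholder := ENNReal.lintegral_mul_norm_pow_le (μ := (volume : Measure (Space N)))
      (f := fun x => V x ^ ((N : ℝ) / 2)) (g := fun x => ‖ψ x‖ₑ ^ (p' : ℝ))
      (hV.pow_const _) (hψ.continuous.measurable.enorm.pow_const _).aemeasurable
      (p := 2 / (N : ℝ)) (q := ((N : ℝ) - 2) / N) (by positivity)
      (div_nonneg (by linarith) (by linarith)) (by field_simp; ring)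
    refine le_trans (le_of_eq (lintegral_congr fun x => ?_)) hholder
    rw [← ENNReal.rpow_mul, ← ENNReal.rpow_mul, hp'r]
    have : (N : ℝ) - 2 ≠ 0 := by linarith
    have : (N : ℝ) ≠ 0 := by linarith
    rw [show (N : ℝ) / 2 * (2 / N) = 1 by field_simp,
      show 2 * (N : ℝ) / (N - 2) * ((N - 2) / N) = (2 : ℕ) by field_simp; norm_num,
      ENNReal.rpow_one, ENNReal.rpow_natCast]
  refine hmain.trans ?_
  rw [← he, mul_comm, mul_right_comm, ← mul_pow]
  gcongr
  simpa using hs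

/-- Form bounds for potentials in `L^(N/(2-α))`. -/
lemma exists_formBound_Lp {α : ℝ} (hα0 : 0 < α) (hα : α < 2) (hN : 3 ≤ N) :
    ∃ K : ℝ≥0∞, K ≠ ⊤ ∧ ∀ U : Space N → ℝ≥0∞, AEMeasurable U → (∀ᵐ x, U x ≠ ⊤) →
      FormBound α U (K * (∫⁻ x, U x ^ ((N : ℝ) / (2 - α))) ^ ((2 - α) / (N : ℝ))) := by
  obtain ⟨K, hK, h⟩ := exists_formBound_sobolev hN
  have hN3 : (3 : ℝ) ≤ N := by exact_mod_cast hN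
  refine ⟨(K * transferConst N α) ^ (1 - α / 2) *
      ENNReal.ofReal ((2 / ((N : ℝ) + α - 2)) ^ 2) ^ (α / 2), ?_, fun U hU hUfin => ?_⟩
  · have := transferConst_ne_top (N := N) (α := α)
    exact ENNReal.mul_ne_top (ENNReal.rpow_ne_top_of_nonneg (by linarith) (by finiteness))
      (ENNReal.rpow_ne_top_of_nonneg (by linarith) (by finiteness))
  · have h1 := (h _ (hU.pow_const (2 / (2 - α)))).of_rpow hα0 hα (by omega) hU hUfin
    refine h1.mono (Eventually.of_forall fun x => le_rfl) (le_of_eq ?_)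
    have h2 : (2 : ℝ) - α ≠ 0 := by linarith
    have h3 : (N : ℝ) ≠ 0 := by linarith
    simp only [← ENNReal.rpow_mul]
    rw [show 2 / (2 - α) * ((N : ℝ) / 2) = N / (2 - α) by field_simp, mul_right_comm K,
      ENNReal.mul_rpow_of_nonneg (K * _) _ (by linarith), ← ENNReal.rpow_mul,
      show 2 / (N : ℝ) * (1 - α / 2) = (2 - α) / N by field_simp]
    ring

/-! ### Compact forms and Rellich's theorem -/

lemma sq_lintegral_le {X : Type*} [MeasurableSpace X] {μ : Measure X} {f : X → ℝ≥0∞}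
    (hf : AEMeasurable f μ) : (∫⁻ x, f x ∂μ) ^ 2 ≤ μ Set.univ * ∫⁻ x, f x ^ 2 ∂μ := by
  have h := ENNReal.lintegral_mul_norm_pow_le (μ := μ) (f := fun x => f x ^ 2)
    (g := fun _ => (1 : ℝ≥0∞)) (hf.pow_const 2) aemeasurable_const (p := 1 / 2) (q := 1 / 2)
    (by norm_num) (by norm_num) (by norm_num)
  have e : ∀ a : ℝ≥0∞, (a ^ 2) ^ (1 / 2 : ℝ) = a := fun a => by
    rw [← ENNReal.rpow_natCast, ← ENNReal.rpow_mul]; simp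
  have e' : ∀ a : ℝ≥0∞, (a ^ (1 / 2 : ℝ)) ^ 2 = a := fun a => by
    rw [← ENNReal.rpow_natCast, ← ENNReal.rpow_mul]; simp
  simp only [e, ENNReal.one_rpow, mul_one, lintegral_const, one_mul] at h
  calc _ ≤ ((∫⁻ x, f x ^ 2 ∂μ) ^ (1 / 2 : ℝ) * μ Set.univ ^ (1 / 2 : ℝ)) ^ 2 := by gcongr
    _ = _ := by rw [mul_pow, e', e', mul_comm]

/-- Translation estimate in `L²`. -/
lemma lintegral_translate_sub_le {ψ : Space N → ℝ} (hψ : IsTestFunction ψ) (z : Space N) :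
    ∫⁻ x, ‖ψ (x + z) - ψ x‖ₑ ^ 2 ≤ ‖z‖ₑ ^ 2 * energy 0 ψ := by
  have hd := hψ.continuous_fderiv
  -- The fundamental theorem of calculus on the segment from `x` to `x + z`, followed by
  -- Cauchy-Schwarz in `t`. Integration in `x` then uses Tonelli and translation invariance.
  have hpt : ∀ x, ‖ψ (x + z) - ψ x‖ₑ ^ 2 ≤
      ‖z‖ₑ ^ 2 * ∫⁻ t in Set.Ioc (0 : ℝ) 1, ‖fderiv ℝ ψ (x + t • z)‖ₑ ^ 2 := by
    intro x
    have h1 : ∀ t ∈ Set.uIcc (0 : ℝ) 1, HasDerivAt (fun t : ℝ => ψ (x + t • z))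
        (fderiv ℝ ψ (x + t • z) z) t := by
      intro t _
      have h2 : HasDerivAt (fun t : ℝ => x + t • z) z t := by
        simpa using ((hasDerivAt_id t).smul_const z).const_add x
      exact (hψ.differentiable _).hasFDerivAt.comp_hasDerivAt t h2
    have h3 := intervalIntegral.integral_eq_sub_of_hasDerivAt h1
      (Continuous.intervalIntegrable (by fun_prop) _ _)
    simp only [one_smul, zero_smul, add_zero] at h3
    rw [← h3, intervalIntegral.integral_of_le zero_le_one]
    have h4 : ‖∫ t in Set.Ioc (0 : ℝ) 1, fderiv ℝ ψ (x + t • z) z‖ₑ ≤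
        ‖z‖ₑ * ∫⁻ t in Set.Ioc (0 : ℝ) 1, ‖fderiv ℝ ψ (x + t • z)‖ₑ := by
      refine (enorm_integral_le_lintegral_enorm _).trans ?_
      rw [← lintegral_const_mul' _ _ (by simp)]
      refine lintegral_mono fun t => ?_
      rw [mul_comm]
      exact (fderiv ℝ ψ (x + t • z)).le_opENorm z
    have hm : AEMeasurable (fun t : ℝ => ‖fderiv ℝ ψ (x + t • z)‖ₑ)
        (volume.restrict (Set.Ioc 0 1)) :=
      (Continuous.enorm (by fun_prop)).aemeasurable
    have h5 := sq_lintegral_le hm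
    rw [Measure.restrict_apply_univ, Real.volume_Ioc, sub_zero, ENNReal.ofReal_one, one_mul] at h5
    calc _ ≤ (‖z‖ₑ * ∫⁻ t in Set.Ioc (0 : ℝ) 1, ‖fderiv ℝ ψ (x + t • z)‖ₑ) ^ 2 := by gcongr
      _ ≤ _ := by rw [mul_pow]; gcongr
  refine (lintegral_mono hpt).trans ?_
  rw [lintegral_const_mul' _ _ (by finiteness), lintegral_lintegral_swap]
  · gcongr
    have : ∀ t : ℝ, ∫⁻ x : Space N, ‖fderiv ℝ ψ (x + t • z)‖ₑ ^ 2 = energy 0 ψ := by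
      intro t
      rw [lintegral_add_right_eq_self (fun x => ‖fderiv ℝ ψ x‖ₑ ^ 2)]
      simp [energy]
    simp [this]
  · refine Continuous.aemeasurable ?_
    refine (ENNReal.continuous_pow 2).comp (Continuous.enorm ?_)
    exact hd.comp (by fun_prop)

/-- A linear functional on test functions that is bounded for the energy norm. -/
def IsBoundedFunctional (β : ℝ) (l : (Space N → ℝ) → ℝ) : Prop :=
  (∀ φ ψ : Space N → ℝ, IsTestFunction φ → IsTestFunction ψ →
    l (fun x => φ x - ψ x) = l φ - l ψ) ∧
  ∃ C : ℝ≥0∞, C ≠ ⊤ ∧ ∀ φ : Space N → ℝ, IsTestFunction φ → ‖l φ‖ₑ ^ 2 ≤ C * energy β φ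

/-- The form `∫ V φ²` is compact with respect to the energy: up to an arbitrarily small multiple
of the energy it is controlled by finitely many bounded functionals. -/
def CompactForm (β : ℝ) (V : Space N → ℝ≥0∞) : Prop :=
  ∀ ε : ℝ, 0 < ε → ∃ (ι : Type) (_ : Fintype ι) (l : ι → (Space N → ℝ) → ℝ),
    (∀ i, IsBoundedFunctional β (l i)) ∧
    ∀ φ : Space N → ℝ, IsTestFunction φ →
      ∫⁻ x, V x * ‖φ x‖ₑ ^ 2 ≤ ENNReal.ofReal ε * energy β φ + ∑ i, ‖l i φ‖ₑ ^ 2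

lemma CompactForm.mono {β : ℝ} {V W : Space N → ℝ≥0∞} (h : CompactForm β V)
    (hVW : ∀ᵐ x, W x ≤ V x) : CompactForm β W := fun ε hε => by
  obtain ⟨ι, hι, l, hl, hb⟩ := h ε hε
  exact ⟨ι, hι, l, hl, fun φ hφ =>
    (lintegral_mono_ae (hVW.mono fun x hx => by gcongr)).trans (hb φ hφ)⟩

lemma CompactForm.add {β : ℝ} {V W : Space N → ℝ≥0∞} (hV : AEMeasurable V)
    (h : CompactForm β V) (h' : CompactForm β W) : CompactForm β (fun x => V x + W x) := by
  intro ε hε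
  obtain ⟨ι, hι, l, hl, hb⟩ := h (ε / 2) (by positivity)
  obtain ⟨ι', hι', l', hl', hb'⟩ := h' (ε / 2) (by positivity)
  refine ⟨ι ⊕ ι', inferInstance, Sum.elim l l', ?_, fun φ hφ => ?_⟩
  · rintro (i | i)
    · exact hl i
    · exact hl' i
  · simp only [add_mul]
    have hm : AEMeasurable (fun x => V x * ‖φ x‖ₑ ^ 2) :=
      hV.mul (hφ.continuous.measurable.enorm.pow_const 2).aemeasurable
    rw [lintegral_add_left' hm]
    refine (add_le_add (hb φ hφ) (hb' φ hφ)).trans (le_of_eq ?_)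
    rw [Fintype.sum_sum_type]
    simp only [Sum.elim_inl, Sum.elim_inr]
    rw [add_add_add_comm, ← add_mul, ← ENNReal.ofReal_add (by positivity) (by positivity),
      add_halves]

/-- Compactness is stable under approximation in the sense of forms. -/
lemma CompactForm.of_approx {β : ℝ} {V : Space N → ℝ≥0∞}
    (h : ∀ ε : ℝ, 0 < ε → ∃ W r : Space N → ℝ≥0∞, AEMeasurable W ∧ CompactForm β W ∧
      FormBound β r (ENNReal.ofReal ε) ∧ ∀ᵐ x, V x ≤ W x + r x) : CompactForm β V := by
  intro ε hε
  obtain ⟨W, r, hWm, hW, hr, hle⟩ := h (ε / 2) (by positivity)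
  obtain ⟨ι, hι, l, hl, hb⟩ := hW (ε / 2) (by positivity)
  refine ⟨ι, hι, l, hl, fun φ hφ => ?_⟩
  have hm : AEMeasurable (fun x => W x * ‖φ x‖ₑ ^ 2) :=
    hWm.mul (hφ.continuous.measurable.enorm.pow_const 2).aemeasurable
  calc ∫⁻ x, V x * ‖φ x‖ₑ ^ 2 ≤ ∫⁻ x, (W x * ‖φ x‖ₑ ^ 2 + r x * ‖φ x‖ₑ ^ 2) :=
        lintegral_mono_ae (hle.mono fun x hx => by rw [← add_mul]; gcongr)
    _ = (∫⁻ x, W x * ‖φ x‖ₑ ^ 2) + ∫⁻ x, r x * ‖φ x‖ₑ ^ 2 := lintegral_add_left' hm _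
    _ ≤ (ENNReal.ofReal (ε / 2) * energy β φ + ∑ i, ‖l i φ‖ₑ ^ 2) +
        ENNReal.ofReal (ε / 2) * energy β φ := add_le_add (hb φ hφ) (hr φ hφ)
    _ = _ := by
        rw [add_right_comm, ← add_mul, ← ENNReal.ofReal_add (by positivity) (by positivity),
          add_halves]

lemma IsBoundedFunctional.const_mul {β : ℝ} {l : (Space N → ℝ) → ℝ}
    (h : IsBoundedFunctional β l) (c : ℝ) : IsBoundedFunctional β fun φ => c * l φ := by
  obtain ⟨h1, C, hC, h2⟩ := h
  refine ⟨fun φ ψ hφ hψ => by simp only [h1 φ ψ hφ hψ]; ring, ‖c‖ₑ ^ 2 * C, by finiteness,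
    fun φ hφ => ?_⟩
  rw [enorm_mul, mul_pow, mul_assoc]
  gcongr
  exact h2 φ hφ

lemma CompactForm.const_mul {β : ℝ} {V : Space N → ℝ≥0∞} (h : CompactForm β V) {c : ℝ}
    (hc : 0 < c) : CompactForm β (fun x => ENNReal.ofReal c * V x) := by
  intro ε hε
  obtain ⟨ι, hι, l, hl, hb⟩ := h (ε / c) (by positivity)
  refine ⟨ι, hι, fun i φ => Real.sqrt c * l i φ, fun i => (hl i).const_mul _, fun φ hφ => ?_⟩
  simp only [mul_assoc]
  rw [lintegral_const_mul' _ _ (by simp)]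
  refine (mul_le_mul_right (hb φ hφ) _).trans (le_of_eq ?_)
  rw [mul_add, ← mul_assoc, ← ENNReal.ofReal_mul hc.le, mul_div_cancel₀ _ hc.ne', Finset.mul_sum]
  simp only [enorm_mul, mul_pow]
  rw [enorm_sq_eq (Real.sqrt c), Real.norm_eq_abs, sq_abs, Real.sq_sqrt hc.le]

/-- Jensen's inequality for the square, here a consequence of Cauchy-Schwarz. -/
lemma enorm_setAverage_sq_le {s : Set (Space N)} (hs0 : volume s ≠ 0) (hs : volume s ≠ ⊤)
    {f : Space N → ℝ} (hf : Continuous f) :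
    ‖⨍ x in s, f x‖ₑ ^ 2 ≤ (volume s)⁻¹ * ∫⁻ x in s, ‖f x‖ₑ ^ 2 := by
  have h1 : ‖⨍ x in s, f x‖ₑ ≤ (volume s)⁻¹ * ∫⁻ x in s, ‖f x‖ₑ := by
    rw [setAverage_eq, enorm_smul, Measure.real, ← ENNReal.toReal_inv]
    gcongr
    · exact (Real.enorm_eq_ofReal ENNReal.toReal_nonneg).trans_le ENNReal.ofReal_toReal_le
    · exact enorm_integral_le_lintegral_enorm _
  have h2 := sq_lintegral_le (μ := volume.restrict s) hf.enorm.aemeasurable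
  rw [Measure.restrict_apply_univ] at h2
  calc _ ≤ ((volume s)⁻¹ * ∫⁻ x in s, ‖f x‖ₑ) ^ 2 := by gcongr
    _ ≤ (volume s)⁻¹ ^ 2 * (volume s * ∫⁻ x in s, ‖f x‖ₑ ^ 2) := by
      rw [mul_pow]; gcongr
    _ = _ := by
      rw [← mul_assoc, pow_two, mul_assoc (volume s)⁻¹, ENNReal.inv_mul_cancel hs0 hs, mul_one]

/-- The ball lies in `‖x‖ ≤ ρ`, where `1 ≤ ρ² ‖x‖⁻²` away from the origin, so Hardy's inequality
bounds the `L²` norm on the ball by the energy. -/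
lemma isBoundedFunctional_setAverage (hN : 3 ≤ N) (y : Space N) {d : ℝ} (hd : 0 < d) :
    IsBoundedFunctional 0 fun φ : Space N → ℝ => ⨍ x in Metric.ball y d, φ x := by
  have hv0 : volume (Metric.ball y d) ≠ 0 := (Metric.measure_ball_pos volume _ hd).ne'
  have hvt : volume (Metric.ball y d) ≠ ⊤ := measure_ball_lt_top.ne
  refine ⟨fun φ ψ hφ hψ => ?_, ?_⟩
  · simp only [setAverage_eq]
    rw [integral_sub, smul_sub]
    · exact (hφ.continuous.integrable_of_hasCompactSupport hφ.2).integrableOn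
    · exact (hψ.continuous.integrable_of_hasCompactSupport hψ.2).integrableOn
  · set ρ : ℝ := ‖y‖ + d with hρ
    refine ⟨(volume (Metric.ball y d))⁻¹ *
      (ENNReal.ofReal (ρ ^ 2) * ENNReal.ofReal ((2 / ((N : ℝ) - 2)) ^ 2)),
      by finiteness, fun φ hφ => ?_⟩
    have h3 : ∫⁻ x in Metric.ball y d, ‖φ x‖ₑ ^ 2 ≤
        ENNReal.ofReal (ρ ^ 2) * (ENNReal.ofReal ((2 / ((N : ℝ) - 2)) ^ 2) * energy 0 φ) := by
      refine le_trans ?_ (mul_le_mul_right (hardy_translate hN 0 φ hφ) _)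
      rw [← lintegral_const_mul' _ _ (by simp)]
      refine le_trans (setLIntegral_mono_ae' measurableSet_ball ?_) (setLIntegral_le_lintegral _ _)
      filter_upwards [ae_ne_point (by omega) 0] with x hx hxb
      have hx0 : 0 < ‖x‖ := norm_pos_iff.2 hx
      have hxρ : ‖x‖ ≤ ρ := by
        rw [Metric.mem_ball, dist_eq_norm] at hxb
        have := norm_sub_norm_le x y
        linarith
      rw [sub_zero, ← mul_assoc, enorm_rpow_eq hx, ← ENNReal.ofReal_mul (by positivity)]
      refine le_mul_of_one_le_left (by simp) ?_
      rw [ENNReal.one_le_ofReal, Real.rpow_neg hx0.le, ← div_eq_mul_inv,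
        one_le_div (by positivity)]
      exact_mod_cast pow_le_pow_left₀ hx0.le hxρ 2
    refine (enorm_setAverage_sq_le hv0 hvt hφ.continuous).trans ?_
    rw [mul_assoc, mul_assoc]
    gcongr

/-- Pointwise comparison of a function with its average over a nearby ball. -/
lemma enorm_sq_le_average {ψ : Space N → ℝ} (hψ : Continuous ψ) {d : ℝ} (hd : 0 < d)
    {x y : Space N} (hxy : x ∈ Metric.ball y d) :
    ‖ψ x‖ₑ ^ 2 ≤ 2 * ((volume (Metric.ball y d))⁻¹ *
      ∫⁻ z in Metric.ball (0 : Space N) (2 * d), ‖ψ (x + z) - ψ x‖ₑ ^ 2) +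
        2 * ‖⨍ z in Metric.ball y d, ψ z‖ₑ ^ 2 := by
  have hv0 : volume (Metric.ball y d) ≠ 0 := (Metric.measure_ball_pos volume _ hd).ne'
  have hvt : volume (Metric.ball y d) ≠ ⊤ := measure_ball_lt_top.ne
  have hψi : IntegrableOn ψ (Metric.ball y d) :=
    (hψ.continuousOn.integrableOn_compact (isCompact_closedBall y d)).mono_set
      Metric.ball_subset_closedBall
  set A := ⨍ z in Metric.ball y d, ψ z with hA
  have h1 : ⨍ z in Metric.ball y d, (ψ z - ψ x) = A - ψ x := by
    have hr : volume.real (Metric.ball y d) ≠ 0 := ENNReal.toReal_ne_zero.2 ⟨hv0, hvt⟩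
    rw [hA, setAverage_eq, setAverage_eq, integral_sub hψi (integrableOn_const hvt), smul_sub,
      setIntegral_const, smul_smul, inv_mul_cancel₀ hr, one_smul]
  -- Since `x` is in the ball of radius `d` about `y`, that ball translated by `-x` lies in the ball
  -- of radius `2 * d` about the origin, which no longer depends on `y`.
  have h4 : ∫⁻ z in Metric.ball y d, ‖ψ z - ψ x‖ₑ ^ 2 ≤
      ∫⁻ z in Metric.ball (0 : Space N) (2 * d), ‖ψ (x + z) - ψ x‖ₑ ^ 2 := by
    rw [← lintegral_indicator measurableSet_ball, ← lintegral_indicator measurableSet_ball,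
      ← lintegral_add_left_eq_self _ x]
    refine lintegral_mono fun z => ?_
    by_cases hz : x + z ∈ Metric.ball y d
    · have hz' : z ∈ Metric.ball (0 : Space N) (2 * d) := by
        rw [Metric.mem_ball, dist_eq_norm] at hz hxy
        rw [mem_ball_zero_iff]
        calc ‖z‖ = ‖(x + z - y) - (x - y)‖ := by congr 1; abel
          _ ≤ ‖x + z - y‖ + ‖x - y‖ := norm_sub_le _ _
          _ < 2 * d := by linarith
      rw [Set.indicator_of_mem hz, Set.indicator_of_mem hz']
    · rw [Set.indicator_of_notMem hz]
      exact zero_le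
  have h5 : ‖A - ψ x‖ₑ ^ 2 ≤ (volume (Metric.ball y d))⁻¹ *
      ∫⁻ z in Metric.ball (0 : Space N) (2 * d), ‖ψ (x + z) - ψ x‖ₑ ^ 2 := by
    rw [← h1]
    refine (enorm_setAverage_sq_le hv0 hvt (by fun_prop)).trans ?_
    gcongr
  have h6 : ‖ψ x‖ₑ ^ 2 ≤ 2 * ‖A - ψ x‖ₑ ^ 2 + 2 * ‖A‖ₑ ^ 2 := by
    simp only [enorm_sq_eq, Real.norm_eq_abs, sq_abs]
    rw [← ENNReal.ofReal_ofNat 2, ← ENNReal.ofReal_mul (by positivity),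
      ← ENNReal.ofReal_mul (by positivity), ← ENNReal.ofReal_add (by positivity)
      (by positivity)]
    refine ENNReal.ofReal_le_ofReal ?_
    nlinarith [sq_nonneg (ψ x - 2 * A)]
  refine h6.trans ?_
  gcongr

lemma lintegral_ball_translate_sub_le {ψ : Space N → ℝ} (hψ : IsTestFunction ψ) (r : ℝ) :
    ∫⁻ x, ∫⁻ z in Metric.ball (0 : Space N) r, ‖ψ (x + z) - ψ x‖ₑ ^ 2 ≤
      ENNReal.ofReal (r ^ 2) * energy 0 ψ * volume (Metric.ball (0 : Space N) r) := by
  have hψc := hψ.continuous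
  have hcont : Continuous fun q : Space N × Space N => ‖ψ (q.1 + q.2) - ψ q.1‖ₑ ^ 2 :=
    (ENNReal.continuous_pow 2).comp (Continuous.enorm (by fun_prop))
  rw [lintegral_lintegral_swap hcont.aemeasurable, ← setLIntegral_const]
  refine setLIntegral_mono' measurableSet_ball fun z hz => ?_
  refine (lintegral_translate_sub_le hψ z).trans ?_
  gcongr
  rw [enorm_sq_eq]
  refine ENNReal.ofReal_le_ofReal (pow_le_pow_left₀ (norm_nonneg _) ?_ 2)
  rw [mem_ball_zero_iff] at hz
  exact hz.le

/-- Rellich's theorem on balls. -/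
lemma compactForm_ball_unweighted (hN : 3 ≤ N) (R : ℝ) :
    CompactForm (N := N) 0 ((Metric.ball 0 R).indicator fun _ => 1) := by
  intro ε hε
  -- The error is `2 * (2 * d)² * 2 ^ N` times the energy, where `2 ^ N` is the volume ratio of the
  -- balls of radii `2 * d` and `d`. Bounding `d` by `1` as well lets a linear bound on `d` control
  -- `d ^ 2`.
  set d : ℝ := min 1 (ε / (8 * 2 ^ N)) with hd
  have hd0 : 0 < d := by positivity
  have hdε : 8 * 2 ^ N * d ^ 2 ≤ ε := by
    have h1 : d ≤ 1 := min_le_left _ _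
    have h2 : d ≤ ε / (8 * 2 ^ N) := min_le_right _ _
    rw [le_div_iff₀ (by positivity)] at h2
    nlinarith [show (0:ℝ) < 8 * 2 ^ N by positivity]
  obtain ⟨t, -, htf, htc⟩ := finite_cover_balls_of_compact (isCompact_closedBall (0 : Space N) R) hd0
  set v : ℝ≥0∞ := volume (Metric.ball (0 : Space N) d) with hv
  have hball : ∀ y : Space N, volume (Metric.ball y d) = v := fun y => by
    rw [hv, Measure.addHaar_ball_center]
  have hv0 : v ≠ 0 := (Metric.measure_ball_pos volume _ hd0).ne'
  have hvt : v ≠ ⊤ := measure_ball_lt_top.ne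
  have hv2 : volume (Metric.ball (0 : Space N) (2 * d)) = ENNReal.ofReal (2 ^ N) * v := by
    rw [Measure.addHaar_ball_mul_of_pos (volume : Measure (Space N)) 0 (r := 2) two_pos d,
      finrank_euclideanSpace_fin]
  clear_value v
  have := htf.fintype
  obtain ⟨V, hV⟩ : ∃ V : ℝ, V = (volume (Metric.ball (0 : Space N) R)).toReal := ⟨_, rfl⟩
  have hVe : volume (Metric.ball (0 : Space N) R) = ENNReal.ofReal V :=
    hV ▸ (ENNReal.ofReal_toReal measure_ball_lt_top.ne).symm
  have hV0 : 0 ≤ V := hV ▸ ENNReal.toReal_nonneg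
  -- Integrating the squared averages over the large ball produces the factor `2 * V`, which is put
  -- into the functionals as a square root.
  refine ⟨t, inferInstance, fun y ψ => Real.sqrt (2 * V) * ⨍ x in Metric.ball (y : Space N) d, ψ x,
    fun y => (isBoundedFunctional_setAverage hN y hd0).const_mul _, fun ψ hψ => ?_⟩
  set A : t → ℝ := fun y => ⨍ x in Metric.ball (y : Space N) d, ψ x with hA
  have hpt : ∀ x ∈ Metric.ball (0 : Space N) R, ‖ψ x‖ₑ ^ 2 ≤
      2 * (v⁻¹ * ∫⁻ z in Metric.ball (0 : Space N) (2 * d), ‖ψ (x + z) - ψ x‖ₑ ^ 2) +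
        2 * ∑ y : t, ‖A y‖ₑ ^ 2 := by
    intro x hx
    obtain ⟨y, hyt, hxy⟩ : ∃ y ∈ t, x ∈ Metric.ball y d := by
      simpa using htc (Metric.ball_subset_closedBall hx)
    have h6 := enorm_sq_le_average hψ.continuous hd0 hxy
    rw [hball] at h6
    have h8 : ‖A ⟨y, hyt⟩‖ₑ ^ 2 ≤ ∑ y : t, ‖A y‖ₑ ^ 2 :=
      Finset.single_le_sum (f := fun y : t => ‖A y‖ₑ ^ 2) (fun _ _ => zero_le) (Finset.mem_univ _)
    exact h6.trans (add_le_add le_rfl (mul_le_mul_right h8 2))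
  have e1 : ∫⁻ x, (Metric.ball 0 R).indicator (fun _ => 1) x * ‖ψ x‖ₑ ^ 2 =
      ∫⁻ x in Metric.ball (0 : Space N) R, ‖ψ x‖ₑ ^ 2 := by
    rw [← lintegral_indicator measurableSet_ball]
    refine lintegral_congr fun x => ?_
    by_cases hx : x ∈ Metric.ball (0 : Space N) R <;> simp [hx]
  rw [e1]
  refine (setLIntegral_mono' measurableSet_ball hpt).trans ?_
  rw [lintegral_add_right _ measurable_const, lintegral_const_mul' _ _ (by finiteness),
    lintegral_const_mul' _ _ (by finiteness), setLIntegral_const]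
  refine add_le_add ?_ (le_of_eq ?_)
  · have h7 : ∫⁻ x in Metric.ball (0 : Space N) R, ∫⁻ z in Metric.ball (0 : Space N) (2 * d),
        ‖ψ (x + z) - ψ x‖ₑ ^ 2 ≤
        ENNReal.ofReal ((2 * d) ^ 2) * energy 0 ψ * (ENNReal.ofReal (2 ^ N) * v) := by
      rw [← hv2]
      exact (setLIntegral_le_lintegral _ _).trans (lintegral_ball_translate_sub_le hψ (2 * d))
    calc _ ≤ 2 * (v⁻¹ * (ENNReal.ofReal ((2 * d) ^ 2) * energy 0 ψ *
          (ENNReal.ofReal (2 ^ N) * v))) := mul_le_mul_right (mul_le_mul_right h7 _) _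
      _ = 2 * ENNReal.ofReal ((2 * d) ^ 2) * ENNReal.ofReal (2 ^ N) * (v⁻¹ * v) *
          energy 0 ψ := by ring
      _ = ENNReal.ofReal (8 * 2 ^ N * d ^ 2) * energy 0 ψ := by
        rw [ENNReal.inv_mul_cancel hv0 hvt, mul_one, ← ENNReal.ofReal_ofNat 2,
          ← ENNReal.ofReal_mul (by positivity), ← ENNReal.ofReal_mul (by positivity)]
        congr 2; ring
      _ ≤ _ := by gcongr
  · have hs : ‖Real.sqrt (2 * V)‖ₑ ^ 2 = 2 * ENNReal.ofReal V := by
      rw [enorm_sq_eq, Real.norm_eq_abs, sq_abs, Real.sq_sqrt (by positivity),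
        ENNReal.ofReal_mul (by positivity), ENNReal.ofReal_ofNat]
    simp only [enorm_mul, mul_pow, hs]
    rw [← Finset.mul_sum, hVe]
    ring

/-- Used to scale a potential with form bound `K` to one with form bound `ε`; the `+ 1` avoids
division by zero. -/
lemma ofReal_div_mul_le {ε : ℝ} (hε : 0 ≤ ε) {K : ℝ≥0∞} (hK : K ≠ ⊤) :
    ENNReal.ofReal (ε / (K.toReal + 1)) * K ≤ ENNReal.ofReal ε := by
  have h0 : 0 ≤ K.toReal := ENNReal.toReal_nonneg
  calc _ = ENNReal.ofReal (ε / (K.toReal + 1)) * ENNReal.ofReal K.toReal := by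
        rw [ENNReal.ofReal_toReal hK]
    _ = ENNReal.ofReal (ε / (K.toReal + 1) * K.toReal) :=
        (ENNReal.ofReal_mul (by positivity)).symm
    _ ≤ _ := by
        refine ENNReal.ofReal_le_ofReal ?_
        rw [div_mul_eq_mul_div, div_le_iff₀ (by positivity)]
        nlinarith

/-- The choice `ε = 1` suffices, since the finitely many functionals are themselves bounded by the
energy. -/
lemma CompactForm.formBound {β : ℝ} {V : Space N → ℝ≥0∞} (h : CompactForm β V) :
    ∃ C : ℝ≥0∞, C ≠ ⊤ ∧ FormBound β V C := by
  obtain ⟨ι, hι, l, hl, hb⟩ := h 1 one_pos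
  choose C hC hlC using fun i => (hl i).2
  refine ⟨1 + ∑ i, C i, ENNReal.add_ne_top.2 ⟨by simp, ENNReal.sum_ne_top.2 fun i _ => hC i⟩,
    fun φ hφ => (hb φ hφ).trans ?_⟩
  rw [add_mul, ENNReal.ofReal_one, Finset.sum_mul]
  gcongr with i
  exact hlC i φ hφ

/-- The functionals are composed with multiplication by the smooth weight. The fixed smoothing
parameter `1` is enough: on a ball with a neighbourhood of the origin removed this weight is bounded
below. -/
lemma CompactForm.weight {α : ℝ} (hα0 : 0 < α) (hα : α < 2) (hN : 2 ≤ N) {V : Space N → ℝ≥0∞}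
    (h : CompactForm 0 V) : CompactForm α (fun x => V x * ‖smoothWeight α 1 x‖ₑ ^ 2) := by
  intro ε hε
  have hT := transferConst_ne_top (N := N) (α := α)
  obtain ⟨ι, hι, l, hl, hb⟩ := h (ε / ((transferConst N α).toReal + 1))
    (by have : 0 ≤ (transferConst N α).toReal := ENNReal.toReal_nonneg
        positivity)
  refine ⟨ι, hι, fun i φ => l i (fun x => smoothWeight α 1 x * φ x), fun i => ?_, fun φ hφ => ?_⟩
  · obtain ⟨h1, C, hC, h2⟩ := hl i
    refine ⟨fun φ ψ hφ hψ => ?_, C * transferConst N α, by finiteness, fun φ hφ => ?_⟩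
    · rw [← h1 _ _ (isTestFunction_smoothWeight_mul one_pos hφ)
        (isTestFunction_smoothWeight_mul one_pos hψ)]
      simp only [mul_sub]
    · refine (h2 _ (isTestFunction_smoothWeight_mul one_pos hφ)).trans ?_
      rw [mul_assoc]
      gcongr
      exact energy_smoothWeight_mul_le hα0 hα hN one_pos hφ
  · have h1 := hb _ (isTestFunction_smoothWeight_mul (α := α) one_pos hφ)
    simp only [enorm_mul, mul_pow, ← mul_assoc] at h1 ⊢
    refine h1.trans (add_le_add ?_ le_rfl)
    calc _ ≤ ENNReal.ofReal (ε / ((transferConst N α).toReal + 1)) *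
          (transferConst N α * energy α φ) := by
            gcongr
            exact energy_smoothWeight_mul_le hα0 hα hN one_pos hφ
      _ ≤ _ := by
        rw [← mul_assoc]
        gcongr
        exact ofReal_div_mul_le hε.le hT

/-- Rellich's theorem on balls for the weighted energy. -/
lemma compactForm_ball {α : ℝ} (hα0 : 0 < α) (hα : α < 2) (hN : 3 ≤ N) (R : ℝ) :
    CompactForm (N := N) α ((Metric.ball 0 R).indicator fun _ => 1) := by
  obtain ⟨K, hK, hKb⟩ := exists_formBound_translate hα0 hα hN
  have hind : Measurable ((Metric.ball (0 : Space N) R).indicator fun _ => (1 : ℝ≥0∞)) :=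
    measurable_const.indicator measurableSet_ball
  refine CompactForm.of_approx fun ε hε => ?_
  have hK0 : 0 ≤ K.toReal := ENNReal.toReal_nonneg
  -- The multiple `c * ‖x‖^(α - 2)` has form bound `ε`, and it is at least `1` for `‖x‖ < δ`. In the
  -- rest of the ball the smooth weight is at least `w0`, so the unweighted Rellich theorem
  -- multiplied by `w0⁻²` covers that region.
  set c := ε / (K.toReal + 1) with hc
  have hc0 : 0 < c := by positivity
  set δ := c ^ (1 / (2 - α)) with hδ
  have hδ0 : 0 < δ := Real.rpow_pos_of_pos hc0 _
  have h2α : (2 : ℝ) - α ≠ 0 := by linarith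
  have hδc : δ ^ (2 - α) = c := by
    rw [hδ, ← Real.rpow_mul hc0.le, one_div_mul_cancel h2α, Real.rpow_one]
  set w0 : ℝ := δ ^ 2 * (R ^ 2 + 1) ^ (α / 4 - 1) with hw0
  have hw0pos : 0 < w0 := mul_pos (by positivity) (Real.rpow_pos_of_pos (by positivity) _)
  have hsw : Continuous (smoothWeight α 1 : Space N → ℝ) :=
    (contDiff_smoothWeight one_pos).continuous
  refine ⟨fun x => ENNReal.ofReal ((w0 ^ 2)⁻¹) * ((Metric.ball (0 : Space N) R).indicator
    (fun _ => 1) x * ‖smoothWeight α 1 x‖ₑ ^ 2), fun x => ENNReal.ofReal c * ‖x - 0‖ₑ ^ (α - 2),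
    ((hind.mul (hsw.measurable.enorm.pow_const 2)).const_mul _).aemeasurable,
    ((compactForm_ball_unweighted hN R).weight hα0 hα (by omega)).const_mul (by positivity),
    ((hKb 0).const_mul (by simp)).mono (Eventually.of_forall fun _ => le_rfl)
      (ofReal_div_mul_le hε.le hK), ?_⟩
  filter_upwards [ae_ne_point (by omega) 0] with x hx
  by_cases hxR : x ∈ Metric.ball (0 : Space N) R
  swap
  · rw [Set.indicator_of_notMem hxR]; exact zero_le
  have hx0 : 0 < ‖x‖ := norm_pos_iff.2 hx
  rw [Set.indicator_of_mem hxR, one_mul, sub_zero]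
  rw [mem_ball_zero_iff] at hxR
  by_cases hxδ : ‖x‖ < δ
  · refine le_add_left ?_
    rw [enorm_rpow_eq hx, ← ENNReal.ofReal_mul hc0.le, ENNReal.one_le_ofReal,
      show α - 2 = -(2 - α) by ring, Real.rpow_neg hx0.le, ← div_eq_mul_inv,
      one_le_div (by positivity), ← hδc]
    exact Real.rpow_le_rpow hx0.le hxδ.le (by linarith)
  · push Not at hxδ
    refine le_add_right ?_
    rw [enorm_sq_eq, ← ENNReal.ofReal_mul (by positivity), ENNReal.one_le_ofReal, mul_comm,
      ← div_eq_mul_inv, one_le_div (by positivity)]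
    refine pow_le_pow_left₀ hw0pos.le ?_ 2
    rw [Real.norm_of_nonneg (smoothWeight_nonneg one_pos x), smoothWeight, hw0]
    have h1 : (R ^ 2 + 1) ^ (α / 4 - 1) ≤ (‖x‖ ^ 2 + 1) ^ (α / 4 - 1) :=
      Real.rpow_le_rpow_of_nonpos (by positivity) (by gcongr) (by linarith)
    gcongr

/-! ### Compactness of the form of the positive part of `g` -/

/-- Potentials in `L^(N/(2-α))` define compact forms. -/
lemma compactForm_of_Lp {α : ℝ} (hα0 : 0 < α) (hα : α < 2) (hN : 3 ≤ N) {U : Space N → ℝ≥0∞}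
    (hU : Measurable U) (hfin : ∫⁻ x, U x ^ ((N : ℝ) / (2 - α)) ≠ ⊤) : CompactForm α U := by
  obtain ⟨K, hK, hKb⟩ := exists_formBound_Lp hα0 hα hN
  set p : ℝ := (N : ℝ) / (2 - α) with hp
  have hN0 : (0 : ℝ) < N := by exact_mod_cast (by omega : 0 < N)
  have hp0 : 0 < p := div_pos hN0 (by linarith)
  have hUfin : ∀ᵐ x, U x ≠ ⊤ := by
    filter_upwards [ae_lt_top (hU.pow_const p) hfin] with x hx h
    rw [h, ENNReal.top_rpow_of_pos hp0] at hx
    exact lt_irrefl _ hx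
  -- On `S n` the potential is dominated by `n` times the indicator of a ball. The part off `S n`
  -- tends to zero in `L^p`, hence so does its form bound.
  set S : ℕ → Set (Space N) := fun n => {x | U x ≤ n} ∩ Metric.ball 0 n with hS
  have hSm : ∀ n, MeasurableSet (S n) := fun n =>
    (measurableSet_le hU measurable_const).inter measurableSet_ball
  have hlim : Tendsto (fun n => ∫⁻ x, (S n)ᶜ.indicator U x ^ p) atTop (𝓝 0) := by
    have h := tendsto_lintegral_of_dominated_convergence (μ := (volume : Measure (Space N)))
      (F := fun n x => (S n)ᶜ.indicator U x ^ p) (f := fun _ => 0) (fun x => U x ^ p)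
      (fun n => (hU.indicator (hSm n).compl).pow_const p)
      (fun n => Eventually.of_forall fun x => by
        refine ENNReal.rpow_le_rpow ?_ hp0.le
        exact Set.indicator_le_self' (fun _ _ => zero_le) x) hfin ?_
    · simpa using h
    · filter_upwards [hUfin] with x hx
      obtain ⟨n₁, hn₁⟩ := ENNReal.exists_nat_gt hx
      obtain ⟨n₂, hn₂⟩ := exists_nat_gt ‖x‖
      refine tendsto_const_nhds.congr' ?_
      filter_upwards [eventually_ge_atTop (max n₁ n₂)] with n hn
      have h1 : x ∈ S n := by
        refine ⟨hn₁.le.trans ?_, ?_⟩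
        · exact_mod_cast (le_max_left _ _).trans hn
        · rw [mem_ball_zero_iff]
          refine hn₂.trans_le ?_
          exact_mod_cast (le_max_right _ _).trans hn
      rw [Set.indicator_of_notMem (by simpa using h1), ENNReal.zero_rpow_of_pos hp0]
  have hlim2 : Tendsto (fun n => K * (∫⁻ x, (S n)ᶜ.indicator U x ^ p) ^ ((2 - α) / (N : ℝ)))
      atTop (𝓝 0) := by
    have hq : 0 < (2 - α) / (N : ℝ) := div_pos (by linarith) hN0
    have h1 := (ENNReal.continuous_rpow_const (y := (2 - α) / (N : ℝ))).tendsto 0 |>.comp hlim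
    rw [ENNReal.zero_rpow_of_pos hq] at h1
    have h2 := ENNReal.Tendsto.const_mul (a := K) h1 (Or.inr hK)
    rwa [mul_zero] at h2
  refine CompactForm.of_approx fun ε hε => ?_
  obtain ⟨n, hn0, hn⟩ := ((eventually_gt_atTop 0).and
    (hlim2.eventually (ge_mem_nhds (ENNReal.ofReal_pos.2 hε)))).exists
  have hn0' : (0 : ℝ) < n := by exact_mod_cast hn0
  have hind : Measurable ((Metric.ball (0 : Space N) n).indicator fun _ => (1 : ℝ≥0∞)) :=
    measurable_const.indicator measurableSet_ball
  refine ⟨fun x => ENNReal.ofReal n * (Metric.ball (0 : Space N) n).indicator (fun _ => 1) x,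
    (S n)ᶜ.indicator U, (hind.const_mul _).aemeasurable,
    (compactForm_ball hα0 hα hN n).const_mul hn0',
    (hKb _ (hU.indicator (hSm n).compl).aemeasurable ?_).mono
      (Eventually.of_forall fun _ => le_rfl) hn, Eventually.of_forall fun x => ?_⟩
  · filter_upwards [hUfin] with x hx
    exact ((Set.indicator_le_self' (fun _ _ => zero_le) x).trans_lt hx.lt_top).ne
  · beta_reduce
    by_cases hx : x ∈ S n
    · rw [Set.indicator_of_mem hx.2, mul_one, ENNReal.ofReal_natCast]
      exact le_add_right hx.1
    · have hx' : x ∈ (S n)ᶜ := hx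
      rw [Set.indicator_of_mem hx']
      exact le_add_self

lemma FormBound.sum {β : ℝ} {ι : Type*} (t : Finset ι) {V : ι → Space N → ℝ≥0∞}
    (hV : ∀ i, AEMeasurable (V i)) {C : ℝ≥0∞} (h : ∀ i, FormBound β (V i) C) :
    FormBound β (fun x => ∑ i ∈ t, V i x) (t.card * C) := by
  intro φ hφ
  have hm : ∀ i ∈ t, AEMeasurable (fun x => V i x * ‖φ x‖ₑ ^ 2) := fun i _ =>
    (hV i).mul (hφ.continuous.measurable.enorm.pow_const 2).aemeasurable
  simp only [Finset.sum_mul]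
  rw [lintegral_finsetSum' _ hm]
  refine (Finset.sum_le_sum fun i _ => h i φ hφ).trans (le_of_eq ?_)
  rw [Finset.sum_const, nsmul_eq_mul, mul_assoc]

lemma enorm_le_of_rpow_mul_le {α c b s : ℝ} {x : Space N} (hx : x ≠ 0) (hc : 0 ≤ c)
    (hs : s = ‖x‖) (h : |s ^ (2 - α) * b| ≤ c) :
    ‖b‖ₑ ≤ ENNReal.ofReal c * ‖x‖ₑ ^ (α - 2) := by
  have hx0 : 0 < ‖x‖ := norm_pos_iff.2 hx
  subst hs
  rw [enorm_rpow_eq hx, ← ENNReal.ofReal_mul hc, ← ofReal_norm]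
  refine ENNReal.ofReal_le_ofReal ?_
  rw [show α - 2 = -(2 - α) by ring, Real.rpow_neg hx0.le, ← div_eq_mul_inv,
    le_div_iff₀ (by positivity), Real.norm_eq_abs, mul_comm]
  rwa [abs_mul, abs_of_pos (Real.rpow_pos_of_pos hx0 _)] at h

/-- Potentials that are `o(|x - y|^(α-2))` at every point and at infinity define compact forms. -/
lemma compactForm_of_vanishing {α : ℝ} (hα0 : 0 < α) (hα : α < 2) (hN : 3 ≤ N) {f : Space N → ℝ}
    (hf : ∀ y : Space N, Tendsto (fun x => ‖x - y‖ ^ (2 - α) * f x) (𝓝[≠] y) (𝓝 0))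
    (hinf : Tendsto (fun x => ‖x‖ ^ (2 - α) * f x) (cocompact (Space N)) (𝓝 0)) :
    CompactForm α (fun x => ‖f x‖ₑ) := by
  classical
  obtain ⟨K, hK, hKb⟩ := exists_formBound_translate hα0 hα hN
  have hK0 : 0 ≤ K.toReal := ENNReal.toReal_nonneg
  refine CompactForm.of_approx fun ε hε => ?_
  set c₁ := (ε / 2) / (K.toReal + 1) with hc₁
  have hc₁0 : 0 < c₁ := by positivity
  have habs : ∀ {l : Filter (Space N)} {F : Space N → ℝ}, Tendsto F l (𝓝 0) → ∀ c : ℝ, 0 < c →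
      ∀ᶠ x in l, |F x| ≤ c := by
    intro l F h c hc
    filter_upwards [h (Metric.closedBall_mem_nhds 0 hc)] with x hx
    simpa using hx
  obtain ⟨R, hR⟩ : ∃ R : ℝ, ∀ x : Space N, x ∉ Metric.closedBall (0 : Space N) R →
      |‖x‖ ^ (2 - α) * f x| ≤ c₁ := by
    obtain ⟨k, hk, hkc⟩ := mem_cocompact.1 (habs hinf c₁ hc₁0)
    obtain ⟨R, hR⟩ := hk.isBounded.subset_closedBall (0 : Space N)
    exact ⟨R, fun x hx => hkc fun hxk => hx (hR hxk)⟩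
  have hnear : ∀ (y : Space N) (c : ℝ), 0 < c → ∃ ρ > 0, ∀ x ∈ Metric.ball y ρ, x ≠ y →
      |‖x - y‖ ^ (2 - α) * f x| ≤ c := by
    intro y c hc
    obtain ⟨ρ, hρ, h⟩ := Metric.mem_nhdsWithin_iff.1 (habs (hf y) c hc)
    exact ⟨ρ, hρ, fun x hx hxy => h ⟨hx, hxy⟩⟩
  -- The cover is chosen with the crude constant `1`, because the small constant `c₂` depends on the
  -- number of centres. Near each centre, within `δ y`, the potential is form-small; elsewhere in
  -- the cover it is at most `δ y ^ (α - 2)`, hence at most `M`.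
  choose ρ hρ0 hρ using fun y => hnear y 1 one_pos
  obtain ⟨t, -, ht⟩ := (isCompact_closedBall (0 : Space N) R).elim_nhds_subcover
    (fun y => Metric.ball y (ρ y)) fun y _ => Metric.ball_mem_nhds y (hρ0 y)
  set c₂ := (ε / 2) / (t.card + 1) / (K.toReal + 1) with hc₂
  have hc₂0 : 0 < c₂ := by positivity
  choose δ hδ0 hδ using fun y => hnear y c₂ hc₂0
  set M : ℝ := 1 + ∑ y ∈ t, δ y ^ (α - 2) with hM
  have hδp : ∀ y, 0 < δ y ^ (α - 2) := fun y => Real.rpow_pos_of_pos (hδ0 y) _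
  have hM0 : 0 < M := add_pos_of_pos_of_nonneg one_pos (Finset.sum_nonneg fun y _ => (hδp y).le)
  have hind : Measurable ((Metric.ball (0 : Space N) (R + 1)).indicator fun _ => (1 : ℝ≥0∞)) :=
    measurable_const.indicator measurableSet_ball
  have hmeas : ∀ (c : ℝ≥0∞) (y : Space N),
      AEMeasurable (fun x : Space N => c * ‖x - y‖ₑ ^ (α - 2)) := fun c y => by fun_prop
  have hfb1 : FormBound α (fun x : Space N => ENNReal.ofReal c₁ * ‖x - 0‖ₑ ^ (α - 2))
      (ENNReal.ofReal (ε / 2)) :=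
    ((hKb 0).const_mul (by simp)).mono (Eventually.of_forall fun _ => le_rfl)
      (ofReal_div_mul_le (by positivity) hK)
  have hfb2 : FormBound α (fun x : Space N =>
      ∑ y ∈ t, ENNReal.ofReal c₂ * ‖x - y‖ₑ ^ (α - 2)) (ENNReal.ofReal (ε / 2)) := by
    refine (FormBound.sum t (hmeas _) fun y => ((hKb y).const_mul (by simp)).mono
      (Eventually.of_forall fun _ => le_rfl)
      (ofReal_div_mul_le (by positivity) hK)).mono (Eventually.of_forall fun _ => le_rfl) ?_
    rw [← ENNReal.ofReal_natCast, ← ENNReal.ofReal_mul (by positivity)]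
    refine ENNReal.ofReal_le_ofReal ?_
    rw [mul_div_assoc', div_le_iff₀ (by positivity)]
    nlinarith
  refine ⟨fun x => ENNReal.ofReal M * (Metric.ball (0 : Space N) (R + 1)).indicator (fun _ => 1) x,
    _, (hind.const_mul _).aemeasurable, (compactForm_ball hα0 hα hN (R + 1)).const_mul hM0,
    (hfb1.add (hmeas _ 0) hfb2).mono (Eventually.of_forall fun _ => le_rfl) ?_, ?_⟩
  · rw [← ENNReal.ofReal_add (by positivity) (by positivity), add_halves]
  · have hae : ∀ᵐ x : Space N, ∀ y ∈ t, x ≠ y :=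
      (Finset.eventually_all t).2 fun y _ => ae_ne_point (by omega) y
    filter_upwards [ae_ne_point (by omega) 0, hae] with x hx hxt
    by_cases hxR : x ∈ Metric.closedBall (0 : Space N) R
    · obtain ⟨y, hyt, hxy⟩ : ∃ y ∈ t, x ∈ Metric.ball y (ρ y) := by simpa using ht hxR
      have hxy' : x - y ≠ 0 := sub_ne_zero.2 (hxt y hyt)
      by_cases hxd : x ∈ Metric.ball y (δ y)
      · refine le_add_left (le_add_left ?_)
        refine le_trans ?_ (Finset.single_le_sum
          (f := fun y => ENNReal.ofReal c₂ * ‖x - y‖ₑ ^ (α - 2)) (fun _ _ => zero_le) hyt)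
        exact enorm_le_of_rpow_mul_le hxy' hc₂0.le rfl (hδ y x hxd (hxt y hyt))
      · refine le_add_right ?_
        have hxR' : x ∈ Metric.ball (0 : Space N) (R + 1) :=
          Metric.closedBall_subset_ball (by linarith) hxR
        rw [Set.indicator_of_mem hxR', mul_one]
        refine (enorm_le_of_rpow_mul_le hxy' zero_le_one rfl (hρ y x hxy (hxt y hyt))).trans ?_
        rw [ENNReal.ofReal_one, one_mul, enorm_rpow_eq hxy']
        refine ENNReal.ofReal_le_ofReal ?_
        have hxd' : δ y ≤ ‖x - y‖ := by
          rw [Metric.mem_ball, dist_eq_norm] at hxd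
          exact not_lt.1 hxd
        calc ‖x - y‖ ^ (α - 2) ≤ δ y ^ (α - 2) :=
              Real.rpow_le_rpow_of_nonpos (hδ0 y) hxd' (by linarith)
          _ ≤ ∑ y ∈ t, δ y ^ (α - 2) :=
              Finset.single_le_sum (f := fun y => δ y ^ (α - 2)) (fun y _ => (hδp y).le) hyt
          _ ≤ M := by rw [hM]; linarith
    · refine le_add_left (le_add_right ?_)
      rw [sub_zero]
      exact enorm_le_of_rpow_mul_le hx hc₁0.le rfl (hR x hxR)

/-- Under condition (G) the form of the positive part of `g` is compact. -/
lemma ConditionG.compactForm {α : ℝ} (hα0 : 0 < α) (hα : α < 2) (hN : 3 ≤ N) {g : Space N → ℝ}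
    (hg : ConditionG α g) : CompactForm α (fun x => ENNReal.ofReal (g x)) := by
  obtain ⟨g₁, g₂, hdec, hg₁, hg₂, hinf⟩ := hg.decomposition
  have hN0 : (0 : ℝ) < N := by exact_mod_cast (by omega : 0 < N)
  have hp0 : 0 < (N : ℝ) / (2 - α) := div_pos hN0 (by linarith)
  have hm := hg₁.aestronglyMeasurable
  -- Only `g₁` needs a measurable representative: the additivity of the integral used here asks for
  -- one measurable summand, and nothing is known about `g₂`.
  have hmk : Measurable fun x => ‖hm.mk g₁ x‖ₑ := hm.stronglyMeasurable_mk.measurable.enorm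
  have h1 : CompactForm α (fun x => ‖hm.mk g₁ x‖ₑ) := by
    refine compactForm_of_Lp hα0 hα hN hmk ?_
    have h2 := ((memLp_congr_ae hm.ae_eq_mk).1 hg₁).eLpNorm_lt_top
    rw [eLpNorm_eq_lintegral_rpow_enorm_toReal (by simpa using hp0) (by simp),
      ENNReal.toReal_ofReal hp0.le] at h2
    intro h3
    rw [h3, ENNReal.top_rpow_of_pos (by positivity)] at h2
    exact lt_irrefl _ h2
  refine (h1.add hmk.aemeasurable (compactForm_of_vanishing hα0 hα hN hg₂ hinf)).mono ?_
  filter_upwards [hdec, hm.ae_eq_mk] with x hx hx1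
  rw [← hx1]
  calc ENNReal.ofReal (g x) ≤ ‖g₁ x + g₂ x‖ₑ := by
        rw [← hx, ← ofReal_norm, Real.norm_of_nonneg (le_max_right _ _)]
        exact ENNReal.ofReal_le_ofReal (le_max_left _ _)
    _ ≤ _ := enorm_add_le _ _

/-! ### Test functions on which the form of `g` is positive -/

lemma integrable_mul_of_hasCompactSupport {g : Space N → ℝ} (hg : LocallyIntegrable g volume)
    {h : Space N → ℝ} (hc : Continuous h) (hs : HasCompactSupport h) :
    Integrable fun x => g x * h x := by
  have := hg.integrable_smul_left_of_hasCompactSupport hc hs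
  simpa only [smul_eq_mul, mul_comm] using this

/-- The potential is positive in mean against a bump function concentrated near a Lebesgue point
where the potential is positive. -/
lemma integral_bump_sq_pos {g : Space N → ℝ} (hg : LocallyIntegrable g volume) {x : Space N}
    (hgx : 0 < g x) (f : ContDiffBump x) (hf : f.rOut = 2 * f.rIn)
    (havg : ⨍ y in Metric.closedBall x f.rOut, ‖g y - g x‖ < g x / 2 ^ N) :
    0 < ∫ y, g y * f y ^ 2 := by
  have hr := f.rIn_pos
  have hfc : Continuous fun y => f y ^ 2 := f.continuous.pow 2
  have hfs : HasCompactSupport fun y => f y ^ 2 :=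
    f.hasCompactSupport.comp_left (g := fun t : ℝ => t ^ 2) (by simp)
  have hfi : Integrable fun y => f y ^ 2 := hfc.integrable_of_hasCompactSupport hfs
  have hgi := integrable_mul_of_hasCompactSupport hg hfc hfs
  set v := volume.real (Metric.closedBall x f.rIn) with hv
  have hv2 : volume.real (Metric.closedBall x f.rOut) = 2 ^ N * v := by
    rw [hv, hf, Measure.real, Measure.real,
      Measure.addHaar_closedBall_mul _ _ (by norm_num : (0 : ℝ) ≤ 2) hr.le,
      Measure.addHaar_closedBall_center _ x, ENNReal.toReal_mul, finrank_euclideanSpace_fin,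
      ENNReal.toReal_ofReal (by positivity)]
  have hv0 : 0 < v := ENNReal.toReal_pos (Metric.measure_closedBall_pos volume _ hr).ne'
    measure_closedBall_lt_top.ne
  have hint : IntegrableOn (fun y => ‖g y - g x‖) (Metric.closedBall x f.rOut) :=
    ((hg.integrableOn_isCompact (isCompact_closedBall _ _)).sub
      (integrableOn_const measure_closedBall_lt_top.ne)).norm
  have h1 : v ≤ ∫ y, f y ^ 2 := by
    calc v = ∫ y in Metric.closedBall x f.rIn, f y ^ 2 := by
          rw [setIntegral_congr_fun (g := fun _ => (1 : ℝ)) measurableSet_closedBall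
            fun y hy => by simp [f.one_of_mem_closedBall hy]]
          simp [hv]
      _ ≤ _ := setIntegral_le_integral hfi (Eventually.of_forall fun y => sq_nonneg _)
  have h2 : ∫ y, (g x - g y) * f y ^ 2 ≤ ∫ y in Metric.closedBall x f.rOut, ‖g y - g x‖ := by
    rw [← integral_indicator measurableSet_closedBall]
    refine integral_mono ?_ (hint.integrable_indicator measurableSet_closedBall) fun y => ?_
    · simp only [sub_mul]
      exact (hfi.const_mul _).sub hgi
    · by_cases hy : y ∈ Metric.closedBall x f.rOut
      · rw [Set.indicator_of_mem hy]
        have a1 : f y ^ 2 ≤ 1 := pow_le_one₀ f.nonneg f.le_one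
        calc (g x - g y) * f y ^ 2 ≤ |g x - g y| * f y ^ 2 := by gcongr; exact le_abs_self _
          _ ≤ |g x - g y| * 1 := by gcongr
          _ = _ := by rw [mul_one, abs_sub_comm, Real.norm_eq_abs]
      · rw [Set.indicator_of_notMem hy]
        have : f y = 0 := f.zero_of_le_dist (by
          rw [Metric.mem_closedBall] at hy; exact (not_le.1 hy).le)
        simp [this]
  -- The outer ball has `2 ^ N` times the volume of the inner one, hence the threshold `g x / 2 ^
  -- N`. The total deviation is then less than `g x * v`, which is at most `g x` times the integral
  -- of `f²`.
  have h3 : ∫ y in Metric.closedBall x f.rOut, ‖g y - g x‖ < g x * v := by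
    rw [setAverage_eq, hv2, smul_eq_mul, inv_mul_eq_div, div_lt_div_iff₀ (by positivity)
      (by positivity)] at havg
    have : (0 : ℝ) < 2 ^ N := by positivity
    nlinarith
  have h4 : ∫ y, (g x - g y) * f y ^ 2 = (g x * ∫ y, f y ^ 2) - ∫ y, g y * f y ^ 2 := by
    simp only [sub_mul]
    rw [integral_sub (hfi.const_mul _) hgi, integral_const_mul]
  have h5 : g x * v ≤ g x * ∫ y, f y ^ 2 := by gcongr
  linarith

/-- There are arbitrarily many test functions with disjoint supports on which the form of `g` is
positive. -/
lemma ConditionG.exists_disjoint_bumps (hN : 0 < N) {α : ℝ} {g : Space N → ℝ}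
    (hg : ConditionG α g) (n : ℕ) :
    ∃ φ : Fin n → Space N → ℝ, (∀ i, IsTestFunction (φ i)) ∧
      (∀ i j, i ≠ j → ∀ x, φ i x * φ j x = 0) ∧ ∀ i, 0 < ∫ x, g x * φ i x ^ 2 := by
  classical
  have : NeZero N := ⟨hN.ne'⟩
  have hleb : ∀ᵐ x : Space N, Tendsto (fun r : ℝ => ⨍ y in Metric.closedBall x r, ‖g y - g x‖)
      (𝓝[>] 0) (𝓝 0) := by
    filter_upwards [IsUnifLocDoublingMeasure.ae_tendsto_average_norm_sub
      (volume : Measure (Space N)) hg.locallyIntegrable 1] with x hx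
    refine hx (fun _ => x) id tendsto_id ?_
    filter_upwards [self_mem_nhdsWithin] with r hr
    simpa using hr.le
  set A : Set (Space N) := {x | 0 < g x ∧ Tendsto (fun r : ℝ =>
    ⨍ y in Metric.closedBall x r, ‖g y - g x‖) (𝓝[>] 0) (𝓝 0)} with hA
  -- Almost every point is a Lebesgue point, so a finite `A` would make the positive part of `g`
  -- vanish almost everywhere.
  have hinf : A.Infinite := by
    intro hfin
    apply hg.posPart_ne_zero
    have h0 : ∀ᵐ x : Space N, x ∉ A := compl_mem_ae_iff.2 (hfin.measure_zero volume)
    filter_upwards [h0, hleb] with x hx hx'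
    refine max_eq_right (not_lt.1 fun h => hx ⟨h, hx'⟩)
  obtain ⟨s, hsA, hsn⟩ := hinf.exists_subset_card_eq n
  let e := (s.equivFinOfCardEq hsn).symm
  have h1 : ∀ x ∈ s, ∀ᶠ r : ℝ in 𝓝[>] 0,
      ⨍ y in Metric.closedBall x (2 * r), ‖g y - g x‖ < g x / 2 ^ N := by
    intro x hx
    have hd : Tendsto (fun r : ℝ => 2 * r) (𝓝[>] 0) (𝓝[>] 0) := by
      refine tendsto_nhdsWithin_iff.2 ⟨?_, ?_⟩
      · have : Tendsto (fun r : ℝ => 2 * r) (𝓝 0) (𝓝 (2 * 0)) := tendsto_id.const_mul 2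
        rw [mul_zero] at this
        exact this.mono_left nhdsWithin_le_nhds
      · filter_upwards [self_mem_nhdsWithin] with r hr
        have : (0 : ℝ) < r := hr
        simpa using this
    refine ((hsA hx).2.comp hd).eventually (gt_mem_nhds ?_)
    exact div_pos (hsA hx).1 (by positivity)
  have h2 : ∀ x ∈ s, ∀ y ∈ s, ∀ᶠ r : ℝ in 𝓝[>] 0, x ≠ y → 2 * r + 2 * r ≤ dist x y := by
    intro x _ y _
    by_cases hxy : x = y
    · exact Eventually.of_forall fun r h => absurd hxy h
    · have hd := dist_pos.2 hxy
      filter_upwards [Ioo_mem_nhdsGT (show (0 : ℝ) < dist x y / 4 by positivity)] with r hr _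
      have := hr.2
      linarith
  have h3 := (Finset.eventually_all s).2 h1
  have h4 := (Finset.eventually_all s).2 fun x hx => (Finset.eventually_all s).2 (h2 x hx)
  obtain ⟨r, ⟨hr3, hr4⟩, hr0⟩ := ((h3.and h4).and self_mem_nhdsWithin).exists
  have hr0' : (0 : ℝ) < r := hr0
  let b : ∀ x : Space N, ContDiffBump x := fun x => ⟨r, 2 * r, hr0', by linarith⟩
  refine ⟨fun i => b (e i), fun i => ⟨(b (e i)).contDiff, (b (e i)).hasCompactSupport⟩,
    fun i j hij x => ?_, fun i => integral_bump_sq_pos hg.locallyIntegrable (hsA (e i).2).1 _ rfl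
      (hr3 _ (e i).2)⟩
  have hne : (e i : Space N) ≠ e j := fun h => hij (e.injective (Subtype.ext h))
  have hd := hr4 _ (e i).2 _ (e j).2 hne
  by_cases hx : dist x (e i) < 2 * r
  · have : b (e j) x = 0 := (b (e j)).zero_of_le_dist (by
      have := dist_triangle_left (e i : Space N) (e j) x
      change 2 * r ≤ _
      linarith)
    simp only [this, mul_zero]
  · have : b (e i) x = 0 := (b (e i)).zero_of_le_dist (not_lt.1 hx)
    simp only [this, zero_mul]

/-! ### Realization of the forms in a product of `L²` spaces -/

lemma eLpNorm_two_sq {X E : Type*} [MeasurableSpace X] [NormedAddCommGroup E] (f : X → E)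
    (μ : Measure X) : eLpNorm f 2 μ ^ 2 = ∫⁻ x, ‖f x‖ₑ ^ 2 ∂μ := by
  rw [eLpNorm_eq_lintegral_rpow_enorm_toReal (by simp) (by simp), ← ENNReal.rpow_natCast,
    ← ENNReal.rpow_mul]
  simp

lemma lintegral_weightMeasure {α : ℝ} (hα : 0 < α) {F : Space N → ℝ≥0∞} (hF : AEMeasurable F) :
    ∫⁻ x, F x ∂weightMeasure N α = ∫⁻ x, ‖x‖ₑ ^ α * F x := by
  have hm : Measurable fun x : Space N => ENNReal.ofReal (‖x‖ ^ α) := by fun_prop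
  rw [weightMeasure, lintegral_withDensity_eq_lintegral_mul₀ hm.aemeasurable hF]
  refine lintegral_congr fun x => ?_
  rw [Pi.mul_apply, ← ENNReal.ofReal_rpow_of_nonneg (norm_nonneg _) hα.le, ofReal_norm]

lemma norm_gradient (φ : Space N → ℝ) (x : Space N) : ‖gradient φ x‖ = ‖fderiv ℝ φ x‖ := by
  simp [gradient]

lemma enorm_gradient (φ : Space N → ℝ) (x : Space N) : ‖gradient φ x‖ₑ = ‖fderiv ℝ φ x‖ₑ := by
  rw [← ofReal_norm, norm_gradient, ofReal_norm]

lemma IsTestFunction.continuous_gradient {φ : Space N → ℝ} (hφ : IsTestFunction φ) :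
    Continuous (gradient φ) :=
  (InnerProductSpace.toDual ℝ (Space N)).symm.continuous.comp hφ.continuous_fderiv

lemma energy_eq_eLpNorm {α : ℝ} (hα : 0 < α) {φ : Space N → ℝ} (hφ : IsTestFunction φ) :
    energy α φ = eLpNorm (gradient φ) 2 (weightMeasure N α) ^ 2 := by
  rw [eLpNorm_two_sq, lintegral_weightMeasure hα
    (hφ.continuous_gradient.enorm.measurable.pow_const 2).aemeasurable, energy]
  simp only [enorm_gradient]

lemma energy_ne_top {α : ℝ} (hα : 0 < α) {φ : Space N → ℝ} (hφ : IsTestFunction φ) :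
    energy α φ ≠ ⊤ := by
  have hdc : HasCompactSupport fun x => ‖fderiv ℝ φ x‖ ^ 2 :=
    (hφ.2.fderiv ℝ).comp_left (g := fun L => ‖L‖ ^ 2) (by simp)
  have hc : Continuous fun x : Space N => ‖x‖ ^ α * ‖fderiv ℝ φ x‖ ^ 2 :=
    (continuous_norm.rpow_const fun _ => Or.inr hα.le).mul (hφ.continuous_fderiv.norm.pow 2)
  have hi := (hc.integrable_of_hasCompactSupport (μ := volume) hdc.mul_left).2
  rw [hasFiniteIntegral_iff_norm] at hi
  refine ((lintegral_mono fun x => ?_).trans_lt hi).ne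
  rw [Real.norm_of_nonneg (by positivity), ENNReal.ofReal_mul (by positivity), ← enorm_sq_eq,
    ← ENNReal.ofReal_rpow_of_nonneg (norm_nonneg _) hα.le, ofReal_norm]

lemma IsTestFunction.memLp_gradient {α : ℝ} (hα : 0 < α) {φ : Space N → ℝ}
    (hφ : IsTestFunction φ) : MemLp (gradient φ) 2 (weightMeasure N α) := by
  refine ⟨hφ.continuous_gradient.aestronglyMeasurable, ?_⟩
  have := energy_ne_top hα hφ
  rw [energy_eq_eLpNorm hα hφ] at this
  exact (lt_top_iff_ne_top.2 fun h => this (by simp [h]))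

lemma IsTestFunction.add {φ ψ : Space N → ℝ} (hφ : IsTestFunction φ) (hψ : IsTestFunction ψ) :
    IsTestFunction fun x => φ x + ψ x := ⟨hφ.1.add hψ.1, hφ.2.add hψ.2⟩

lemma IsTestFunction.const_mul {φ : Space N → ℝ} (hφ : IsTestFunction φ) (c : ℝ) :
    IsTestFunction fun x => c * φ x := ⟨contDiff_const.mul hφ.1, hφ.2.mul_left⟩

lemma IsTestFunction.sub {φ ψ : Space N → ℝ} (hφ : IsTestFunction φ) (hψ : IsTestFunction ψ) :
    IsTestFunction fun x => φ x - ψ x := ⟨hφ.1.sub hψ.1, by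
  have := hφ.2.add (hψ.const_mul (-1)).2
  simpa [sub_eq_add_neg, Pi.add_def] using this⟩

lemma isTestFunction_zero : IsTestFunction (fun _ : Space N => (0 : ℝ)) :=
  ⟨contDiff_const, HasCompactSupport.zero⟩

lemma gradient_add_apply {φ ψ : Space N → ℝ} (hφ : IsTestFunction φ) (hψ : IsTestFunction ψ)
    (x : Space N) : gradient (fun x => φ x + ψ x) x = gradient φ x + gradient ψ x := by
  rw [gradient, fderiv_fun_add (hφ.differentiable x) (hψ.differentiable x), map_add]
  rfl

lemma gradient_sub_apply {φ ψ : Space N → ℝ} (hφ : IsTestFunction φ) (hψ : IsTestFunction ψ)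
    (x : Space N) : gradient (fun x => φ x - ψ x) x = gradient φ x - gradient ψ x := by
  rw [gradient, fderiv_fun_sub (hφ.differentiable x) (hψ.differentiable x), map_sub]
  rfl

lemma gradient_const_mul_apply {φ : Space N → ℝ} (hφ : IsTestFunction φ) (c : ℝ)
    (x : Space N) : gradient (fun x => c * φ x) x = c • gradient φ x := by
  rw [gradient, fderiv_const_mul (hφ.differentiable x), map_smul]
  rfl

/-- The measure `g⁺ dx`. -/
noncomputable def posMeasure (g : Space N → ℝ) : Measure (Space N) :=
  (volume : Measure (Space N)).withDensity fun x => ENNReal.ofReal (g x)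

lemma aemeasurable_ofReal {g : Space N → ℝ} (hg : LocallyIntegrable g volume) :
    AEMeasurable fun x => ENNReal.ofReal (g x) :=
  hg.aestronglyMeasurable.aemeasurable.ennreal_ofReal

lemma posMeasure_absolutelyContinuous (g : Space N → ℝ) : posMeasure g ≪ volume :=
  withDensity_absolutelyContinuous _ _

lemma lintegral_posMeasure {g : Space N → ℝ} (hg : LocallyIntegrable g volume)
    {F : Space N → ℝ≥0∞} (hF : AEMeasurable F) :
    ∫⁻ x, F x ∂posMeasure g = ∫⁻ x, ENNReal.ofReal (g x) * F x := by
  rw [posMeasure, lintegral_withDensity_eq_lintegral_mul₀ (aemeasurable_ofReal hg) hF]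
  rfl

lemma integral_posMeasure {g : Space N → ℝ} (hg : LocallyIntegrable g volume)
    (F : Space N → ℝ) : ∫ x, F x ∂posMeasure g = ∫ x, max (g x) 0 * F x := by
  rw [posMeasure, integral_withDensity_eq_integral_toReal_smul₀ (aemeasurable_ofReal hg)
    (Eventually.of_forall fun _ => by simp)]
  simp only [ENNReal.toReal_ofReal', smul_eq_mul]

lemma integrable_posMeasure_iff {g : Space N → ℝ} (hg : LocallyIntegrable g volume)
    {F : Space N → ℝ} : Integrable F (posMeasure g) ↔ Integrable fun x => max (g x) 0 * F x := by
  rw [posMeasure, integrable_withDensity_iff_integrable_smul₀' (aemeasurable_ofReal hg)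
    (Eventually.of_forall fun _ => by simp)]
  simp only [ENNReal.toReal_ofReal', smul_eq_mul]

lemma lintegral_posMeasure_sq {g : Space N → ℝ} (hg : LocallyIntegrable g volume) {φ : Space N → ℝ}
    (hφ : IsTestFunction φ) : eLpNorm φ 2 (posMeasure g) ^ 2 =
      ∫⁻ x, ENNReal.ofReal (g x) * ‖φ x‖ₑ ^ 2 := by
  rw [eLpNorm_two_sq, lintegral_posMeasure hg
    (hφ.continuous.enorm.measurable.pow_const 2).aemeasurable]

lemma IsTestFunction.memLp_posMeasure {g : Space N → ℝ} (hg : LocallyIntegrable g volume)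
    {φ : Space N → ℝ} (hφ : IsTestFunction φ) : MemLp φ 2 (posMeasure g) := by
  refine ⟨hφ.continuous.aestronglyMeasurable, ?_⟩
  have hs : HasCompactSupport fun x => φ x ^ 2 :=
    hφ.2.comp_left (g := fun t : ℝ => t ^ 2) (by simp)
  have hi := (integrable_mul_of_hasCompactSupport hg (hφ.continuous.pow 2) hs).2
  rw [hasFiniteIntegral_iff_norm] at hi
  have h1 : eLpNorm φ 2 (posMeasure g) ^ 2 < ⊤ := by
    rw [lintegral_posMeasure_sq hg hφ]
    refine (lintegral_mono fun x => ?_).trans_lt hi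
    rw [enorm_sq_eq, ← ENNReal.ofReal_mul' (by positivity)]
    refine ENNReal.ofReal_le_ofReal ?_
    rw [norm_mul, Pi.pow_apply, Real.norm_of_nonneg (sq_nonneg (φ x)), Real.norm_eq_abs (φ x), sq_abs]
    gcongr
    exact le_abs_self _
  exact lt_top_iff_ne_top.2 fun h => h1.ne (by simp [h])

lemma IsTestFunction.integrable_mul_sq {g : Space N → ℝ} (hg : LocallyIntegrable g volume)
    {φ : Space N → ℝ} (hφ : IsTestFunction φ) : Integrable fun x => g x * φ x ^ 2 :=
  integrable_mul_of_hasCompactSupport hg (hφ.continuous.pow 2)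
    (hφ.2.comp_left (g := fun t : ℝ => t ^ 2) (by simp))

/-- The product of `L²` spaces carrying the gradient, the function with respect to `g⁻ dx`, and
the function with respect to `g⁺ dx`. -/
abbrev FormSpace (N : ℕ) (α : ℝ) (g : Space N → ℝ) : Type :=
  Lp (Space N) 2 (weightMeasure N α) × Lp ℝ 2 (posMeasure fun x => - g x) × Lp ℝ 2 (posMeasure g)

/-- The element `x` of the form space is the one defined by the function `φ`. -/
def Represents {α : ℝ} {g : Space N → ℝ} (x : FormSpace N α g) (φ : Space N → ℝ) : Prop :=
  x.1 =ᵐ[weightMeasure N α] gradient φ ∧ x.2.1 =ᵐ[posMeasure fun x => - g x] φ ∧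
    x.2.2 =ᵐ[posMeasure g] φ

lemma represents_zero {α : ℝ} {g : Space N → ℝ} :
    Represents (0 : FormSpace N α g) fun _ => 0 := by
  refine ⟨?_, Lp.coeFn_zero ℝ 2 _, Lp.coeFn_zero ℝ 2 _⟩
  filter_upwards [Lp.coeFn_zero (Space N) 2 (weightMeasure N α)] with z hz
  rw [Prod.fst_zero, hz]
  simp [gradient]

lemma Represents.add {α : ℝ} {g : Space N → ℝ} {x y : FormSpace N α g} {φ ψ : Space N → ℝ}
    (hφ : IsTestFunction φ) (hψ : IsTestFunction ψ) (h : Represents x φ) (k : Represents y ψ) :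
    Represents (x + y) fun z => φ z + ψ z := by
  refine ⟨?_, ?_, ?_⟩
  · filter_upwards [Lp.coeFn_add x.1 y.1, h.1, k.1] with z hz h k
    rw [Prod.fst_add, hz, Pi.add_apply, h, k, gradient_add_apply hφ hψ]
  · filter_upwards [Lp.coeFn_add x.2.1 y.2.1, h.2.1, k.2.1] with z hz h k
    rw [Prod.snd_add, Prod.fst_add, hz, Pi.add_apply, h, k]
  · filter_upwards [Lp.coeFn_add x.2.2 y.2.2, h.2.2, k.2.2] with z hz h k
    rw [Prod.snd_add, Prod.snd_add, hz, Pi.add_apply, h, k]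

lemma Represents.const_smul {α : ℝ} {g : Space N → ℝ} {x : FormSpace N α g} {φ : Space N → ℝ}
    (hφ : IsTestFunction φ) (h : Represents x φ) (c : ℝ) :
    Represents (c • x) fun z => c * φ z := by
  refine ⟨?_, ?_, ?_⟩
  · filter_upwards [Lp.coeFn_smul c x.1, h.1] with z hz h
    rw [Prod.smul_fst, hz, Pi.smul_apply, h, gradient_const_mul_apply hφ]
  · filter_upwards [Lp.coeFn_smul c x.2.1, h.2.1] with z hz h
    rw [Prod.smul_snd, Prod.smul_fst, hz, Pi.smul_apply, h, smul_eq_mul]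
  · filter_upwards [Lp.coeFn_smul c x.2.2, h.2.2] with z hz h
    rw [Prod.smul_snd, Prod.smul_snd, hz, Pi.smul_apply, h, smul_eq_mul]

/-- Test functions as a subspace of the form space. -/
def testSubmodule (N : ℕ) (α : ℝ) (g : Space N → ℝ) : Submodule ℝ (FormSpace N α g) where
  carrier := {x | ∃ φ, IsTestFunction φ ∧ Represents x φ}
  add_mem' := by
    rintro x y ⟨φ, hφ, h⟩ ⟨ψ, hψ, k⟩
    exact ⟨_, hφ.add hψ, h.add hφ hψ k⟩
  zero_mem' := ⟨_, isTestFunction_zero, represents_zero⟩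
  smul_mem' := by
    rintro c x ⟨φ, hφ, h⟩
    exact ⟨_, hφ.const_mul c, h.const_smul hφ c⟩

lemma exists_represents {α : ℝ} (hα : 0 < α) {g : Space N → ℝ} (hg : LocallyIntegrable g volume)
    {φ : Space N → ℝ} (hφ : IsTestFunction φ) :
    ∃ x ∈ testSubmodule N α g, Represents x φ := by
  have h1 := hφ.memLp_gradient hα
  have h2 := hφ.memLp_posMeasure (g := fun x => - g x) hg.neg
  have h3 := hφ.memLp_posMeasure hg
  have hr : Represents (α := α) (g := g) (h1.toLp, h2.toLp, h3.toLp) φ :=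
    ⟨h1.coeFn_toLp, h2.coeFn_toLp, h3.coeFn_toLp⟩
  exact ⟨_, ⟨φ, hφ, hr⟩, hr⟩

lemma Represents.sub {α : ℝ} {g : Space N → ℝ} {x y : FormSpace N α g} {φ ψ : Space N → ℝ}
    (hφ : IsTestFunction φ) (hψ : IsTestFunction ψ) (h : Represents x φ) (k : Represents y ψ) :
    Represents (x - y) fun z => φ z - ψ z := by
  refine ⟨?_, ?_, ?_⟩
  · filter_upwards [Lp.coeFn_sub x.1 y.1, h.1, k.1] with z hz h k
    rw [Prod.fst_sub, hz, Pi.sub_apply, h, k, gradient_sub_apply hφ hψ]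
  · filter_upwards [Lp.coeFn_sub x.2.1 y.2.1, h.2.1, k.2.1] with z hz h k
    rw [Prod.snd_sub, Prod.fst_sub, hz, Pi.sub_apply, h, k]
  · filter_upwards [Lp.coeFn_sub x.2.2 y.2.2, h.2.2, k.2.2] with z hz h k
    rw [Prod.snd_sub, Prod.snd_sub, hz, Pi.sub_apply, h, k]

lemma Represents.enorm_fst {α : ℝ} (hα : 0 < α) {g : Space N → ℝ} {x : FormSpace N α g}
    {φ : Space N → ℝ} (hφ : IsTestFunction φ) (h : Represents x φ) :
    ‖x.1‖ₑ ^ 2 = energy α φ := by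
  rw [Lp.enorm_def, eLpNorm_congr_ae h.1, energy_eq_eLpNorm hα hφ]

lemma Represents.enorm_snd_snd {α : ℝ} {g : Space N → ℝ} (hg : LocallyIntegrable g volume)
    {x : FormSpace N α g} {φ : Space N → ℝ} (hφ : IsTestFunction φ) (h : Represents x φ) :
    ‖x.2.2‖ₑ ^ 2 = ∫⁻ x, ENNReal.ofReal (g x) * ‖φ x‖ₑ ^ 2 := by
  rw [Lp.enorm_def, eLpNorm_congr_ae h.2.2, lintegral_posMeasure_sq hg hφ]

lemma norm_sq_eq_integral {g : Space N → ℝ} (hg : LocallyIntegrable g volume)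
    (f : Lp ℝ 2 (posMeasure g)) {φ : Space N → ℝ} (h : f =ᵐ[posMeasure g] φ) :
    ‖f‖ ^ 2 = ∫ x, max (g x) 0 * φ x ^ 2 := by
  rw [← real_inner_self_eq_norm_sq, L2.inner_def, ← integral_posMeasure hg]
  refine integral_congr_ae (h.mono fun x hx => ?_)
  simp [hx, pow_two]

lemma Represents.norm_sq_sub {α : ℝ} {g : Space N → ℝ} (hg : LocallyIntegrable g volume)
    {x : FormSpace N α g} {φ : Space N → ℝ} (hφ : IsTestFunction φ) (h : Represents x φ) :
    ‖x.2.2‖ ^ 2 - ‖x.2.1‖ ^ 2 = ∫ x, g x * φ x ^ 2 := by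
  have h1 := hφ.memLp_posMeasure hg
  have h2 := hφ.memLp_posMeasure (g := fun x => - g x) hg.neg
  rw [norm_sq_eq_integral hg _ h.2.2, norm_sq_eq_integral hg.neg _ h.2.1, ← integral_sub]
  · refine integral_congr_ae (Eventually.of_forall fun x => ?_)
    beta_reduce
    rw [← sub_mul]
    congr 1
    rcases le_total (g x) 0 with h | h
    · rw [max_eq_right h, max_eq_left (by simpa using h)]; simp
    · rw [max_eq_left h, max_eq_right (by simpa using h)]; simp
  · exact (integrable_posMeasure_iff hg).1 h1.integrable_sq
  · exact (integrable_posMeasure_iff hg.neg).1 h2.integrable_sq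

lemma norm_le_of_enorm_sq_le {E F : Type*} [NormedAddCommGroup E] [NormedAddCommGroup F] {x : E}
    {y : F} {C : ℝ≥0∞} (hC : C ≠ ⊤) (h : ‖x‖ₑ ^ 2 ≤ C * ‖y‖ₑ ^ 2) :
    ‖x‖ ≤ Real.sqrt C.toReal * ‖y‖ := by
  rw [enorm_sq_eq, enorm_sq_eq, ← ENNReal.ofReal_toReal hC,
    ← ENNReal.ofReal_mul ENNReal.toReal_nonneg, ENNReal.ofReal_le_ofReal_iff
    (mul_nonneg ENNReal.toReal_nonneg (sq_nonneg _))] at h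
  refine le_of_sq_le_sq ?_ (by positivity)
  rwa [mul_pow, Real.sq_sqrt ENNReal.toReal_nonneg]

/-- The form domain: the closure of the test functions. -/
noncomputable def formDomain (N : ℕ) (α : ℝ) (g : Space N → ℝ) :
    Submodule ℝ (FormSpace N α g) := (testSubmodule N α g).topologicalClosure

lemma exists_seq_tendsto_of_mem_formDomain {α : ℝ} {g : Space N → ℝ} {x : FormSpace N α g}
    (hx : x ∈ formDomain N α g) :
    ∃ (s : ℕ → FormSpace N α g) (φ : ℕ → Space N → ℝ), (∀ n, s n ∈ testSubmodule N α g) ∧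
      (∀ n, IsTestFunction (φ n)) ∧ (∀ n, Represents (s n) (φ n)) ∧ Tendsto s atTop (𝓝 x) := by
  obtain ⟨s, hs, hlim⟩ := mem_closure_iff_seq_limit.1 hx
  have hs' : ∀ n, s n ∈ testSubmodule N α g := hs
  choose φ hφ hr using hs
  exact ⟨s, φ, hs', hφ, hr, hlim⟩

/-- The form of `g⁺` is bounded on the form domain. -/
lemma exists_norm_le_of_mem_formDomain {α : ℝ} (hα : 0 < α) {g : Space N → ℝ}
    (hg : LocallyIntegrable g volume) (hcf : CompactForm α fun x => ENNReal.ofReal (g x)) :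
    ∃ C : ℝ, ∀ x ∈ formDomain N α g, ‖x.2.2‖ ≤ C * ‖x.1‖ := by
  obtain ⟨C, hC, hb⟩ := hcf.formBound
  refine ⟨Real.sqrt C.toReal, fun x hx => ?_⟩
  obtain ⟨s, φ, -, hφ, hr, hlim⟩ := exists_seq_tendsto_of_mem_formDomain hx
  have h1 : Tendsto (fun n => ‖(s n).2.2‖) atTop (𝓝 ‖x.2.2‖) :=
    (continuous_snd.snd.norm.tendsto x).comp hlim
  have h2 : Tendsto (fun n => Real.sqrt C.toReal * ‖(s n).1‖) atTop
      (𝓝 (Real.sqrt C.toReal * ‖x.1‖)) :=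
    ((continuous_fst.norm.tendsto x).comp hlim).const_mul _
  refine le_of_tendsto_of_tendsto' h1 h2 fun n => norm_le_of_enorm_sq_le hC ?_
  rw [(hr n).enorm_fst hα (hφ n), (hr n).enorm_snd_snd hg (hφ n)]
  exact hb _ (hφ n)

/-- The functionals of the compact form map the set to a bounded, hence totally bounded, subset of a
finite-dimensional space. Elements with nearby images differ by a vector on which the form is small,
so a finite net downstairs discretizes the set. The radius `2` leaves room for passing to the
closure in `totallyBounded_formDomain`. -/
lemma totallyBounded_testSubmodule {α : ℝ} (hα : 0 < α) {g : Space N → ℝ}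
    (hg : LocallyIntegrable g volume) (hcf : CompactForm α fun x => ENNReal.ofReal (g x)) :
    TotallyBounded ((fun x : FormSpace N α g => x.2.2) ''
      {x | x ∈ testSubmodule N α g ∧ ‖x.1‖ ≤ 2}) := by
  refine Metric.totallyBounded_of_finite_discretization fun ε hε => ?_
  obtain ⟨ι, hι, l, hl, hb⟩ := hcf (ε ^ 2 / 32) (by positivity)
  choose C hC hlC using fun i => (hl i).2
  have hrep : ∀ z : ((fun x : FormSpace N α g => x.2.2) ''
      {x | x ∈ testSubmodule N α g ∧ ‖x.1‖ ≤ 2}), ∃ (x : FormSpace N α g) (φ : Space N → ℝ),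
      IsTestFunction φ ∧ Represents x φ ∧ ‖x.1‖ ≤ 2 ∧ x.2.2 = z := by
    rintro ⟨_, x, ⟨⟨φ, hφ, hr⟩, hx2⟩, rfl⟩
    exact ⟨x, φ, hφ, hr, hx2, rfl⟩
  choose X φ hφ hr hX2 hXz using hrep
  let L := fun z => (fun i => l i (φ z) : ι → ℝ)
  have hbdd : ∀ z, L z ∈ Metric.closedBall (0 : ι → ℝ) (∑ i, Real.sqrt (C i).toReal * 2) := by
    intro z
    rw [mem_closedBall_zero_iff]
    refine (pi_norm_le_iff_of_nonneg (by positivity)).2 fun i => ?_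
    have h1 : ‖l i (φ z)‖ ≤ Real.sqrt (C i).toReal * ‖(X z).1‖ := by
      refine norm_le_of_enorm_sq_le (hC i) ?_
      rw [(hr z).enorm_fst hα (hφ z)]
      exact hlC i _ (hφ z)
    calc ‖L z i‖ ≤ Real.sqrt (C i).toReal * 2 := h1.trans (by gcongr; exact hX2 z)
      _ ≤ _ := Finset.single_le_sum (f := fun i => Real.sqrt (C i).toReal * 2)
        (fun i _ => by positivity) (Finset.mem_univ i)
  -- The functionals contribute at most `ε² / 4`. The energy term contributes at most `16 * ε² /
  -- 32`, since differences have first component of norm at most `4`. Together this is below `ε²`.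
  set η : ℝ := ε / (2 * (Fintype.card ι + 1)) with hη
  have hη0 : 0 < η := by positivity
  obtain ⟨t, ht, htc⟩ := Metric.totallyBounded_iff.1
    (isCompact_closedBall (0 : ι → ℝ) (∑ i, Real.sqrt (C i).toReal * 2)).totallyBounded (η / 2)
    (by positivity)
  have := ht.fintype
  have hsel : ∀ z, ∃ y : t, L z ∈ Metric.ball (y : ι → ℝ) (η / 2) := by
    intro z
    obtain ⟨y, hy, h⟩ := Set.mem_iUnion₂.1 (htc (hbdd z))
    exact ⟨⟨y, hy⟩, h⟩
  choose F hF using hsel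
  refine ⟨t, inferInstance, F, fun z w hzw => ?_⟩
  have hd : dist (L z) (L w) < η := by
    have h1 := hF z
    have h2 := hF w
    rw [← hzw] at h2
    rw [Metric.mem_ball] at h1 h2
    have := dist_triangle_right (L z) (L w) (F z)
    linarith
  have hlin : ∀ i, l i (fun x => φ z x - φ w x) = l i (φ z) - l i (φ w) := fun i =>
    (hl i).1 _ _ (hφ z) (hφ w)
  have hs := (hr z).sub (hφ z) (hφ w) (hr w)
  have hst := (hφ z).sub (hφ w)
  have h1 := hb _ hst
  rw [← hs.enorm_fst hα hst, ← hs.enorm_snd_snd hg hst] at h1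
  have hli : ∀ i, ‖l i (fun x => φ z x - φ w x)‖ₑ ^ 2 ≤ ENNReal.ofReal (η ^ 2) := by
    intro i
    rw [hlin, enorm_sq_eq]
    refine ENNReal.ofReal_le_ofReal (pow_le_pow_left₀ (norm_nonneg _) ?_ 2)
    rw [← dist_eq_norm]
    exact (dist_le_pi_dist (L z) (L w) i).trans hd.le
  have h2 : ‖(X z - X w).2.2‖ₑ ^ 2 ≤ ENNReal.ofReal (ε ^ 2 / 32) * ‖(X z - X w).1‖ₑ ^ 2 +
      Fintype.card ι * ENNReal.ofReal (η ^ 2) := by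
    refine h1.trans (add_le_add le_rfl ((Finset.sum_le_sum fun i _ => hli i).trans (le_of_eq ?_)))
    rw [Finset.sum_const, nsmul_eq_mul, Finset.card_univ]
  rw [enorm_sq_eq, enorm_sq_eq, ← ENNReal.ofReal_mul (by positivity), ← ENNReal.ofReal_natCast,
    ← ENNReal.ofReal_mul (by positivity), ← ENNReal.ofReal_add (by positivity) (by positivity),
    ENNReal.ofReal_le_ofReal_iff (by positivity)] at h2
  have h3 : ‖(X z - X w).1‖ ≤ 4 := by
    rw [Prod.fst_sub]
    refine (norm_sub_le _ _).trans ?_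
    linarith [hX2 z, hX2 w]
  have h4 : ‖(X z - X w).1‖ ^ 2 ≤ 16 := by nlinarith [norm_nonneg (X z - X w).1]
  have h5 : Fintype.card ι * η ^ 2 ≤ ε ^ 2 / 4 := by
    rw [hη, div_pow, mul_div_assoc', div_le_div_iff₀ (by positivity) (by positivity)]
    have : (0 : ℝ) ≤ Fintype.card ι := Nat.cast_nonneg _
    nlinarith [sq_nonneg ε, mul_nonneg this (sq_nonneg ε), mul_nonneg (mul_nonneg this this)
      (sq_nonneg ε)]
  have h6 : ‖(X z - X w).2.2‖ ^ 2 < ε ^ 2 := by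
    have : ε ^ 2 / 32 * ‖(X z - X w).1‖ ^ 2 ≤ ε ^ 2 / 32 * 16 := by gcongr
    nlinarith [sq_pos_of_pos hε]
  have h7 := lt_of_pow_lt_pow_left₀ 2 hε.le h6
  rwa [Prod.snd_sub, Prod.snd_sub, hXz, hXz, ← dist_eq_norm] at h7

lemma totallyBounded_formDomain {α : ℝ} (hα : 0 < α) {g : Space N → ℝ}
    (hg : LocallyIntegrable g volume) (hcf : CompactForm α fun x => ENNReal.ofReal (g x)) :
    TotallyBounded ((fun x : FormSpace N α g => x.2.2) ''
      {x | x ∈ formDomain N α g ∧ ‖x.1‖ ≤ 1}) := by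
  refine (totallyBounded_testSubmodule hα hg hcf).closure.subset ?_
  rintro _ ⟨x, ⟨hx, hx1⟩, rfl⟩
  obtain ⟨s, φ, hs, -, -, hlim⟩ := exists_seq_tendsto_of_mem_formDomain hx
  have h1 : Tendsto (fun n => ‖(s n).1‖) atTop (𝓝 ‖x.1‖) :=
    (continuous_fst.norm.tendsto x).comp hlim
  refine mem_closure_of_tendsto ((continuous_snd.snd.tendsto x).comp hlim) ?_
  filter_upwards [h1.eventually (gt_mem_nhds (show ‖x.1‖ < 2 by linarith))] with n hn
  exact ⟨s n, ⟨hs n, hn.le⟩, rfl⟩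

/-! ### Weak eigenvectors in the form domain -/

lemma represents_sum {α : ℝ} {g : Space N → ℝ} {ι : Type*} {φ : ι → Space N → ℝ}
    (hφ : ∀ i, IsTestFunction (φ i)) {x : ι → FormSpace N α g}
    (hx : ∀ i, Represents (x i) (φ i)) (c : ι → ℝ) (s : Finset ι) :
    IsTestFunction (fun z => ∑ i ∈ s, c i * φ i z) ∧
      Represents (∑ i ∈ s, c i • x i) fun z => ∑ i ∈ s, c i * φ i z := by
  induction s using Finset.cons_induction with
  | empty => simpa using ⟨isTestFunction_zero, represents_zero⟩
  | cons a s ha ih =>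
    simp only [Finset.sum_cons]
    exact ⟨((hφ a).const_mul (c a)).add ih.1,
      ((hx a).const_smul (hφ a) (c a)).add ((hφ a).const_mul (c a)) ih.1 ih.2⟩

/-- The form of `g` is positive on infinitely many independent directions. -/
lemma ConditionG.exists_positive_direction (hN : 0 < N) {α : ℝ} (hα : 0 < α) {g : Space N → ℝ}
    (hg : ConditionG α g) (F : Finset (Lp (Space N) 2 (weightMeasure N α))) :
    ∃ x ∈ formDomain N α g, (∀ f ∈ F, inner ℝ f x.1 = 0) ∧ ‖x.2.1‖ < ‖x.2.2‖ := by
  have hgl := hg.locallyIntegrable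
  obtain ⟨φ, hφ, hdisj, hpos⟩ := hg.exists_disjoint_bumps hN (F.card + 1)
  choose x hxS hxr using fun i => exists_represents hα hgl (hφ i)
  let T : (Fin (F.card + 1) → ℝ) →ₗ[ℝ] (F → ℝ) :=
    LinearMap.pi fun f => ∑ i, (inner ℝ (f : Lp (Space N) 2 (weightMeasure N α)) (x i).1 : ℝ) •
      LinearMap.proj i
  -- There is one bump more than there are orthogonality conditions, so some nontrivial combination
  -- satisfies them all.
  have hker : LinearMap.ker T ≠ ⊥ := LinearMap.ker_ne_bot_of_finrank_lt (by simp)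
  obtain ⟨c, hc, hc0⟩ := Submodule.exists_mem_ne_zero_of_ne_bot hker
  obtain ⟨ht, hr⟩ := represents_sum hφ hxr c Finset.univ
  refine ⟨∑ i, c i • x i, Submodule.le_topologicalClosure _
    (Submodule.sum_mem _ fun i _ => Submodule.smul_mem _ _ (hxS i)), fun f hf => ?_, ?_⟩
  · have h1 := congrFun (LinearMap.mem_ker.1 hc) ⟨f, hf⟩
    simp only [T, LinearMap.pi_apply, LinearMap.sum_apply, LinearMap.smul_apply,
      LinearMap.proj_apply, smul_eq_mul, Pi.zero_apply] at h1
    rw [Prod.fst_sum, inner_sum, ← h1]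
    refine Finset.sum_congr rfl fun i _ => ?_
    rw [Prod.smul_fst, real_inner_smul_right, mul_comm]
  · have h1 := hr.norm_sq_sub hgl ht
    -- Disjoint supports remove the cross terms, so the form of the combination is a sum of
    -- nonnegative terms, one of them positive.
    have hsq : ∀ z, (∑ i, c i * φ i z) ^ 2 = ∑ i, c i ^ 2 * φ i z ^ 2 := by
      intro z
      rw [pow_two, Finset.sum_mul_sum]
      refine Finset.sum_congr rfl fun i _ => ?_
      rw [Finset.sum_eq_single i]
      · ring
      · intro j _ hj
        rw [mul_mul_mul_comm, hdisj i j hj.symm z, mul_zero]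
      · simp
    have h2 : ∫ z, g z * (∑ i, c i * φ i z) ^ 2 = ∑ i, c i ^ 2 * ∫ z, g z * φ i z ^ 2 := by
      have : ∀ z, g z * (∑ i, c i * φ i z) ^ 2 = ∑ i, c i ^ 2 * (g z * φ i z ^ 2) := fun z => by
        rw [hsq, Finset.mul_sum]
        exact Finset.sum_congr rfl fun i _ => by ring
      simp only [this]
      rw [integral_finsetSum _ fun i _ => ((hφ i).integrable_mul_sq hgl).const_mul _]
      simp only [integral_const_mul]
    rw [h2] at h1
    have h3 : 0 < ∑ i, c i ^ 2 * ∫ z, g z * φ i z ^ 2 := by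
      obtain ⟨i, hi⟩ := Function.ne_iff.1 hc0
      refine Finset.sum_pos' (fun i _ => mul_nonneg (sq_nonneg _) (hpos i).le)
        ⟨i, Finset.mem_univ _, mul_pos (sq_pos_of_ne_zero hi) (hpos i)⟩
    exact lt_of_pow_lt_pow_left₀ 2 (norm_nonneg _) (by linarith)

/-- Existence of large eigenvalues in the form domain. -/
lemma ConditionG.exists_weak_eigenvector (hN : 3 ≤ N) {α : ℝ} (hα0 : 0 < α) (hα : α < 2)
    {g : Space N → ℝ} (hg : ConditionG α g) (R : ℝ) :
    ∃ lam : ℝ, R < lam ∧ 0 < lam ∧ ∃ x ∈ formDomain N α g, x.1 ≠ 0 ∧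
      ∀ z ∈ formDomain N α g,
        inner ℝ x.1 z.1 = lam * (inner ℝ x.2.2 z.2.2 - inner ℝ x.2.1 z.2.1) := by
  have hcf := hg.compactForm hα0 hα hN
  obtain ⟨C, hC⟩ := exists_norm_le_of_mem_formDomain hα0 hg.locallyIntegrable hcf
  exact exists_large_eigenvalue _ (Submodule.isClosed_topologicalClosure _) hC
    (totallyBounded_formDomain hα0 hg.locallyIntegrable hcf)
    (hg.exists_positive_direction (by omega) hα0) R

/-! ### Almost everywhere limits and extension to the energy space -/

/-- The limit of test functions that converge in energy exists almost everywhere along a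
subsequence. -/
lemma exists_ae_limit {α : ℝ} (hα0 : 0 < α) (hα : α < 2) (hN : 3 ≤ N) {g : Space N → ℝ}
    {s : ℕ → FormSpace N α g} {φ : ℕ → Space N → ℝ} {x : FormSpace N α g}
    (hφ : ∀ n, IsTestFunction (φ n)) (hr : ∀ n, Represents (s n) (φ n))
    (hs : Tendsto s atTop (𝓝 x)) :
    ∃ (k : ℕ → ℕ) (u : Space N → ℝ), StrictMono k ∧
      ∀ᵐ z : Space N, Tendsto (fun n => φ (k n) z) atTop (𝓝 (u z)) := by
  have hN3 : (3 : ℝ) ≤ N := by exact_mod_cast hN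
  have hH := hardy (N := N) hα (by omega) (by linarith)
  set C := ENNReal.ofReal ((2 / ((N : ℝ) + α - 2)) ^ 2)
  have hCt : C ≠ ⊤ := ENNReal.ofReal_ne_top
  have hw : AEMeasurable fun x : Space N => ‖x‖ₑ ^ (α - 2) := by fun_prop
  -- By Hardy's inequality, convergence in energy implies convergence in `L²(μ₀)`. The density is
  -- nowhere zero, so `μ₀`-null sets are Lebesgue null.
  set μ₀ : Measure (Space N) := volume.withDensity fun x => ‖x‖ₑ ^ (α - 2) with hμ₀
  have hbound : ∀ ψ : Space N → ℝ, IsTestFunction ψ → eLpNorm ψ 2 μ₀ ^ 2 ≤ C * energy α ψ := by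
    intro ψ hψ
    rw [eLpNorm_two_sq, hμ₀, lintegral_withDensity_eq_lintegral_mul₀ hw
      (hψ.continuous.enorm.measurable.pow_const 2).aemeasurable]
    exact hH ψ hψ
  have hmem : ∀ n, MemLp (φ n) 2 μ₀ := fun n => by
    refine ⟨(hφ n).continuous.aestronglyMeasurable, lt_top_iff_ne_top.2 fun h => ?_⟩
    have h1 := hbound _ (hφ n)
    rw [h, ENNReal.top_pow two_ne_zero, top_le_iff] at h1
    exact ENNReal.mul_ne_top hCt (energy_ne_top hα0 (hφ n)) h1
  set f : ℕ → Lp ℝ 2 μ₀ := fun n => (hmem n).toLp with hf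
  have hdist : ∀ m n, dist (f m) (f n) ≤ Real.sqrt C.toReal * dist (s m) (s n) := by
    intro m n
    have hst := (hφ m).sub (hφ n)
    have h1 : ‖f m - f n‖ ≤ Real.sqrt C.toReal * ‖(s m - s n).1‖ := by
      refine norm_le_of_enorm_sq_le hCt ?_
      rw [((hr m).sub (hφ m) (hφ n) (hr n)).enorm_fst hα0 hst, hf, ← MemLp.toLp_sub, Lp.enorm_def,
        eLpNorm_congr_ae (MemLp.coeFn_toLp _)]
      exact hbound _ hst
    rw [dist_eq_norm, dist_eq_norm]
    refine h1.trans ?_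
    gcongr
    exact norm_fst_le _
  have hcauchy : CauchySeq f := by
    rw [Metric.cauchySeq_iff]
    intro ε hε
    obtain ⟨M, hM⟩ := Metric.cauchySeq_iff.1 hs.cauchySeq (ε / (Real.sqrt C.toReal + 1))
      (by positivity)
    refine ⟨M, fun m hm n hn => (hdist m n).trans_lt ?_⟩
    have h1 := hM m hm n hn
    rw [lt_div_iff₀ (by positivity)] at h1
    nlinarith [dist_nonneg (x := s m) (y := s n)]
  obtain ⟨u, hu⟩ := cauchySeq_tendsto_of_complete hcauchy
  obtain ⟨k, hk, hae⟩ := (tendstoInMeasure_of_tendsto_Lp hu).exists_seq_tendsto_ae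
  refine ⟨k, u, hk, ?_⟩
  have hac : (volume : Measure (Space N)) ≪ μ₀ := by
    refine withDensity_absolutelyContinuous' hw ?_
    refine Eventually.of_forall fun x h => ?_
    rw [ENNReal.rpow_eq_zero_iff] at h
    rcases h with h | h
    · linarith [h.2]
    · exact enorm_ne_top h.1
  have hcoe : ∀ᵐ z ∂μ₀, ∀ n, f n z = φ n z := ae_all_iff.2 fun n => (hmem n).coeFn_toLp
  refine hac.ae_le ?_
  filter_upwards [hae, hcoe] with z hz hz'
  simpa only [hz'] using hz

/-- Limits in `L²` and almost everywhere coincide. -/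
lemma ae_eq_of_tendsto_Lp {X : Type*} [MeasurableSpace X] {ν : Measure X} {f : ℕ → Lp ℝ 2 ν}
    {F : Lp ℝ 2 ν} (hf : Tendsto f atTop (𝓝 F)) {φ : ℕ → X → ℝ} (hφ : ∀ n, f n =ᵐ[ν] φ n)
    {u : X → ℝ} (hu : ∀ᵐ x ∂ν, Tendsto (fun n => φ n x) atTop (𝓝 (u x))) : F =ᵐ[ν] u := by
  obtain ⟨k, hk, hae⟩ := (tendstoInMeasure_of_tendsto_Lp hf).exists_seq_tendsto_ae
  have hcoe : ∀ᵐ z ∂ν, ∀ n, f n z = φ n z := ae_all_iff.2 hφ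
  filter_upwards [hae, hcoe, hu] with z h1 h2 h3
  simp only [h2] at h1
  exact tendsto_nhds_unique h1 (h3.comp hk.tendsto_atTop)

/-- A weighted bound for test functions extends to the space `W`. -/
lemma MemW.integrable_mul {α : ℝ} {ν : Measure (Space N)}
    (hν : ν ≪ volume) {u : Space N → ℝ} (hu : AEStronglyMeasurable u ν) {C : ℝ≥0∞} (hC : C ≠ ⊤)
    (hbound : ∀ v : Space N → ℝ, IsTestFunction v →
      ∫⁻ x, ‖u x‖ₑ * ‖v x‖ₑ ∂ν ≤ C * eLpNorm (gradient v) 2 (weightMeasure N α))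
    (hα : 0 < α) {v : Space N → ℝ} {H : Space N → Space N} (hH : MemLp H 2 (weightMeasure N α))
    {w : ℕ → Space N → ℝ} (hw : ∀ n, IsTestFunction (w n))
    (hlim : ∀ᵐ x : Space N, Tendsto (fun n => w n x) atTop (𝓝 (v x)))
    (hgrad : Tendsto (fun n => eLpNorm (fun x => gradient (w n) x - H x) 2 (weightMeasure N α))
      atTop (𝓝 0)) :
    Integrable (fun x => u x * v x) ν ∧
      Tendsto (fun n => ∫ x, u x * w n x ∂ν) atTop (𝓝 (∫ x, u x * v x ∂ν)) := by
  have hlimν := hν.ae_le hlim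
  have hwm : ∀ n, AEStronglyMeasurable (w n) ν := fun n => (hw n).continuous.aestronglyMeasurable
  have hvm : AEStronglyMeasurable v ν := aestronglyMeasurable_of_tendsto_ae atTop hwm hlimν
  have hgm : ∀ n, AEStronglyMeasurable (fun x => gradient (w n) x - H x) (weightMeasure N α) :=
    fun n => (hw n).continuous_gradient.aestronglyMeasurable.sub hH.1
  have hint : ∀ n, Integrable (fun x => u x * w n x) ν := by
    intro n
    refine ⟨hu.mul (hwm n), ?_⟩
    refine lt_of_le_of_lt ?_ (ENNReal.mul_lt_top hC.lt_top ((hw n).memLp_gradient hα).2)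
    refine le_trans (le_of_eq ?_) (hbound _ (hw n))
    simp only [enorm_mul]
  -- The assumed bound is applied to `w n - w m`, and Fatou's lemma lets `m` tend to infinity. A
  -- finite value for one large `n` then gives the integrability of `u * v`.
  have hdiff : ∀ n, ∫⁻ x, ‖u x * w n x - u x * v x‖ₑ ∂ν ≤
      C * eLpNorm (fun x => gradient (w n) x - H x) 2 (weightMeasure N α) := by
    intro n
    refine lintegral_le_of_tendsto_of_le (f := fun m x => ‖u x * w n x - u x * w m x‖ₑ)
      (b := fun m => C * (eLpNorm (fun x => gradient (w n) x - H x) 2 (weightMeasure N α) +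
        eLpNorm (fun x => gradient (w m) x - H x) 2 (weightMeasure N α)))
      (fun m => ((hu.mul (hwm n)).sub (hu.mul (hwm m))).enorm) ?_ (fun m => ?_) ?_
    · filter_upwards [hlimν] with x hx
      exact (tendsto_const_nhds.sub (hx.const_mul (u x))).enorm
    · have h1 := hbound _ ((hw n).sub (hw m))
      simp only [← mul_sub, enorm_mul]
      refine h1.trans ?_
      gcongr
      refine le_trans (le_of_eq ?_) (eLpNorm_sub_le (hgm n) (hgm m) one_le_two)
      congr 1
      ext1 x
      rw [gradient_sub_apply (hw n) (hw m), Pi.sub_apply, sub_sub_sub_cancel_right]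
    · have := ENNReal.Tendsto.const_mul (a := C) (tendsto_const_nhds (x := eLpNorm
        (fun x => gradient (w n) x - H x) 2 (weightMeasure N α)) |>.add hgrad) (Or.inr hC)
      rwa [add_zero] at this
  have hto0 : Tendsto (fun n => ∫⁻ x, ‖u x * w n x - u x * v x‖ₑ ∂ν) atTop (𝓝 0) := by
    have h1 := ENNReal.Tendsto.const_mul (a := C) hgrad (Or.inr hC)
    rw [mul_zero] at h1
    exact tendsto_of_tendsto_of_tendsto_of_le_of_le tendsto_const_nhds h1 (fun _ => zero_le) hdiff
  have hi : Integrable (fun x => u x * v x) ν := by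
    obtain ⟨n, hn⟩ := (hto0.eventually (gt_mem_nhds zero_lt_one)).exists
    have h1 : Integrable (fun x => u x * w n x - u x * v x) ν :=
      ⟨(hu.mul (hwm n)).sub (hu.mul hvm), hn.trans ENNReal.one_lt_top⟩
    exact ((hint n).sub h1).congr (Eventually.of_forall fun x => sub_sub_cancel _ _)
  exact ⟨hi, tendsto_integral_of_L1 _ hi.1 (Eventually.of_forall hint) hto0⟩

/-- The Cauchy-Schwarz inequality. -/
lemma integral_norm_mul_norm_le {X E F : Type*} [MeasurableSpace X] {μ : Measure X}
    [NormedAddCommGroup E] [NormedAddCommGroup F] {f : X → E} {h : X → F} (hf : MemLp f 2 μ)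
    (hh : MemLp h 2 μ) : Integrable (fun x => ‖f x‖ * ‖h x‖) μ ∧
      ∫ x, ‖f x‖ * ‖h x‖ ∂μ ≤ (eLpNorm f 2 μ).toReal * (eLpNorm h 2 μ).toReal := by
  refine ⟨hf.norm.integrable_mul hh.norm, ?_⟩
  have h1 := real_inner_le_norm hf.norm.toLp hh.norm.toLp
  rw [Lp.norm_toLp, Lp.norm_toLp, eLpNorm_norm, eLpNorm_norm, L2.inner_def] at h1
  refine le_trans (le_of_eq (integral_congr_ae ?_)) h1
  filter_upwards [hf.norm.coeFn_toLp, hh.norm.coeFn_toLp] with x h2 h3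
  rw [h2, h3]
  simp [mul_comm]

/-! ### Kato's inequality -/

/-- The smooth function `√(t² + ε²) - ε`, an approximation of the absolute value. -/
noncomputable def smoothAbs (ε t : ℝ) : ℝ := Real.sqrt (t ^ 2 + ε ^ 2) - ε

/-- The smooth function `t / √(t² + ε²)`, an approximation of the sign. -/
noncomputable def smoothSign (ε t : ℝ) : ℝ := t / Real.sqrt (t ^ 2 + ε ^ 2)

lemma sqrt_sq_add_sq_pos {ε : ℝ} (hε : 0 < ε) (t : ℝ) : 0 < Real.sqrt (t ^ 2 + ε ^ 2) :=
  Real.sqrt_pos.2 (by positivity)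

lemma abs_le_sqrt_sq_add_sq (ε : ℝ) (t : ℝ) : |t| ≤ Real.sqrt (t ^ 2 + ε ^ 2) :=
  Real.abs_le_sqrt (by nlinarith)

lemma contDiff_smoothAbs {ε : ℝ} (hε : 0 < ε) : ContDiff ℝ ∞ (smoothAbs ε) :=
  (((contDiff_id.pow 2).add contDiff_const).sqrt fun t => by positivity).sub contDiff_const

lemma contDiff_smoothSign {ε : ℝ} (hε : 0 < ε) : ContDiff ℝ ∞ (smoothSign ε) :=
  contDiff_id.div (((contDiff_id.pow 2).add contDiff_const).sqrt fun t => by positivity)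
    fun t => (sqrt_sq_add_sq_pos hε t).ne'

lemma smoothAbs_zero {ε : ℝ} (hε : 0 < ε) : smoothAbs ε 0 = 0 := by
  simp [smoothAbs, Real.sqrt_sq hε.le]

lemma hasDerivAt_sqrt_sq_add_sq {ε : ℝ} (hε : 0 < ε) (t : ℝ) :
    HasDerivAt (fun t => Real.sqrt (t ^ 2 + ε ^ 2)) (smoothSign ε t) t := by
  have h := ((hasDerivAt_pow 2 t).add_const (ε ^ 2)).sqrt (by positivity)
  convert h using 1
  simp only [smoothSign]
  norm_num
  field_simp

lemma hasDerivAt_smoothAbs {ε : ℝ} (hε : 0 < ε) (t : ℝ) : HasDerivAt (smoothAbs ε) (smoothSign ε t) t :=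
  (hasDerivAt_sqrt_sq_add_sq hε t).sub_const ε

lemma abs_smoothSign_le {ε : ℝ} (hε : 0 < ε) (t : ℝ) : |smoothSign ε t| ≤ 1 := by
  rw [smoothSign, abs_div, abs_of_pos (sqrt_sq_add_sq_pos hε t),
    div_le_one (sqrt_sq_add_sq_pos hε t)]
  exact abs_le_sqrt_sq_add_sq ε t

lemma smoothAbs_nonneg (ε : ℝ) (t : ℝ) : 0 ≤ smoothAbs ε t := by
  rw [smoothAbs, sub_nonneg]
  exact Real.le_sqrt_of_sq_le (by nlinarith [sq_nonneg t])

lemma smoothAbs_le {ε : ℝ} (hε : 0 < ε) (t : ℝ) : smoothAbs ε t ≤ |t| := by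
  rw [smoothAbs, sub_le_iff_le_add]
  refine Real.sqrt_le_iff.2 ⟨by positivity, ?_⟩
  nlinarith [sq_abs t, abs_nonneg t]

lemma mul_smoothSign_nonneg {ε : ℝ} (hε : 0 < ε) (t : ℝ) : 0 ≤ t * smoothSign ε t := by
  rw [smoothSign, mul_div_assoc']
  exact div_nonneg (mul_self_nonneg t) (sqrt_sq_add_sq_pos hε t).le

lemma hasDerivAt_smoothSign {ε : ℝ} (hε : 0 < ε) (t : ℝ) : HasDerivAt (smoothSign ε)
    (ε ^ 2 / Real.sqrt (t ^ 2 + ε ^ 2) ^ 3) t := by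
  have hp := sqrt_sq_add_sq_pos hε t
  have hs : Real.sqrt (t ^ 2 + ε ^ 2) ^ 2 = t ^ 2 + ε ^ 2 := Real.sq_sqrt (by positivity)
  have h : HasDerivAt (smoothSign ε) _ t :=
    (hasDerivAt_id t).div (hasDerivAt_sqrt_sq_add_sq hε t) hp.ne'
  convert h using 1
  simp only [smoothSign, id]
  field_simp
  rw [hs]
  ring

lemma deriv_smoothSign_nonneg {ε : ℝ} (hε : 0 < ε) (t : ℝ) : 0 ≤ deriv (smoothSign ε) t := by
  rw [(hasDerivAt_smoothSign hε t).deriv]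
  have := sqrt_sq_add_sq_pos hε t
  positivity

lemma deriv_smoothSign_le {ε : ℝ} (hε : 0 < ε) (t : ℝ) : deriv (smoothSign ε) t ≤ 1 / ε := by
  rw [(hasDerivAt_smoothSign hε t).deriv, div_le_div_iff₀
    (pow_pos (sqrt_sq_add_sq_pos hε t) 3) hε]
  have h1 : ε ≤ Real.sqrt (t ^ 2 + ε ^ 2) := Real.le_sqrt_of_sq_le (by nlinarith [sq_nonneg t])
  have h2 := pow_le_pow_left₀ hε.le h1 3
  linarith

lemma IsTestFunction.comp_smooth {φ : Space N → ℝ} (hφ : IsTestFunction φ) {f : ℝ → ℝ}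
    (hf : ContDiff ℝ ∞ f) (hf0 : f 0 = 0) : IsTestFunction fun x => f (φ x) :=
  ⟨hf.comp hφ.1, hφ.2.comp_left hf0⟩

lemma gradient_comp_apply {φ : Space N → ℝ} (hφ : IsTestFunction φ) {f : ℝ → ℝ} {f' : ℝ}
    {x : Space N} (hf : HasDerivAt f f' (φ x)) :
    gradient (fun x => f (φ x)) x = f' • gradient φ x := by
  have h : HasFDerivAt (fun x => f (φ x)) _ x :=
    hf.comp_hasFDerivAt x (hφ.differentiable x).hasFDerivAt
  rw [gradient, h.fderiv, map_smul]
  rfl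

lemma IsTestFunction.mul {φ ψ : Space N → ℝ} (hφ : IsTestFunction φ) (hψ : IsTestFunction ψ) :
    IsTestFunction fun x => φ x * ψ x := ⟨hφ.1.mul hψ.1, hψ.2.mul_left⟩

lemma gradient_mul_apply {φ ψ : Space N → ℝ} (hφ : IsTestFunction φ) (hψ : IsTestFunction ψ)
    (x : Space N) :
    gradient (fun x => φ x * ψ x) x = φ x • gradient ψ x + ψ x • gradient φ x := by
  rw [gradient, fderiv_fun_mul (hφ.differentiable x) (hψ.differentiable x), map_add, map_smul,
    map_smul]
  rfl

/-- The weak equation against all test functions, in divided form. -/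
def WeakEquation (α : ℝ) (g : Space N → ℝ) (lam : ℝ) (u : Space N → ℝ)
    (G : Space N → Space N) : Prop :=
  ∀ v : Space N → ℝ, IsTestFunction v →
    ∫ x, inner ℝ (G x) (gradient v x) ∂weightMeasure N α =
      lam * ((∫ x, u x * v x ∂posMeasure g) - ∫ x, u x * v x ∂posMeasure fun x => - g x)

/-- Kato's inequality, tested against a nonnegative function: the weak equation is tested with the
product of a smoothed sign of `u` and `v`. -/
lemma WeakEquation.kato_nonneg {α : ℝ} (hα : 0 < α) {g : Space N → ℝ}
    (hg : LocallyIntegrable g volume) {lam : ℝ} (hlam : 0 < lam) {u : Space N → ℝ}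
    {G : Space N → Space N} (hE : WeakEquation α g lam u G) (hG : MemLp G 2 (weightMeasure N α))
    (hu₁ : MemLp u 2 (posMeasure g)) (hu₂ : MemLp u 2 (posMeasure fun x => - g x))
    {φ : ℕ → Space N → ℝ} (hφ : ∀ n, IsTestFunction (φ n))
    (hlim : ∀ᵐ x : Space N, Tendsto (fun n => φ n x) atTop (𝓝 (u x)))
    (hgrad : Tendsto (fun n => eLpNorm (fun x => gradient (φ n) x - G x) 2 (weightMeasure N α))
      atTop (𝓝 0)) {v : Space N → ℝ} (hv : IsTestFunction v) (hv0 : ∀ x, 0 ≤ v x) {ε : ℝ}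
    (hε : 0 < ε) :
    lam * ∫ x, u x * (smoothSign ε (u x) * v x) ∂posMeasure (fun x => - g x) ≤
      lam * ((eLpNorm u 2 (posMeasure g)).toReal * (eLpNorm v 2 (posMeasure g)).toReal) +
        (eLpNorm G 2 (weightMeasure N α)).toReal *
          (eLpNorm (gradient v) 2 (weightMeasure N α)).toReal := by
  set μ := weightMeasure N α with hμ
  obtain ⟨M, hM⟩ := hv.2.exists_bound_of_continuous hv.continuous
  have hM' : ∀ x, v x ≤ M := fun x => (le_abs_self _).trans (hM x)
  have hM0 : 0 ≤ M := (hv0 0).trans (hM' 0)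
  -- The limit `u` is not smooth, so the sign is taken of the approximations `φ n`, which gives
  -- admissible test functions. At fixed `ε` the index `n` tends to infinity.
  set w : ℕ → Space N → ℝ := fun n x => smoothSign ε (φ n x) * v x with hw
  have hθ0 : smoothSign ε 0 = 0 := by simp [smoothSign]
  have hθc : Continuous (smoothSign ε) := (contDiff_smoothSign hε).continuous
  have hθφ : ∀ n, IsTestFunction fun x => smoothSign ε (φ n x) := fun n =>
    (hφ n).comp_smooth (contDiff_smoothSign hε) hθ0
  have hwt : ∀ n, IsTestFunction (w n) := fun n => (hθφ n).mul hv
  have hwle : ∀ n x, |w n x| ≤ |v x| := fun n x => by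
    rw [hw, abs_mul]
    exact mul_le_of_le_one_left (abs_nonneg _) (abs_smoothSign_le hε _)
  have hdiff : ∀ n, MemLp (fun x => gradient (φ n) x - G x) 2 μ := fun n =>
    ((hφ n).memLp_gradient hα).sub hG
  have hgv := hv.memLp_gradient hα
  have hlower : ∀ n, -((M / ε) * ((eLpNorm G 2 μ).toReal *
      (eLpNorm (fun x => gradient (φ n) x - G x) 2 μ).toReal)) -
      (eLpNorm G 2 μ).toReal * (eLpNorm (gradient v) 2 μ).toReal ≤
      ∫ x, inner ℝ (G x) (gradient (w n) x) ∂μ := by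
    intro n
    obtain ⟨i1, c1⟩ := integral_norm_mul_norm_le hG (hdiff n)
    obtain ⟨i2, c2⟩ := integral_norm_mul_norm_le hG hgv
    have hi : Integrable (fun x => (inner ℝ (G x) (gradient (w n) x) : ℝ)) μ := by
      refine (integral_norm_mul_norm_le hG ((hwt n).memLp_gradient hα)).1.mono'
        (hG.1.inner (hwt n).continuous_gradient.aestronglyMeasurable)
        (Eventually.of_forall fun x => norm_inner_le_norm _ _)
    have hpt : ∀ x, -((M / ε) * (‖G x‖ * ‖gradient (φ n) x - G x‖)) - ‖G x‖ * ‖gradient v x‖ ≤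
        inner ℝ (G x) (gradient (w n) x) := by
      intro x
      have e1 : gradient (w n) x = smoothSign ε (φ n x) • gradient v x +
          (v x * deriv (smoothSign ε) (φ n x)) • gradient (φ n) x := by
        rw [hw, gradient_mul_apply (hθφ n) hv, gradient_comp_apply (hφ n)
          ((contDiff_smoothSign hε).differentiable (by simp) _).hasDerivAt, smul_smul]
      set c := v x * deriv (smoothSign ε) (φ n x) with hc
      have hc0 : 0 ≤ c := mul_nonneg (hv0 x) (deriv_smoothSign_nonneg hε _)
      have hcM : c ≤ M / ε := by
        rw [div_eq_mul_one_div]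
        exact mul_le_mul (hM' x) (deriv_smoothSign_le hε _) (deriv_smoothSign_nonneg hε _) hM0
      -- Writing `∇φ n = (∇φ n - G) + G` isolates the nonnegative term `c * ‖G x‖ ^ 2`, which is
      -- dropped. The remainder has a coefficient at most `M / ε` and vanishes in the limit.
      have e2 : (inner ℝ (G x) (gradient (w n) x) : ℝ) =
          smoothSign ε (φ n x) * inner ℝ (G x) (gradient v x) +
          c * inner ℝ (G x) (gradient (φ n) x - G x) + c * ‖G x‖ ^ 2 := by
        rw [e1, inner_add_right, real_inner_smul_right, real_inner_smul_right, inner_sub_right,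
          real_inner_self_eq_norm_sq]
        ring
      have b1 : |smoothSign ε (φ n x) * inner ℝ (G x) (gradient v x)| ≤
          ‖G x‖ * ‖gradient v x‖ := by
        rw [abs_mul]
        exact (mul_le_of_le_one_left (abs_nonneg _) (abs_smoothSign_le hε _)).trans
          (abs_real_inner_le_norm _ _)
      have b2 : |c * inner ℝ (G x) (gradient (φ n) x - G x)| ≤
          (M / ε) * (‖G x‖ * ‖gradient (φ n) x - G x‖) := by
        rw [abs_mul, abs_of_nonneg hc0]
        exact mul_le_mul hcM (abs_real_inner_le_norm _ _) (abs_nonneg _) (hc0.trans hcM)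
      have b3 : 0 ≤ c * ‖G x‖ ^ 2 := by positivity
      rw [e2]
      linarith [neg_le_of_abs_le b1, neg_le_of_abs_le b2]
    have hmono := integral_mono (((i1.const_mul (M / ε)).neg).sub i2) hi hpt
    have hME : 0 ≤ M / ε := by positivity
    refine le_trans ?_ hmono
    have e3 : ∫ x, ((-fun x => M / ε * (‖G x‖ * ‖gradient (φ n) x - G x‖)) -
        fun x => ‖G x‖ * ‖gradient v x‖) x ∂μ =
        -((M / ε) * ∫ x, ‖G x‖ * ‖gradient (φ n) x - G x‖ ∂μ) -
          ∫ x, ‖G x‖ * ‖gradient v x‖ ∂μ := by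
      rw [integral_sub' (i1.const_mul (M / ε)).neg i2, integral_neg', integral_const_mul]
    rw [e3]
    have := mul_le_mul_of_nonneg_left c1 hME
    linarith
  have hv₁ := hv.memLp_posMeasure hg
  have hv₂ := hv.memLp_posMeasure (g := fun x => - g x) hg.neg
  have hupper : ∀ n, ∫ x, u x * w n x ∂posMeasure g ≤
      (eLpNorm u 2 (posMeasure g)).toReal * (eLpNorm v 2 (posMeasure g)).toReal := by
    intro n
    obtain ⟨i, c⟩ := integral_norm_mul_norm_le hu₁ hv₁
    have hpt : ∀ x, ‖u x * w n x‖ ≤ ‖u x‖ * ‖v x‖ := fun x => by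
      rw [norm_mul]
      exact mul_le_mul_of_nonneg_left (hwle n x) (norm_nonneg _)
    exact ((le_abs_self _).trans (norm_integral_le_of_norm_le i (Eventually.of_forall hpt))).trans c
  have hstep : ∀ n, lam * ∫ x, u x * w n x ∂posMeasure (fun x => - g x) ≤
      lam * ((eLpNorm u 2 (posMeasure g)).toReal * (eLpNorm v 2 (posMeasure g)).toReal) +
        (M / ε) * ((eLpNorm G 2 μ).toReal *
          (eLpNorm (fun x => gradient (φ n) x - G x) 2 μ).toReal) +
        (eLpNorm G 2 μ).toReal * (eLpNorm (gradient v) 2 μ).toReal := by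
    intro n
    have h1 := hE _ (hwt n)
    have h2 := hlower n
    have h3 := mul_le_mul_of_nonneg_left (hupper n) hlam.le
    rw [h1] at h2
    linarith
  have hL : Tendsto (fun n => ∫ x, u x * w n x ∂posMeasure (fun x => - g x)) atTop
      (𝓝 (∫ x, u x * (smoothSign ε (u x) * v x) ∂posMeasure (fun x => - g x))) := by
    obtain ⟨i, -⟩ := integral_norm_mul_norm_le hu₂ hv₂
    refine tendsto_integral_of_dominated_convergence (fun x => ‖u x‖ * ‖v x‖)
      (fun n => hu₂.1.mul (hwt n).continuous.aestronglyMeasurable) i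
      (fun n => Eventually.of_forall fun x => ?_) ?_
    · rw [norm_mul]
      exact mul_le_mul_of_nonneg_left (hwle n x) (norm_nonneg _)
    · filter_upwards [(posMeasure_absolutelyContinuous fun x => - g x).ae_le hlim] with x hx
      exact (((hθc.tendsto _).comp hx).mul_const _).const_mul _
  have hR : Tendsto (fun n =>
      lam * ((eLpNorm u 2 (posMeasure g)).toReal * (eLpNorm v 2 (posMeasure g)).toReal) +
        (M / ε) * ((eLpNorm G 2 μ).toReal *
          (eLpNorm (fun x => gradient (φ n) x - G x) 2 μ).toReal) +
        (eLpNorm G 2 μ).toReal * (eLpNorm (gradient v) 2 μ).toReal) atTop (𝓝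
      (lam * ((eLpNorm u 2 (posMeasure g)).toReal * (eLpNorm v 2 (posMeasure g)).toReal) +
        (M / ε) * ((eLpNorm G 2 μ).toReal * 0) +
        (eLpNorm G 2 μ).toReal * (eLpNorm (gradient v) 2 μ).toReal)) := by
    have h0 := (ENNReal.tendsto_toReal ENNReal.zero_ne_top).comp hgrad
    rw [ENNReal.toReal_zero] at h0
    exact ((((h0.const_mul _).const_mul _).const_add _).add_const _)
  have := le_of_tendsto_of_tendsto' (hL.const_mul lam) hR hstep
  simpa using this

/-- Kato's inequality: `g⁻ |u|` belongs to the dual of the energy space. -/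
lemma WeakEquation.exists_bound {α : ℝ} (hα : 0 < α) {g : Space N → ℝ}
    (hg : LocallyIntegrable g volume) {K : ℝ} (hK0 : 0 ≤ K)
    (hK : ∀ v : Space N → ℝ, IsTestFunction v → (eLpNorm v 2 (posMeasure g)).toReal ≤
      K * (eLpNorm (gradient v) 2 (weightMeasure N α)).toReal)
    {lam : ℝ} (hlam : 0 < lam) {u : Space N → ℝ}
    {G : Space N → Space N} (hE : WeakEquation α g lam u G) (hG : MemLp G 2 (weightMeasure N α))
    (hu₁ : MemLp u 2 (posMeasure g)) (hu₂ : MemLp u 2 (posMeasure fun x => - g x))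
    {φ : ℕ → Space N → ℝ} (hφ : ∀ n, IsTestFunction (φ n))
    (hlim : ∀ᵐ x : Space N, Tendsto (fun n => φ n x) atTop (𝓝 (u x)))
    (hgrad : Tendsto (fun n => eLpNorm (fun x => gradient (φ n) x - G x) 2 (weightMeasure N α))
      atTop (𝓝 0)) :
    ∃ C : ℝ≥0∞, C ≠ ⊤ ∧ ∀ v : Space N → ℝ, IsTestFunction v →
      ∫⁻ x, ‖u x‖ₑ * ‖v x‖ₑ ∂posMeasure (fun x => - g x) ≤
        C * eLpNorm (gradient v) 2 (weightMeasure N α) := by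
  set a := (eLpNorm u 2 (posMeasure g)).toReal
  set b := (eLpNorm G 2 (weightMeasure N α)).toReal
  have ha : 0 ≤ a := ENNReal.toReal_nonneg
  have hb : 0 ≤ b := ENNReal.toReal_nonneg
  -- The constant is the right-hand side of `kato_nonneg` divided by `lam`. To reach `|v|`, that
  -- inequality is applied to `smoothAbs (ε n) (v x)`, nonnegative and with gradient no larger than
  -- that of `v`; Fatou's lemma then lets `ε n` tend to zero.
  refine ⟨ENNReal.ofReal (a * K + b / lam), ENNReal.ofReal_ne_top, fun v hv => ?_⟩
  set ε : ℕ → ℝ := fun n => 1 / ((n : ℝ) + 1) with hε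
  have hεpos : ∀ n, 0 < ε n := fun n => by simp only [hε]; positivity
  have hgv := hv.memLp_gradient hα
  have hvn : ∀ n, IsTestFunction fun x => smoothAbs (ε n) (v x) := fun n =>
    hv.comp_smooth (contDiff_smoothAbs (hεpos n)) (smoothAbs_zero (hεpos n))
  have hgn : ∀ n, (eLpNorm (gradient fun x => smoothAbs (ε n) (v x)) 2
      (weightMeasure N α)).toReal ≤ (eLpNorm (gradient v) 2 (weightMeasure N α)).toReal := by
    intro n
    refine ENNReal.toReal_mono hgv.2.ne (eLpNorm_mono fun x => ?_)
    rw [gradient_comp_apply hv (hasDerivAt_smoothAbs (hεpos n) _), norm_smul]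
    exact mul_le_of_le_one_left (norm_nonneg _) (abs_smoothSign_le (hεpos n) _)
  have hv₂ := hv.memLp_posMeasure (g := fun x => - g x) hg.neg
  have hθc : ∀ n, Continuous (smoothSign (ε n)) := fun n =>
    (contDiff_smoothSign (hεpos n)).continuous
  have hmeas : ∀ n, AEStronglyMeasurable (fun x => u x * (smoothSign (ε n) (u x) *
      smoothAbs (ε n) (v x))) (posMeasure fun x => - g x) := fun n =>
    hu₂.1.mul (((hθc n).comp_aestronglyMeasurable hu₂.1).mul
      (hvn n).continuous.aestronglyMeasurable)
  refine lintegral_le_of_tendsto (f := fun n x => ENNReal.ofReal (u x * (smoothSign (ε n) (u x) *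
    smoothAbs (ε n) (v x)))) (fun n => (hmeas n).aemeasurable.ennreal_ofReal)
    (Eventually.of_forall fun x => ?_) fun n => ?_
  · rw [← enorm_mul, ← ofReal_norm, norm_mul, Real.norm_eq_abs, Real.norm_eq_abs]
    refine ENNReal.tendsto_ofReal ?_
    have hε0 : Tendsto (fun n => ε n ^ 2) atTop (𝓝 (0 ^ 2)) := tendsto_inv_succ.pow 2
    have hsq : ∀ t : ℝ, Tendsto (fun n => Real.sqrt (t ^ 2 + ε n ^ 2)) atTop (𝓝 |t|) := by
      intro t
      have := ((tendsto_const_nhds (x := t ^ 2)).add hε0).sqrt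
      rwa [zero_pow two_ne_zero, add_zero, Real.sqrt_sq_eq_abs] at this
    have h1 : Tendsto (fun n => smoothAbs (ε n) (v x)) atTop (𝓝 |v x|) := by
      have := (hsq (v x)).sub tendsto_inv_succ
      rwa [sub_zero] at this
    have h2 : Tendsto (fun n => u x * smoothSign (ε n) (u x)) atTop (𝓝 |u x|) := by
      by_cases hu0 : u x = 0
      · simp [hu0]
      · have h3 := (tendsto_const_nhds (x := u x * u x)).div (hsq (u x)) (abs_ne_zero.2 hu0)
        have h4 : u x * u x / |u x| = |u x| := by
          rw [← abs_mul_abs_self, mul_div_assoc, div_self (abs_ne_zero.2 hu0), mul_one]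
        rw [h4] at h3
        refine h3.congr fun n => ?_
        simp only [smoothSign, Pi.div_apply]
        ring
    refine (h2.mul h1).congr fun n => by ring
  · have hkato := hE.kato_nonneg hα hg hlam hG hu₁ hu₂ hφ hlim hgrad (hvn n)
      (fun x => smoothAbs_nonneg (ε n) _) (hεpos n)
    have hint : Integrable (fun x => u x * (smoothSign (ε n) (u x) * smoothAbs (ε n) (v x)))
        (posMeasure fun x => - g x) := by
      refine (integral_norm_mul_norm_le hu₂ hv₂).1.mono' (hmeas n)
        (Eventually.of_forall fun x => ?_)
      rw [norm_mul, norm_mul]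
      gcongr
      calc _ ≤ 1 * ‖smoothAbs (ε n) (v x)‖ := by
            gcongr; exact abs_smoothSign_le (hεpos n) _
        _ ≤ ‖v x‖ := by
            rw [one_mul, Real.norm_of_nonneg (smoothAbs_nonneg (ε n) _)]
            exact smoothAbs_le (hεpos n) _
    rw [← ofReal_integral_eq_lintegral_ofReal hint (Eventually.of_forall fun x => by
      beta_reduce
      rw [Pi.zero_apply, ← mul_assoc]
      exact mul_nonneg (mul_smoothSign_nonneg (hεpos n) _) (smoothAbs_nonneg (ε n) _)),
      ← ENNReal.ofReal_toReal hgv.2.ne, ← ENNReal.ofReal_mul (by positivity)]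
    refine ENNReal.ofReal_le_ofReal ?_
    have h1 := (hK _ (hvn n)).trans (mul_le_mul_of_nonneg_left (hgn n) hK0)
    have h2 := mul_le_mul_of_nonneg_left (mul_le_mul_of_nonneg_left h1 ha) hlam.le
    have h3 := mul_le_mul_of_nonneg_left (hgn n) hb
    have h4 := hkato.trans (add_le_add h2 h3)
    rw [← mul_le_mul_iff_right₀ hlam]
    refine h4.trans (le_of_eq ?_)
    field_simp

/-! ### From weak eigenvectors to eigenfunctions -/

lemma L2_inner_eq_integral {X E : Type*} [MeasurableSpace X] {μ : Measure X}
    [NormedAddCommGroup E] [InnerProductSpace ℝ E] (x y : Lp E 2 μ) {f h : X → E}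
    (hf : x =ᵐ[μ] f) (hh : y =ᵐ[μ] h) : (inner ℝ x y : ℝ) = ∫ z, inner ℝ (f z) (h z) ∂μ := by
  rw [L2.inner_def]
  refine integral_congr_ae ?_
  filter_upwards [hf, hh] with z h1 h2
  rw [h1, h2]

lemma integral_weightMeasure (α : ℝ) (F : Space N → ℝ) :
    ∫ x, F x ∂weightMeasure N α = ∫ x, ‖x‖ ^ α * F x := by
  have hm : Measurable fun x : Space N => ENNReal.ofReal (‖x‖ ^ α) := by fun_prop
  rw [weightMeasure, integral_withDensity_eq_integral_toReal_smul hm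
    (Eventually.of_forall fun _ => by simp)]
  refine integral_congr_ae (Eventually.of_forall fun x => ?_)
  beta_reduce
  rw [ENNReal.toReal_ofReal (by positivity), smul_eq_mul]

lemma max_zero_sub_max_neg_zero (a : ℝ) : max a 0 - max (-a) 0 = a := by
  rcases le_total a 0 with h | h
  · rw [max_eq_right h, max_eq_left (by simpa using h)]; simp
  · rw [max_eq_left h, max_eq_right (by simpa using h)]; simp

lemma integrable_of_integrable_posMeasure {g : Space N → ℝ} (hg : LocallyIntegrable g volume)
    {F : Space N → ℝ} (h₁ : Integrable F (posMeasure g))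
    (h₂ : Integrable F (posMeasure fun x => - g x)) : Integrable (fun x => g x * F x) ∧
      ∫ x, g x * F x = ∫ x, F x ∂posMeasure g - ∫ x, F x ∂posMeasure (fun x => - g x) := by
  have i₁ := (integrable_posMeasure_iff hg).1 h₁
  have i₂ := (integrable_posMeasure_iff (g := fun x => - g x) hg.neg).1 h₂
  have he : ∀ x, max (g x) 0 * F x - max (- g x) 0 * F x = g x * F x := fun x => by
    rw [← sub_mul, max_zero_sub_max_neg_zero]
  refine ⟨(i₁.sub i₂).congr (Eventually.of_forall he), ?_⟩
  rw [integral_posMeasure hg, integral_posMeasure (g := fun x => - g x) hg.neg,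
    ← integral_sub i₁ i₂]
  exact integral_congr_ae (Eventually.of_forall fun x => (he x).symm)

/-- Convergence of gradients in the weighted `L²` space implies convergence of the form. -/
lemma tendsto_integral_inner {X E : Type*} [MeasurableSpace X] {μ : Measure X}
    [NormedAddCommGroup E] [InnerProductSpace ℝ E] {G H : X → E} (hG : MemLp G 2 μ)
    (hH : MemLp H 2 μ) {w : ℕ → X → E} (hw : ∀ n, MemLp (w n) 2 μ)
    (hlim : Tendsto (fun n => eLpNorm (fun x => w n x - H x) 2 μ) atTop (𝓝 0)) :
    Tendsto (fun n => ∫ x, (inner ℝ (G x) (w n x) : ℝ) ∂μ) atTop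
      (𝓝 (∫ x, inner ℝ (G x) (H x) ∂μ)) := by
  have h1 : Tendsto (fun n => (hw n).toLp) atTop (𝓝 hH.toLp) := by
    rw [Lp.tendsto_Lp_iff_tendsto_eLpNorm'']
    exact hlim
  have h2 := (tendsto_const_nhds (x := hG.toLp)).inner (𝕜 := ℝ) h1
  rw [L2_inner_eq_integral _ _ hG.coeFn_toLp hH.coeFn_toLp] at h2
  exact h2.congr fun n => L2_inner_eq_integral _ _ hG.coeFn_toLp (hw n).coeFn_toLp

/-- A bound for the form of a positive potential in terms of norms. -/
lemma CompactForm.exists_eLpNorm_le {α : ℝ} (hα : 0 < α) {g : Space N → ℝ}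
    (hg : LocallyIntegrable g volume) (hcf : CompactForm α fun x => ENNReal.ofReal (g x)) :
    ∃ K : ℝ, 0 ≤ K ∧ ∀ v : Space N → ℝ, IsTestFunction v → (eLpNorm v 2 (posMeasure g)).toReal ≤
      K * (eLpNorm (gradient v) 2 (weightMeasure N α)).toReal := by
  obtain ⟨C, hC, hb⟩ := hcf.formBound
  refine ⟨Real.sqrt C.toReal, Real.sqrt_nonneg _, fun v hv => ?_⟩
  have h1 := hv.memLp_posMeasure hg
  have h2 := hv.memLp_gradient hα
  rw [← Lp.norm_toLp v h1, ← Lp.norm_toLp _ h2]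
  refine norm_le_of_enorm_sq_le hC ?_
  rw [Lp.enorm_toLp, Lp.enorm_toLp, lintegral_posMeasure_sq hg hv, ← energy_eq_eLpNorm hα hv]
  exact hb v hv

/-- A weak eigenvector in the form domain is an eigenfunction. -/
lemma isEigenvalue_of_mem_formDomain (hN : 3 ≤ N) {α : ℝ} (hα0 : 0 < α) (hα : α < 2)
    {g : Space N → ℝ} (hg : LocallyIntegrable g volume)
    (hcf : CompactForm α fun x => ENNReal.ofReal (g x)) {lam : ℝ} (hlam : 0 < lam)
    {x : FormSpace N α g} (hx : x ∈ formDomain N α g) (hx0 : x.1 ≠ 0)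
    (heq : ∀ z ∈ formDomain N α g,
      inner ℝ x.1 z.1 = lam * (inner ℝ x.2.2 z.2.2 - inner ℝ x.2.1 z.2.1)) :
    IsEigenvalue α g lam := by
  obtain ⟨s, φ, -, hφ, hr, hs⟩ := exists_seq_tendsto_of_mem_formDomain hx
  obtain ⟨k, u, hk, hlim⟩ := exists_ae_limit hα0 hα hN hφ hr hs
  have hsk := hs.comp hk.tendsto_atTop
  have hG : MemLp x.1 2 (weightMeasure N α) := Lp.memLp x.1
  have hgrad : Tendsto (fun n => eLpNorm (fun z => gradient (φ (k n)) z - x.1 z) 2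
      (weightMeasure N α)) atTop (𝓝 0) := by
    have h1 := (Lp.tendsto_Lp_iff_tendsto_eLpNorm' _ _).1 ((continuous_fst.tendsto x).comp hsk)
    refine h1.congr fun n => eLpNorm_congr_ae ?_
    filter_upwards [(hr (k n)).1] with z hz
    rw [Pi.sub_apply, ← hz]
    rfl
  have hx2 : x.2.2 =ᵐ[posMeasure g] u :=
    ae_eq_of_tendsto_Lp ((continuous_snd.snd.tendsto x).comp hsk) (fun n => (hr (k n)).2.2)
      ((posMeasure_absolutelyContinuous g).ae_le hlim)
  have hx1 : x.2.1 =ᵐ[posMeasure fun x => - g x] u :=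
    ae_eq_of_tendsto_Lp ((continuous_snd.fst.tendsto x).comp hsk) (fun n => (hr (k n)).2.1)
      ((posMeasure_absolutelyContinuous _).ae_le hlim)
  have hu₁ : MemLp u 2 (posMeasure g) := (Lp.memLp x.2.2).ae_eq hx2
  have hu₂ : MemLp u 2 (posMeasure fun x => - g x) := (Lp.memLp x.2.1).ae_eq hx1
  have hE : WeakEquation α g lam u x.1 := by
    intro v hv
    obtain ⟨z, hz, hzr⟩ := exists_represents hα0 hg hv
    have h1 := heq z (Submodule.le_topologicalClosure _ hz)
    rw [L2_inner_eq_integral _ _ (ae_eq_refl _) hzr.1, L2_inner_eq_integral _ _ hx2 hzr.2.2,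
      L2_inner_eq_integral _ _ hx1 hzr.2.1] at h1
    simpa [mul_comm] using h1
  obtain ⟨K, hK0, hK⟩ := hcf.exists_eLpNorm_le hα0 hg
  obtain ⟨C₂, hC₂, hb₂⟩ := hE.exists_bound hα0 hg hK0 hK hlam hG hu₁ hu₂
    (fun n => hφ (k n)) hlim hgrad
  have hb₁ : ∀ v : Space N → ℝ, IsTestFunction v → ∫⁻ x, ‖u x‖ₑ * ‖v x‖ₑ ∂posMeasure g ≤
      (eLpNorm u 2 (posMeasure g) * ENNReal.ofReal K) *
        eLpNorm (gradient v) 2 (weightMeasure N α) := by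
    intro v hv
    have hv₁ := hv.memLp_posMeasure hg
    have hv₂ := hv.memLp_gradient hα0
    have h1 := eLpNorm_le_eLpNorm_mul_eLpNorm_of_nnnorm (p := 2) (q := 2) (r := 1) hu₁.1 hv₁.1
      (fun a b => a * b) 1 (Eventually.of_forall fun x => by simp)
    rw [eLpNorm_one_eq_lintegral_enorm] at h1
    simp only [enorm_mul, ENNReal.coe_one, one_mul] at h1
    refine h1.trans ?_
    rw [mul_assoc]
    gcongr
    rw [← ENNReal.ofReal_toReal hv₁.2.ne, ← ENNReal.ofReal_toReal hv₂.2.ne,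
      ← ENNReal.ofReal_mul hK0]
    exact ENNReal.ofReal_le_ofReal (hK v hv)
  -- If `u` vanished, so would the last two components of `x`, and the equation tested with `x`
  -- itself would force `x.1 = 0`.
  refine ⟨hlam, u, x.1, ⟨hG, _, fun n => hφ (k n), hlim, hgrad⟩, fun hu0 => ?_, ?_⟩
  · have h2 : x.2.2 = 0 := (Lp.eq_zero_iff_ae_eq_zero).2
      (hx2.trans ((posMeasure_absolutelyContinuous g).ae_le hu0))
    have h1 : x.2.1 = 0 := (Lp.eq_zero_iff_ae_eq_zero).2
      (hx1.trans ((posMeasure_absolutelyContinuous _).ae_le hu0))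
    have h3 := heq x hx
    rw [h1, h2, inner_zero_left, inner_zero_left, sub_zero, mul_zero] at h3
    exact hx0 (inner_self_eq_zero.1 h3)
  -- Such a `v` need not come from the form domain, so the equation is passed to the limit along `w
  -- n`. The bounds `hb₁` and `hb₂` make the two parts of the right-hand side converge.
  · rintro v H ⟨hH, w, hw, hwlim, hwgrad⟩
    obtain ⟨i₁, t₁⟩ := MemW.integrable_mul (posMeasure_absolutelyContinuous g) hu₁.1
      (ENNReal.mul_ne_top hu₁.2.ne ENNReal.ofReal_ne_top) hb₁ hα0 hH hw hwlim hwgrad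
    obtain ⟨i₂, t₂⟩ := MemW.integrable_mul (posMeasure_absolutelyContinuous _) hu₂.1
      hC₂ hb₂ hα0 hH hw hwlim hwgrad
    obtain ⟨i, e⟩ := integrable_of_integrable_posMeasure hg i₁ i₂
    simp only [← mul_assoc] at i e
    refine ⟨i, ?_⟩
    rw [e, ← integral_weightMeasure]
    have t := tendsto_integral_inner hG hH (fun n => (hw n).memLp_gradient hα0) hwgrad
    exact tendsto_nhds_unique t (((t₁.sub t₂).const_mul lam).congr fun n => (hE _ (hw n)).symm)

end WeightedEigen

/-! ### The increasing sequence of eigenvalues -/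

theorem theorem1 (N : ℕ) (hN : 3 ≤ N) (α : ℝ) (hα : α ∈ Set.Ioo (0 : ℝ) 2)
    (g : WeightedEigen.Space N → ℝ) (hg : WeightedEigen.ConditionG α g) :
    ∃ lam : ℕ → ℝ, StrictMono lam ∧ Tendsto lam atTop atTop ∧
      ∀ n, 0 < lam n ∧ WeightedEigen.IsEigenvalue α g (lam n) := by
  have hex : ∀ R : ℝ, ∃ lam, R < lam ∧ WeightedEigen.IsEigenvalue α g lam := by
    intro R
    obtain ⟨lam, hR, hlam, x, hx, hx0, heq⟩ := hg.exists_weak_eigenvector hN hα.1 hα.2 R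
    exact ⟨lam, hR, WeightedEigen.isEigenvalue_of_mem_formDomain hN hα.1 hα.2
      hg.locallyIntegrable (hg.compactForm hα.1 hα.2 hN) hlam hx hx0 heq⟩
  choose f hf hfe using hex
  -- Each new eigenvalue is taken beyond the previous one, for strict monotonicity, and beyond its
  -- own index, for divergence.
  let lam : ℕ → ℝ := fun n => Nat.rec (f 0) (fun n a => f (max a (n + 1))) n
  have hsucc : ∀ n, lam (n + 1) = f (max (lam n) (n + 1)) := fun n => rfl
  have hev : ∀ n, WeightedEigen.IsEigenvalue α g (lam n) := by
    rintro (_ | n)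
    · exact hfe 0
    · rw [hsucc]
      exact hfe _
  refine ⟨lam, strictMono_nat_of_lt_succ fun n => ?_, ?_, fun n => ⟨(hev n).1, hev n⟩⟩
  · rw [hsucc]
    exact (le_max_left _ _).trans_lt (hf _)
  · refine tendsto_atTop_mono (fun n => ?_) tendsto_natCast_atTop_atTop
    rcases n with _ | n
    · simpa using (hev 0).1.le
    · rw [hsucc, Nat.cast_succ]
      exact (le_max_right _ _).trans (hf _).le
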